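/- Let $k$ be a field or, more generally, a commutative ring, and let $A$ be an associative unital $k$-algebra that is projective as a $k$-module. Write $\otimes=\otimes_k$ and $A^e=A\otimes A^{op}$, and regard $A$-bimodules (over $k$) as left $A^e$-modules. Groups $\operatorname{Ext}^i_{A^e}(A,A\otimes A)$ are formed with the outer bimodule structure $a(x\otimes y)b=ax\otimes yb$ of $A\otimes A$, and are $A$-bimodules through the inner structure $a(x\otimes y)b=xb\otimes ay$. Let $d\ge 0$ and suppose that $A$ satisfies the conditions for van den Bergh duality of dimension $d$, that is: 1. $A$ has a resolution of finite length by finitely generated projective $A$-bimodules; 2. $\operatorname{Ext}^i_{A^e}(A,A\otimes A)=0$ for all $i\ne d$; 3. the dualizing bimodule $U=\operatorname{Ext}^d_{A^e}(A,A\otimes A)$ is invertible, i.e. there is an $A$-bimodule $V$ with $U\otimes_A V\cong A\cong V\otimes_A U$ as bimodules. Then there are an $A$-bimodule $V=U^{\otimes_A(-1)}$ and bimodule isomorphisms $U\otimes_AV\to A$, $u\otimes v\mapsto\langle u,v\rangle$, and $V\otimes_AU\to A$, $v\otimes u\mapsto\langle v,u\rangle$, which are compatible: $\langle u,v\rangle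 u'=u\langle v,u'\rangle$ and $\langle v,u\rangle v'=v\langle u,v'\rangle$ for all $u,u'\in U$, $v,v'\in V$. For every such choice put $U^{\otimes_A(-n)}=V^{\otimes_A n}$ for $n>0$, and let $$C=\bigoplus_{n\in\mathbb Z}U^{\otimes_A n}$$ be the $k$-algebra whose product is given by concatenation of tensors followed by contraction of adjacent factors from $U$ and $V$ through $\langle-,-\rangle$. Then $C$ is a Calabi-Yau algebra of dimension $d+1$: with $C^e=C\otimes C^{op}$, $C$ has a resolution of finite length by finitely generated projective $C$-bimodules, $\operatorname{Ext}^i_{C^e}(C,C\otimes C)=0$ for all $i\neq d+1$, and $\operatorname{Ext}^{d+1}_{C^e}(C,C\otimes C)\cong C$ as $C$-bimodules. -/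

import Mathlib

open scoped TensorProduct DirectSum
open MulOpposite

universe u

/-- An `A`-bimodule over `k`: commuting left and right actions of `A` (the right one written as an
action of `Aᵐᵒᵖ`, so that `op a • m` is `m · a`) which induce one and the same action of `k`. -/
structure Bimodule (k A : Type u) [CommRing k] [Ring A] [Algebra k A] where
  carrier : Type u
  [addCommGroup : AddCommGroup carrier]
  [base : Module k carrier]
  [left : Module A carrier]
  [right : Module Aᵐᵒᵖ carrier]
  [smulComm : SMulCommClass A Aᵐᵒᵖ carrier]
  [towerLeft : IsScalarTower k A carrier]
  [towerRight : IsScalarTower k Aᵐᵒᵖ carrier]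

namespace Bimodule

variable {k A : Type u} [CommRing k] [Ring A] [Algebra k A]

instance : CoeSort (Bimodule k A) (Type u) := ⟨Bimodule.carrier⟩

attribute [instance] addCommGroup base left right smulComm towerLeft towerRight

instance (M : Bimodule k A) : SMulCommClass k A M := IsScalarTower.to_smulCommClass
instance (M : Bimodule k A) : SMulCommClass A k M := IsScalarTower.to_smulCommClass'
instance (M : Bimodule k A) : SMulCommClass k Aᵐᵒᵖ M := IsScalarTower.to_smulCommClass
instance (M : Bimodule k A) : SMulCommClass Aᵐᵒᵖ k M := IsScalarTower.to_smulCommClass'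

/-- Isomorphisms of bimodules. -/
structure Iso (M N : Bimodule k A) extends M ≃ₗ[k] N where
  map_left : ∀ (a : A) (m : M), toFun (a • m) = a • toFun m
  map_right : ∀ (a : A) (m : M), toFun (op a • m) = op a • toFun m

variable (k A) in
/-- The algebra `A` as a bimodule over itself. -/
def unit : Bimodule k A where
  carrier := A

/-- An element of the bimodule `A`, seen as an element of the algebra `A`. -/
def toAlg (x : unit k A) : A := x

section Tensor

variable (M N : Bimodule k A)

/-- The relations `m a ⊗ n = m ⊗ a n`. -/
def balanced : Submodule k (M ⊗[k] N) :=
  Submodule.span k {t | ∃ (m : M) (a : A) (n : N), t = (op a • m) ⊗ₜ[k] n - m ⊗ₜ[k] (a • n)}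

/-- The underlying `k`-module of `M ⊗_A N`. -/
abbrev TensorCarrier : Type u := (M ⊗[k] N) ⧸ balanced M N

variable {M N}

/-- The pure tensor `m ⊗ n` in `M ⊗_A N`. -/
def pureTensor (m : M) (n : N) : TensorCarrier M N := (balanced M N).mkQ (m ⊗ₜ[k] n)

theorem pureTensor_balanced (m : M) (a : A) (n : N) :
    pureTensor (op a • m) n = pureTensor m (a • n) := by
  unfold pureTensor
  rw [← sub_eq_zero, ← map_sub, Submodule.mkQ_apply, Submodule.Quotient.mk_eq_zero]
  exact Submodule.subset_span ⟨m, a, n, rfl⟩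

theorem tensor_ext {Q : Type*} [AddCommGroup Q] [Module k Q] {f g : TensorCarrier M N →ₗ[k] Q}
    (h : ∀ m n, f (pureTensor m n) = g (pureTensor m n)) : f = g := by
  apply Submodule.linearMap_qext
  apply TensorProduct.ext'
  exact h

/-- A `k`-bilinear `A`-balanced map on `M × N` induces a linear map on `M ⊗_A N`. -/
def tensorLift {Q : Type*} [AddCommGroup Q] [Module k Q] (F : M →ₗ[k] N →ₗ[k] Q)
    (hF : ∀ (m : M) (a : A) (n : N), F (op a • m) n = F m (a • n)) : TensorCarrier M N →ₗ[k] Q :=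
  (balanced M N).liftQ (TensorProduct.lift F) (by
    unfold balanced
    rw [Submodule.span_le]
    rintro _ ⟨m, a, n, rfl⟩
    simp [hF])

@[simp]
theorem tensorLift_pureTensor {Q : Type*} [AddCommGroup Q] [Module k Q] (F : M →ₗ[k] N →ₗ[k] Q)
    (hF : ∀ (m : M) (a : A) (n : N), F (op a • m) n = F m (a • n)) (m : M) (n : N) :
    tensorLift F hF (pureTensor m n) = F m n := by
  simp [tensorLift, pureTensor]

variable (M N) in
/-- The bilinear map `(m, n) ↦ m ⊗ n`. -/
def tensorMk : M →ₗ[k] N →ₗ[k] TensorCarrier M N :=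
  (TensorProduct.mk k M N).compr₂ (balanced M N).mkQ

@[simp]
theorem tensorMk_apply (m : M) (n : N) : tensorMk M N m n = pureTensor m n := rfl

theorem pureTensor_add_left (m m' : M) (n : N) :
    pureTensor (m + m') n = pureTensor m n + pureTensor m' n := by
  rw [← tensorMk_apply, map_add, LinearMap.add_apply, tensorMk_apply, tensorMk_apply]

theorem pureTensor_add_right (m : M) (n n' : N) :
    pureTensor m (n + n') = pureTensor m n + pureTensor m n' := by
  rw [← tensorMk_apply, map_add, tensorMk_apply, tensorMk_apply]

theorem pureTensor_smul_left (c : k) (m : M) (n : N) :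
    pureTensor (c • m) n = c • pureTensor m n := by
  rw [← tensorMk_apply, map_smul, LinearMap.smul_apply, tensorMk_apply]

theorem pureTensor_smul_right (c : k) (m : M) (n : N) :
    pureTensor m (c • n) = c • pureTensor m n := by
  rw [← tensorMk_apply, map_smul, tensorMk_apply]

theorem pureTensor_zero_left (n : N) : pureTensor (0 : M) n = 0 := by
  rw [← tensorMk_apply, map_zero, LinearMap.zero_apply]

theorem pureTensor_zero_right (m : M) : pureTensor m (0 : N) = 0 := by
  rw [← tensorMk_apply, map_zero]

variable (M N) in
/-- The map `m ⊗ n ↦ a m ⊗ n`. -/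
def tensorLeftMap (a : A) : TensorCarrier M N →ₗ[k] TensorCarrier M N :=
  tensorLift ((tensorMk M N).comp (Algebra.lsmul k k M a)) (by
    intro m b n
    simp [smul_comm a (op b) m, pureTensor_balanced])

@[simp]
theorem tensorLeftMap_pureTensor (a : A) (m : M) (n : N) :
    tensorLeftMap M N a (pureTensor m n) = pureTensor (a • m) n := by
  exact tensorLift_pureTensor _ _ m n

variable (M N) in
/-- The map `m ⊗ n ↦ m ⊗ n a`. -/
def tensorRightMap (a : Aᵐᵒᵖ) : TensorCarrier M N →ₗ[k] TensorCarrier M N :=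
  tensorLift ((tensorMk M N).compl₂ (Algebra.lsmul k k N a)) (by
    intro m b n
    simp [smul_comm b a n, pureTensor_balanced])

@[simp]
theorem tensorRightMap_pureTensor (a : Aᵐᵒᵖ) (m : M) (n : N) :
    tensorRightMap M N a (pureTensor m n) = pureTensor m (a • n) := by
  exact tensorLift_pureTensor _ _ m n

variable (M N) in
/-- The left action of `A` on `M ⊗_A N`. -/
def tensorLeft : A →+* Module.End k (TensorCarrier M N) where
  toFun := tensorLeftMap M N
  map_one' := tensor_ext fun m n => by simp
  map_mul' a b := tensor_ext fun m n => by simp [mul_smul]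
  map_zero' := tensor_ext fun m n => by simp [pureTensor_zero_left]
  map_add' a b := tensor_ext fun m n => by simp [add_smul, pureTensor_add_left]

variable (M N) in
/-- The right action of `A` on `M ⊗_A N`. -/
def tensorRight : Aᵐᵒᵖ →+* Module.End k (TensorCarrier M N) where
  toFun := tensorRightMap M N
  map_one' := tensor_ext fun m n => by simp
  map_mul' a b := tensor_ext fun m n => by simp [mul_smul]
  map_zero' := tensor_ext fun m n => by simp [pureTensor_zero_right]
  map_add' a b := tensor_ext fun m n => by simp [add_smul, pureTensor_add_right]

variable (M N) in
/-- The bimodule `M ⊗_A N`, with `a · (m ⊗ n) · b = a m ⊗ n b`. -/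
def tensor : Bimodule k A :=
  letI : Module A (TensorCarrier M N) := Module.compHom _ (tensorLeft M N)
  letI : Module Aᵐᵒᵖ (TensorCarrier M N) := Module.compHom _ (tensorRight M N)
  { carrier := TensorCarrier M N
    smulComm := ⟨fun a b t => LinearMap.congr_fun
      (f := (tensorLeftMap M N a).comp (tensorRightMap M N b))
      (g := (tensorRightMap M N b).comp (tensorLeftMap M N a))
      (tensor_ext fun m n => by simp) t⟩
    towerLeft := ⟨fun c a t => LinearMap.congr_fun
      (f := tensorLeftMap M N (c • a)) (g := c • tensorLeftMap M N a)
      (tensor_ext fun m n => by simp [pureTensor_smul_left]) t⟩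
    towerRight := ⟨fun c a t => LinearMap.congr_fun
      (f := tensorRightMap M N (c • a)) (g := c • tensorRightMap M N a)
      (tensor_ext fun m n => by simp [pureTensor_smul_right]) t⟩ }

variable (M N) in
/-- The bilinear map `(m, n) ↦ m ⊗ n` with values in the bimodule `M ⊗_A N`. -/
def mkTensor : M →ₗ[k] N →ₗ[k] tensor M N := tensorMk M N

/-- The element `m ⊗ n` of the bimodule `M ⊗_A N`. -/
def tmul (m : M) (n : N) : tensor M N := mkTensor M N m n

theorem mkTensor_apply (m : M) (n : N) : mkTensor M N m n = tmul m n := rfl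

theorem tmul_balanced (m : M) (a : A) (n : N) : tmul (op a • m) n = tmul m (a • n) :=
  pureTensor_balanced m a n

theorem smul_tmul (a : A) (m : M) (n : N) : a • tmul m n = tmul (a • m) n :=
  tensorLeftMap_pureTensor a m n

theorem op_smul_tmul (a : A) (m : M) (n : N) : op a • tmul m n = tmul m (op a • n) :=
  tensorRightMap_pureTensor (op a) m n

/-- A `k`-bilinear `A`-balanced map on `M × N` induces a linear map on `M ⊗_A N`. -/
def lift {Q : Type*} [AddCommGroup Q] [Module k Q] (F : M →ₗ[k] N →ₗ[k] Q)
    (hF : ∀ (m : M) (a : A) (n : N), F (op a • m) n = F m (a • n)) : tensor M N →ₗ[k] Q :=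
  tensorLift F hF

theorem lift_tmul {Q : Type*} [AddCommGroup Q] [Module k Q] (F : M →ₗ[k] N →ₗ[k] Q)
    (hF : ∀ (m : M) (a : A) (n : N), F (op a • m) n = F m (a • n)) (m : M) (n : N) :
    lift F hF (tmul m n) = F m n :=
  tensorLift_pureTensor F hF m n

theorem hom_ext {Q : Type*} [AddCommGroup Q] [Module k Q] {f g : tensor M N →ₗ[k] Q}
    (h : ∀ m n, f (tmul m n) = g (tmul m n)) : f = g :=
  tensor_ext h

@[elab_as_elim]
theorem tensor_induction {C : tensor M N → Prop} (t : tensor M N)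
    (tmul : ∀ m n, C (tmul m n)) (add : ∀ x y, C x → C y → C (x + y)) : C t := by
  obtain ⟨s, rfl⟩ := (balanced M N).mkQ_surjective t
  induction s using TensorProduct.induction_on with
  | zero =>
    have h := tmul 0 0
    have h' : Bimodule.tmul (0 : M) (0 : N) = (balanced M N).mkQ 0 :=
      (map_zero (mkTensor M N 0)).trans (map_zero (balanced M N).mkQ).symm
    rwa [h'] at h
  | tmul m n => exact tmul m n
  | add x y hx hy => rw [map_add]; exact add _ _ hx hy

end Tensor

/-- The tensor powers `M^{⊗_A n}` for `n ≥ 0`. -/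
def pow (M : Bimodule k A) : ℕ → Bimodule k A
  | 0 => unit k A
  | n + 1 => tensor M (pow M n)

section Pow

variable {M : Bimodule k A}

variable (M) in
/-- The identification of `A` with `M^{⊗ 0}`. -/
def powZero : A →ₗ[k] pow M 0 := (LinearMap.id : A →ₗ[k] A)

variable (M) in
/-- The bilinear map `M × M^{⊗ n} → M^{⊗ (n + 1)}`, `(w, p) ↦ w ⊗ p`. -/
def powCons (n : ℕ) : M →ₗ[k] pow M n →ₗ[k] pow M (n + 1) := mkTensor M (pow M n)

theorem smul_powZero (a b : A) : a • powZero M b = powZero M (a * b) := rfl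

theorem powCons_balanced (n : ℕ) (w : M) (a : A) (p : pow M n) :
    powCons M n (op a • w) p = powCons M n w (a • p) := tmul_balanced w a p

theorem smul_powCons (n : ℕ) (a : A) (w : M) (p : pow M n) :
    a • powCons M n w p = powCons M n (a • w) p := smul_tmul a w p

/-- A linear map on `M^{⊗ (n + 1)}` given by a balanced bilinear map on `M × M^{⊗ n}`. -/
def powLift {n : ℕ} {Q : Type*} [AddCommGroup Q] [Module k Q] (F : M →ₗ[k] pow M n →ₗ[k] Q)
    (hF : ∀ (m : M) (a : A) (p : pow M n), F (op a • m) p = F m (a • p)) :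
    pow M (n + 1) →ₗ[k] Q :=
  lift F hF

theorem powLift_powCons {n : ℕ} {Q : Type*} [AddCommGroup Q] [Module k Q]
    (F : M →ₗ[k] pow M n →ₗ[k] Q)
    (hF : ∀ (m : M) (a : A) (p : pow M n), F (op a • m) p = F m (a • p)) (m : M) (p : pow M n) :
    powLift F hF (powCons M n m p) = F m p :=
  lift_tmul F hF m p

theorem pow_hom_ext {n : ℕ} {Q : Type*} [AddCommGroup Q] [Module k Q]
    {f g : pow M (n + 1) →ₗ[k] Q}
    (h : ∀ m p, f (powCons M n m p) = g (powCons M n m p)) : f = g :=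
  hom_ext h

@[elab_as_elim]
theorem pow_induction {n : ℕ} {C : pow M (n + 1) → Prop} (t : pow M (n + 1))
    (cons : ∀ w p, C (powCons M n w p)) (add : ∀ x y, C x → C y → C (x + y)) : C t :=
  tensor_induction (M := M) (N := pow M n) t cons add

end Pow

/-- A bimodule `U` is invertible if there is a bimodule `V` such that `U ⊗_A V` and `V ⊗_A U` are
both isomorphic to `A` as bimodules. -/
def IsInvertible (U : Bimodule k A) : Prop :=
  ∃ V : Bimodule k A, Nonempty (Iso (tensor U V) (unit k A)) ∧
    Nonempty (Iso (tensor V U) (unit k A))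

/-- A `k`-bilinear pairing `M × N → A` that is `A`-bilinear and `A`-balanced. -/
structure Pairing (M N : Bimodule k A) where
  toFun : M →ₗ[k] N →ₗ[k] A
  map_left : ∀ (a : A) (m : M) (n : N), toFun (a • m) n = a * toFun m n
  map_right : ∀ (a : A) (m : M) (n : N), toFun m (op a • n) = toFun m n * a
  balanced : ∀ (a : A) (m : M) (n : N), toFun (op a • m) n = toFun m (a • n)

/-- The pairing `(m, n) ↦ e (m ⊗ n)` given by an isomorphism `e : M ⊗_A N ≅ A`. -/
def Iso.pairing {M N : Bimodule k A} (e : Iso (tensor M N) (unit k A)) : Pairing M N where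
  toFun := (mkTensor M N).compr₂ e.toLinearEquiv.toLinearMap
  map_left a m n := (congrArg e.toFun (smul_tmul a m n).symm).trans (e.map_left a (tmul m n))
  map_right a m n := (congrArg e.toFun (op_smul_tmul a m n).symm).trans (e.map_right a (tmul m n))
  balanced a m n := congrArg e.toFun (tmul_balanced m a n)

/-- A choice of an inverse `U^{⊗_A (-1)}` of `U`: a bimodule `V` with isomorphisms `U ⊗_A V ≅ A` and
`V ⊗_A U ≅ A`, written `u ⊗ v ↦ ⟨u, v⟩` and `v ⊗ u ↦ ⟨v, u⟩`, that are compatible, in the sense that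
`⟨u, v⟩ u' = u ⟨v, u'⟩` and `⟨v, u⟩ v' = v ⟨u, v'⟩`. -/
structure Inverse (U : Bimodule k A) where
  inv : Bimodule k A
  evRight : Iso (tensor U inv) (unit k A)
  evLeft : Iso (tensor inv U) (unit k A)
  assoc_left : ∀ (u : U) (v : inv) (u' : U),
    evRight.pairing.toFun u v • u' = op (evLeft.pairing.toFun v u') • u
  assoc_right : ∀ (v : inv) (u : U) (v' : inv),
    evLeft.pairing.toFun v u • v' = op (evRight.pairing.toFun u v') • v

/-- The bilinear map `(n, p) ↦ ⟨m, n⟩ p`. -/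
def Pairing.contractAux {M N : Bimodule k A} (P : Pairing M N) (n : ℕ) (m : M) :
    N →ₗ[k] pow N n →ₗ[k] pow N n :=
  (Algebra.lsmul k k (pow N n)).toLinearMap.comp (P.toFun m)

theorem Pairing.contractAux_apply {M N : Bimodule k A} (P : Pairing M N) (n : ℕ) (m : M) (w : N)
    (p : pow N n) : P.contractAux n m w p = P.toFun m w • p := rfl

/-- The map `M × N^{⊗ (n + 1)} → N^{⊗ n}`, `(m, w ⊗ p) ↦ ⟨m, w⟩ p`. -/
def Pairing.contract {M N : Bimodule k A} (P : Pairing M N) (n : ℕ) (m : M) :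
    pow N (n + 1) →ₗ[k] pow N n :=
  powLift (P.contractAux n m) fun w a p => by
    rw [contractAux_apply, contractAux_apply, P.map_right, mul_smul]

theorem Pairing.contract_powCons {M N : Bimodule k A} (P : Pairing M N) (n : ℕ)
    (m : M) (w : N) (p : pow N n) : P.contract n m (powCons N n w p) = P.toFun m w • p := by
  rw [contract, powLift_powCons, contractAux_apply]

section Action

set_option linter.unusedSectionVars false

variable {X : Type u} [AddCommGroup X] [Module k X] [Module A X] [IsScalarTower k A X]
  {M : Bimodule k A}

/-- A `k`-bilinear map `M × X → X`, `(w, x) ↦ w x`, such that `(a w) x = a (w x)` and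
`(w a) x = w (a x)`. -/
structure Action (M : Bimodule k A) (X : Type u) [AddCommGroup X] [Module k X] [Module A X] where
  toFun : M →ₗ[k] Module.End k X
  map_left : ∀ (a : A) (w : M) (x : X), toFun (a • w) x = a • toFun w x
  map_right : ∀ (a : A) (w : M) (x : X), toFun (op a • w) x = toFun w (a • x)

/-- The map `(w, f) ↦ (p ↦ w ∘ f p)`. -/
def Action.consAux (L : Action M X) {n : ℕ} (f : pow M n →ₗ[k] Module.End k X) :
    M →ₗ[k] pow M n →ₗ[k] Module.End k X :=
  (LinearMap.mul k (Module.End k X)).compl₁₂ L.toFun f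

theorem Action.consAux_apply (L : Action M X) {n : ℕ} (f : pow M n →ₗ[k] Module.End k X) (w : M)
    (p : pow M n) (x : X) : L.consAux f w p x = L.toFun w (f p x) := rfl

/-- The action of the tensor powers of `M` on `X` that an action of `M` induces:
`(w₁ ⊗ ⋯ ⊗ wₙ ⊗ a) x = w₁ (⋯ (wₙ (a x)))`. -/
def Action.pow (L : Action M X) : (n : ℕ) → {f : pow M n →ₗ[k] Module.End k X //
    ∀ (a : A) (p : pow M n) (x : X), f (a • p) x = a • f p x}
  | 0 => ⟨(Algebra.lsmul k k X : A →ₐ[k] Module.End k X).toLinearMap,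
      fun a p x => mul_smul a (toAlg p) x⟩
  | n + 1 => ⟨powLift (L.consAux (L.pow n).1) fun w a p => LinearMap.ext fun x => by
        rw [consAux_apply, consAux_apply, L.map_right, (L.pow n).2],
      fun a t x => by
        induction t using pow_induction with
        | cons w p =>
          rw [smul_powCons, powLift_powCons, powLift_powCons, consAux_apply, consAux_apply,
            L.map_left]
        | add s t hs ht => simp only [smul_add, map_add, LinearMap.add_apply, hs, ht]⟩

theorem Action.pow_zero (L : Action M X) (a : A) (x : X) :
    (L.pow 0).1 (powZero M a) x = a • x := rfl

theorem Action.pow_succ (L : Action M X) (n : ℕ) (w : M) (p : Bimodule.pow M n) (x : X) :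
    (L.pow (n + 1)).1 (powCons M n w p) x = L.toFun w ((L.pow n).1 p x) := by
  rw [Action.pow, powLift_powCons, consAux_apply]

end Action

namespace Inverse

variable {U : Bimodule k A} (D : Inverse U)

/-- The tensor powers `U^{⊗_A n}` for all integers `n`; for `n > 0`, `U^{⊗_A (-n)}` is the `n`-th
tensor power of the inverse of `U`. -/
def zpow : ℤ → Bimodule k A
  | Int.ofNat n => pow U n
  | Int.negSucc n => pow D.inv (n + 1)

/-- The underlying `k`-module of the algebra `⨁ n : ℤ, U^{⊗_A n}`. -/
def Laurent : Type u := ⨁ n : ℤ, D.zpow n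

namespace Laurent

noncomputable instance : AddCommGroup D.Laurent :=
  inferInstanceAs (AddCommGroup (⨁ n : ℤ, D.zpow n))

noncomputable instance : Module k D.Laurent :=
  inferInstanceAs (Module k (⨁ n : ℤ, D.zpow n))

noncomputable instance : Module A D.Laurent :=
  inferInstanceAs (Module A (⨁ n : ℤ, D.zpow n))

instance : IsScalarTower k A D.Laurent :=
  inferInstanceAs (IsScalarTower k A (⨁ n : ℤ, D.zpow n))

/-- The inclusion of the component `U^{⊗_A n}`, `n ≥ 0`. -/
noncomputable def ofPos (n : ℕ) : pow U n →ₗ[k] D.Laurent :=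
  DirectSum.lof k ℤ (fun n => D.zpow n) (Int.ofNat n)

/-- The inclusion of the component `U^{⊗_A (-(n + 1))}`. -/
noncomputable def ofNegSucc (n : ℕ) : pow D.inv (n + 1) →ₗ[k] D.Laurent :=
  DirectSum.lof k ℤ (fun n => D.zpow n) (Int.negSucc n)

/-- The inclusion of the component `U^{⊗_A 0} = A`. -/
noncomputable def ofAlg : A →ₗ[k] D.Laurent := (ofPos D 0).comp (powZero U)

/-- The inclusion of the component `U^{⊗_A (-n)}`, `n ≥ 0`. -/
noncomputable def ofNeg : (n : ℕ) → pow D.inv n →ₗ[k] D.Laurent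
  | 0 => ofAlg D
  | n + 1 => ofNegSucc D n

/-- The linear map on the direct sum with given values on the components. -/
noncomputable def desc {Q : Type u} [AddCommGroup Q] [Module k Q] (f : ∀ n : ℕ, pow U n →ₗ[k] Q)
    (g : ∀ n : ℕ, pow D.inv (n + 1) →ₗ[k] Q) : D.Laurent →ₗ[k] Q :=
  DirectSum.toModule k ℤ Q (fun
    | Int.ofNat n => f n
    | Int.negSucc n => g n)

variable {D}

theorem ofNeg_zero (a : A) : ofNeg D 0 (powZero D.inv a) = ofAlg D a := rfl

theorem ofPos_zero (a : A) : ofPos D 0 (powZero U a) = ofAlg D a := rfl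

theorem desc_ofPos {Q : Type u} [AddCommGroup Q] [Module k Q] (f : ∀ n : ℕ, pow U n →ₗ[k] Q)
    (g : ∀ n : ℕ, pow D.inv (n + 1) →ₗ[k] Q) (n : ℕ) (p : pow U n) :
    desc D f g (ofPos D n p) = f n p :=
  DirectSum.toModule_lof k (M := fun n => D.zpow n) (Int.ofNat n) p

theorem desc_ofNeg {Q : Type u} [AddCommGroup Q] [Module k Q] (f : ∀ n : ℕ, pow U n →ₗ[k] Q)
    (g : ∀ n : ℕ, pow D.inv (n + 1) →ₗ[k] Q) (n : ℕ) (p : pow D.inv (n + 1)) :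
    desc D f g (ofNeg D (n + 1) p) = g n p :=
  DirectSum.toModule_lof k (M := fun n => D.zpow n) (Int.negSucc n) p

theorem smul_ofPos (a : A) (n : ℕ) (p : pow U n) : a • ofPos D n p = ofPos D n (a • p) :=
  ((DirectSum.lof A ℤ (fun n => D.zpow n) (Int.ofNat n)).map_smul a p).symm

theorem smul_ofNeg (a : A) (n : ℕ) (p : pow D.inv n) : a • ofNeg D n p = ofNeg D n (a • p) := by
  cases n with
  | zero => exact smul_ofPos (D := D) a 0 p
  | succ n => exact ((DirectSum.lof A ℤ (fun n => D.zpow n) (Int.negSucc n)).map_smul a p).symm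

theorem smul_ofAlg (a b : A) : a • ofAlg D b = ofAlg D (a * b) := smul_ofPos (D := D) a 0 b

/-- To prove an additive property of all elements of the direct sum, it suffices to treat `A` and
the elements `w ⊗ p` of the components of positive and negative degree. -/
@[elab_as_elim]
theorem induction {C : D.Laurent → Prop} (x : D.Laurent) (alg : ∀ a : A, C (ofAlg D a))
    (pos : ∀ n u p, C (ofPos D (n + 1) (powCons U n u p)))
    (neg : ∀ n v p, C (ofNeg D (n + 1) (powCons D.inv n v p)))
    (add : ∀ x y, C x → C y → C (x + y)) : C x := by
  refine DirectSum.induction_on x ?_ ?_ add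
  · have h := alg 0
    rwa [map_zero] at h
  · rintro (n | n) p
    · rcases n with _ | n
      · exact alg p
      · change C (ofPos D (n + 1) p)
        induction p using pow_induction with
        | cons u p => exact pos n u p
        | add x y hx hy => rw [map_add]; exact add _ _ hx hy
    · change C (ofNeg D (n + 1) p)
      induction p using pow_induction with
      | cons v p => exact neg n v p
      | add x y hx hy => rw [map_add]; exact add _ _ hx hy

variable (D) in
/-- Left multiplication by an element `u` of `U`: it is `p ↦ u ⊗ p` on the components of
non-negative degree and `v ⊗ p ↦ ⟨u, v⟩ p` on those of negative degree. -/
noncomputable def mulU (u : U) : Module.End k D.Laurent :=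
  desc D (fun n => (ofPos D (n + 1)).comp (powCons U n u))
    (fun n => (ofNeg D n).comp (D.evRight.pairing.contract n u))

theorem mulU_ofPos (u : U) (n : ℕ) (p : pow U n) :
    mulU D u (ofPos D n p) = ofPos D (n + 1) (powCons U n u p) := by
  rw [mulU, desc_ofPos, LinearMap.comp_apply]

theorem mulU_ofAlg (u : U) (a : A) :
    mulU D u (ofAlg D a) = ofPos D 1 (powCons U 0 u (powZero U a)) :=
  mulU_ofPos u 0 (powZero U a)

theorem mulU_ofNeg (u : U) (n : ℕ) (v : D.inv) (p : pow D.inv n) :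
    mulU D u (ofNeg D (n + 1) (powCons D.inv n v p)) =
      D.evRight.pairing.toFun u v • ofNeg D n p := by
  rw [mulU, desc_ofNeg, LinearMap.comp_apply, Pairing.contract_powCons, smul_ofNeg]

variable (D) in
/-- Left multiplication by an element `v` of the inverse of `U`: it is `p ↦ v ⊗ p` on the components
of non-positive degree and `u ⊗ p ↦ ⟨v, u⟩ p` on those of positive degree. -/
noncomputable def mulInv (v : D.inv) : Module.End k D.Laurent :=
  desc D (fun
      | 0 => (ofNeg D 1).comp (powCons D.inv 0 v)
      | n + 1 => (ofPos D n).comp (D.evLeft.pairing.contract n v))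
    (fun n => (ofNeg D (n + 2)).comp (powCons D.inv (n + 1) v))

theorem mulInv_ofAlg (v : D.inv) (a : A) :
    mulInv D v (ofAlg D a) = ofNeg D 1 (powCons D.inv 0 v (powZero D.inv a)) :=
  desc_ofPos (D := D) _ _ 0 _

theorem mulInv_ofNeg (v : D.inv) (n : ℕ) (p : pow D.inv n) :
    mulInv D v (ofNeg D n p) = ofNeg D (n + 1) (powCons D.inv n v p) := by
  cases n with
  | zero => exact mulInv_ofAlg v p
  | succ n => rw [mulInv, desc_ofNeg, LinearMap.comp_apply]

theorem mulInv_ofPos (v : D.inv) (n : ℕ) (u : U) (p : pow U n) :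
    mulInv D v (ofPos D (n + 1) (powCons U n u p)) =
      D.evLeft.pairing.toFun v u • ofPos D n p := by
  rw [mulInv, desc_ofPos, LinearMap.comp_apply, Pairing.contract_powCons, smul_ofPos]

variable (D) in
/-- The left action of `U` on the direct sum. -/
noncomputable def actU : Action U D.Laurent where
  toFun :=
    { toFun := mulU D
      map_add' := fun u u' => LinearMap.ext fun x => by
        rw [LinearMap.add_apply]
        induction x using induction with
        | alg a => simp only [mulU_ofAlg, map_add, LinearMap.add_apply]
        | pos n w p => simp only [mulU_ofPos, map_add, LinearMap.add_apply]
        | neg n v p => simp only [mulU_ofNeg, map_add, LinearMap.add_apply, add_smul]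
        | add x y hx hy => rw [map_add, map_add, map_add, hx, hy]; abel
      map_smul' := fun c u => LinearMap.ext fun x => by
        rw [LinearMap.smul_apply, RingHom.id_apply]
        induction x using induction with
        | alg a => simp only [mulU_ofAlg, map_smul, LinearMap.smul_apply]
        | pos n w p => simp only [mulU_ofPos, map_smul, LinearMap.smul_apply]
        | neg n v p => simp only [mulU_ofNeg, map_smul, LinearMap.smul_apply, smul_assoc]
        | add x y hx hy => rw [map_add, map_add, hx, hy, smul_add] }
  map_left a u x := by
    change mulU D (a • u) x = a • mulU D u x
    induction x using induction with
    | alg b => simp only [mulU_ofAlg, smul_ofPos, smul_powCons]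
    | pos n w p => simp only [mulU_ofPos, smul_ofPos, smul_powCons]
    | neg n v p => simp only [mulU_ofNeg, Pairing.map_left, mul_smul]
    | add x y hx hy => rw [map_add, map_add, hx, hy, smul_add]
  map_right a u x := by
    change mulU D (op a • u) x = mulU D u (a • x)
    induction x using induction with
    | alg b => rw [smul_ofAlg, mulU_ofAlg, mulU_ofAlg, powCons_balanced, smul_powZero]
    | pos n w p => rw [smul_ofPos, mulU_ofPos, mulU_ofPos, powCons_balanced]
    | neg n v p =>
      rw [smul_ofNeg, smul_powCons, mulU_ofNeg, mulU_ofNeg, Pairing.balanced]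
    | add x y hx hy => rw [map_add, smul_add, map_add, hx, hy]

variable (D) in
/-- The left action of the inverse of `U` on the direct sum. -/
noncomputable def actInv : Action D.inv D.Laurent where
  toFun :=
    { toFun := mulInv D
      map_add' := fun v v' => LinearMap.ext fun x => by
        rw [LinearMap.add_apply]
        induction x using induction with
        | alg a => simp only [mulInv_ofAlg, map_add, LinearMap.add_apply]
        | pos n w p => simp only [mulInv_ofPos, map_add, LinearMap.add_apply, add_smul]
        | neg n v p => simp only [mulInv_ofNeg, map_add, LinearMap.add_apply]
        | add x y hx hy => rw [map_add, map_add, map_add, hx, hy]; abel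
      map_smul' := fun c v => LinearMap.ext fun x => by
        rw [LinearMap.smul_apply, RingHom.id_apply]
        induction x using induction with
        | alg a => simp only [mulInv_ofAlg, map_smul, LinearMap.smul_apply]
        | pos n w p => simp only [mulInv_ofPos, map_smul, LinearMap.smul_apply, smul_assoc]
        | neg n v p => simp only [mulInv_ofNeg, map_smul, LinearMap.smul_apply]
        | add x y hx hy => rw [map_add, map_add, hx, hy, smul_add] }
  map_left a v x := by
    change mulInv D (a • v) x = a • mulInv D v x
    induction x using induction with
    | alg b => simp only [mulInv_ofAlg, smul_ofNeg, smul_powCons]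
    | pos n w p => simp only [mulInv_ofPos, Pairing.map_left, mul_smul]
    | neg n v p => simp only [mulInv_ofNeg, smul_ofNeg, smul_powCons]
    | add x y hx hy => rw [map_add, map_add, hx, hy, smul_add]
  map_right a v x := by
    change mulInv D (op a • v) x = mulInv D v (a • x)
    induction x using induction with
    | alg b => rw [smul_ofAlg, mulInv_ofAlg, mulInv_ofAlg, powCons_balanced, smul_powZero]
    | pos n w p =>
      rw [smul_ofPos, smul_powCons, mulInv_ofPos, mulInv_ofPos, Pairing.balanced]
    | neg n v p => rw [smul_ofNeg, mulInv_ofNeg, mulInv_ofNeg, powCons_balanced]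
    | add x y hx hy => rw [map_add, smul_add, map_add, hx, hy]

theorem mulU_smul (u : U) (a : A) (x : D.Laurent) : mulU D u (a • x) = mulU D (op a • u) x :=
  ((actU D).map_right a u x).symm

theorem mulInv_smul (v : D.inv) (a : A) (x : D.Laurent) :
    mulInv D v (a • x) = mulInv D (op a • v) x :=
  ((actInv D).map_right a v x).symm

theorem mulU_mulInv (u : U) (v : D.inv) (x : D.Laurent) :
    mulU D u (mulInv D v x) = D.evRight.pairing.toFun u v • x := by
  induction x using induction with
  | alg a => rw [mulInv_ofAlg, mulU_ofNeg, ofNeg_zero]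
  | pos n w p =>
    rw [mulInv_ofPos, mulU_smul, mulU_ofPos, smul_ofPos, smul_powCons, D.assoc_left]
  | neg n v' p => rw [mulInv_ofNeg, mulU_ofNeg]
  | add x y hx hy => rw [map_add, map_add, hx, hy, smul_add]

theorem mulInv_mulU (v : D.inv) (u : U) (x : D.Laurent) :
    mulInv D v (mulU D u x) = D.evLeft.pairing.toFun v u • x := by
  induction x using induction with
  | alg a => rw [mulU_ofAlg, mulInv_ofPos, ofPos_zero]
  | pos n w p => rw [mulU_ofPos, mulInv_ofPos]
  | neg n v' p =>
    rw [mulU_ofNeg, mulInv_smul, mulInv_ofNeg, smul_ofNeg, smul_powCons, D.assoc_right]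
  | add x y hx hy => rw [map_add, map_add, hx, hy, smul_add]

variable (D) in
/-- The multiplication: `a ∈ A` acts by `a`, and `w₁ ⊗ ⋯ ⊗ wₙ` (all `wᵢ` in `U`, or all in its
inverse) acts by left multiplication by `w₁`, …, `wₙ` in turn, the last one first. -/
noncomputable def mulMap : D.Laurent →ₗ[k] Module.End k D.Laurent :=
  desc D (fun n => ((actU D).pow n).1) (fun n => ((actInv D).pow (n + 1)).1)

theorem mulMap_ofAlg (a : A) (y : D.Laurent) : mulMap D (ofAlg D a) y = a • y := by
  rw [mulMap, ← ofPos_zero, desc_ofPos, Action.pow_zero]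

theorem mulMap_ofPos (n : ℕ) (p : pow U n) (y : D.Laurent) :
    mulMap D (ofPos D n p) y = ((actU D).pow n).1 p y := by
  rw [mulMap, desc_ofPos]

theorem mulMap_ofNeg (n : ℕ) (p : pow D.inv n) (y : D.Laurent) :
    mulMap D (ofNeg D n p) y = ((actInv D).pow n).1 p y := by
  cases n with
  | zero => exact mulMap_ofAlg (A := A) (toAlg p) y
  | succ n => rw [mulMap, desc_ofNeg]

theorem mulMap_ofPos_succ (n : ℕ) (u : U) (p : pow U n) (y : D.Laurent) :
    mulMap D (ofPos D (n + 1) (powCons U n u p)) y = mulU D u (mulMap D (ofPos D n p) y) := by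
  rw [mulMap_ofPos, mulMap_ofPos, Action.pow_succ]; rfl

theorem mulMap_ofNeg_succ (n : ℕ) (v : D.inv) (p : pow D.inv n) (y : D.Laurent) :
    mulMap D (ofNeg D (n + 1) (powCons D.inv n v p)) y =
      mulInv D v (mulMap D (ofNeg D n p) y) := by
  rw [mulMap_ofNeg, mulMap_ofNeg, Action.pow_succ]; rfl

theorem mulMap_smul (a : A) (x y : D.Laurent) : mulMap D (a • x) y = a • mulMap D x y := by
  induction x using induction with
  | alg b => rw [smul_ofAlg, mulMap_ofAlg, mulMap_ofAlg, mul_smul]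
  | pos n u p => rw [smul_ofPos, mulMap_ofPos, mulMap_ofPos, ((actU D).pow (n + 1)).2]
  | neg n v p => rw [smul_ofNeg, mulMap_ofNeg, mulMap_ofNeg, ((actInv D).pow (n + 1)).2]
  | add x x' hx hx' =>
    rw [smul_add, map_add, map_add, LinearMap.add_apply, LinearMap.add_apply, hx, hx', smul_add]

theorem mulMap_mulU (u : U) (x y : D.Laurent) : mulMap D (mulU D u x) y = mulU D u (mulMap D x y) := by
  induction x using induction with
  | alg b => rw [mulU_ofAlg, mulMap_ofPos_succ, ofPos_zero]
  | pos n w p => rw [mulU_ofPos, mulMap_ofPos_succ]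
  | neg n v p => rw [mulU_ofNeg, mulMap_smul, mulMap_ofNeg_succ, mulU_mulInv]
  | add x x' hx hx' =>
    rw [map_add, map_add, map_add, LinearMap.add_apply, LinearMap.add_apply, map_add, hx, hx']

theorem mulMap_mulInv (v : D.inv) (x y : D.Laurent) :
    mulMap D (mulInv D v x) y = mulInv D v (mulMap D x y) := by
  induction x using induction with
  | alg b => rw [mulInv_ofAlg, mulMap_ofNeg_succ, ofNeg_zero]
  | pos n w p => rw [mulInv_ofPos, mulMap_smul, mulMap_ofPos_succ, mulInv_mulU]
  | neg n v p => rw [mulInv_ofNeg, mulMap_ofNeg_succ]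
  | add x x' hx hx' =>
    rw [map_add, map_add, map_add, LinearMap.add_apply, LinearMap.add_apply, map_add, hx, hx']

/-- Every element is obtained from elements of `A` by additions and left multiplications by elements
of `U` and of its inverse. -/
@[elab_as_elim]
theorem generation {C : D.Laurent → Prop} (x : D.Laurent) (alg : ∀ a : A, C (ofAlg D a))
    (actU : ∀ u x, C x → C (mulU D u x)) (actInv : ∀ v x, C x → C (mulInv D v x))
    (add : ∀ x y, C x → C y → C (x + y)) : C x := by
  have h0 : C 0 := by
    have h := alg 0
    rwa [map_zero] at h
  have hpos : ∀ (n : ℕ) (p : pow U n), C (ofPos D n p) := by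
    intro n
    induction n with
    | zero => exact fun p => alg p
    | succ n ih =>
      intro p
      induction p using pow_induction with
      | cons u p => rw [← mulU_ofPos]; exact actU u _ (ih p)
      | add p q hp hq => rw [map_add]; exact add _ _ hp hq
  have hneg : ∀ (n : ℕ) (p : pow D.inv n), C (ofNeg D n p) := by
    intro n
    induction n with
    | zero => exact fun p => alg p
    | succ n ih =>
      intro p
      induction p using pow_induction with
      | cons v p => rw [← mulInv_ofNeg]; exact actInv v _ (ih p)
      | add p q hp hq => rw [map_add]; exact add _ _ hp hq
  exact induction x alg (fun n u p => hpos _ _) (fun n v p => hneg _ _) add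

theorem mulMap_assoc (x y z : D.Laurent) :
    mulMap D (mulMap D x y) z = mulMap D x (mulMap D y z) := by
  induction x using generation with
  | alg a => rw [mulMap_ofAlg, mulMap_ofAlg, mulMap_smul]
  | actU u x ih => rw [mulMap_mulU, mulMap_mulU, mulMap_mulU, ih]
  | actInv v x ih => rw [mulMap_mulInv, mulMap_mulInv, mulMap_mulInv, ih]
  | add x x' hx hx' => simp only [map_add, LinearMap.add_apply, hx, hx']

theorem mulMap_one (x : D.Laurent) : mulMap D x (ofAlg D 1) = x := by
  induction x using generation with
  | alg a => rw [mulMap_ofAlg, smul_ofAlg, mul_one]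
  | actU u x ih => rw [mulMap_mulU, ih]
  | actInv v x ih => rw [mulMap_mulInv, ih]
  | add x x' hx hx' => simp only [map_add, LinearMap.add_apply, hx, hx']

noncomputable instance : Ring D.Laurent :=
  { (inferInstance : AddCommGroup D.Laurent) with
    mul := fun x y => mulMap D x y
    one := ofAlg D 1
    mul_assoc := mulMap_assoc
    one_mul := fun x => (mulMap_ofAlg 1 x).trans (one_smul A x)
    mul_one := mulMap_one
    zero_mul := fun x => LinearMap.congr_fun (map_zero (mulMap D)) x
    mul_zero := fun x => map_zero (mulMap D x)
    left_distrib := fun x y z => map_add (mulMap D x) y z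
    right_distrib := fun x y z => LinearMap.congr_fun (map_add (mulMap D) x y) z }

theorem mul_def (x y : D.Laurent) : x * y = mulMap D x y := rfl

noncomputable instance : Algebra k D.Laurent :=
  Algebra.ofModule (fun c x y => LinearMap.congr_fun (map_smul (mulMap D) c x) y)
    (fun c x y => map_smul (mulMap D x) c y)

end Laurent

end Inverse

end Bimodule

section Homological

open CategoryTheory Abelian

variable (k A : Type u) [CommRing k] [Ring A] [Algebra k A]

/-- The enveloping algebra `A ⊗ A^op`; its left modules are the `A`-bimodules over `k`, the element
`a ⊗ b` acting by `m ↦ a m b`. -/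
abbrev Enveloping : Type u := A ⊗[k] Aᵐᵒᵖ

/-- `A` as a module over its enveloping algebra: `(a ⊗ b) x = a x b`. -/
noncomputable def diagonalModule : ModuleCat.{u} (Enveloping k A) :=
  letI : Module (Enveloping k A) A := TensorProduct.Algebra.module
  ModuleCat.of (Enveloping k A) A

/-- `A ⊗ A` with its outer bimodule structure `a (x ⊗ y) b = a x ⊗ y b`; this is the left regular
module of the enveloping algebra. -/
noncomputable def outerModule : ModuleCat.{u} (Enveloping k A) :=
  ModuleCat.of (Enveloping k A) (Enveloping k A)

/-- The anti-automorphism `a ⊗ b ↦ b ⊗ a` of the enveloping algebra. -/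
noncomputable def envelopingSwap : Enveloping k A ≃ₐ[k] (Enveloping k A)ᵐᵒᵖ :=
  ((Algebra.TensorProduct.comm k A Aᵐᵒᵖ).trans
    (Algebra.TensorProduct.congr AlgEquiv.refl (AlgEquiv.opOp k A))).trans
    (Algebra.TensorProduct.opAlgEquiv k k A Aᵐᵒᵖ)

theorem envelopingSwap_tmul (a b : A) :
    envelopingSwap k A (a ⊗ₜ op b) = op (b ⊗ₜ op a) := rfl

variable {k A} in
/-- The inner bimodule structure `a (x ⊗ y) b = x b ⊗ a y` of `A ⊗ A`: the element `t = a ⊗ b` of the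
enveloping algebra acts by right multiplication by `b ⊗ a`. This is an endomorphism of `A ⊗ A` for
the outer structure. -/
noncomputable def innerAction (t : Enveloping k A) : outerModule k A ⟶ outerModule k A :=
  ModuleCat.ofHom (LinearMap.toSpanSingleton (Enveloping k A) (Enveloping k A)
    (unop (envelopingSwap k A t)))

theorem innerAction_tmul (a b x y : A) :
    (innerAction (k := k) (a ⊗ₜ op b)).hom (x ⊗ₜ[k] op y : Enveloping k A) =
      ((x * b) ⊗ₜ[k] op (a * y) : Enveloping k A) := by
  change (x ⊗ₜ[k] op y : Enveloping k A) * (b ⊗ₜ[k] op a) = _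
  rw [Algebra.TensorProduct.tmul_mul_tmul, ← op_mul]

theorem innerAction_one : innerAction (1 : Enveloping k A) = 𝟙 (outerModule k A) := by
  apply ModuleCat.hom_ext
  ext
  change (1 : Enveloping k A) * unop (envelopingSwap k A 1) = 1
  simp

theorem innerAction_mul (s t : Enveloping k A) :
    innerAction (s * t) = innerAction t ≫ innerAction s := by
  apply ModuleCat.hom_ext
  ext
  change (1 : Enveloping k A) * unop (envelopingSwap k A (s * t)) =
    1 * unop (envelopingSwap k A t) * unop (envelopingSwap k A s)
  simp

theorem innerAction_add (s t : Enveloping k A) :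
    innerAction (s + t) = innerAction s + innerAction t := by
  apply ModuleCat.hom_ext
  ext
  change (1 : Enveloping k A) * unop (envelopingSwap k A (s + t)) =
    1 * unop (envelopingSwap k A s) + 1 * unop (envelopingSwap k A t)
  simp

/-- The `k`-module `Ext^i_{A^e}(A, A ⊗ A)`, computed with the outer structure of `A ⊗ A`. -/
abbrev ExtGroup (i : ℕ) : Type u := Ext.{u} (diagonalModule k A) (outerModule k A) i

/-- The inner bimodule structure of `A ⊗ A` makes `Ext^i_{A^e}(A, A ⊗ A)` a module over the enveloping
algebra. -/
@[reducible]
noncomputable def extModule (i : ℕ) : Module (Enveloping k A) (ExtGroup k A i) where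
  smul t e := e.comp (Ext.mk₀ (innerAction t)) (add_zero i)
  one_smul e := by
    change e.comp (Ext.mk₀ (innerAction 1)) (add_zero i) = e
    rw [innerAction_one, Ext.comp_mk₀_id]
  mul_smul s t e := by
    change e.comp (Ext.mk₀ (innerAction (s * t))) (add_zero i) =
      (e.comp (Ext.mk₀ (innerAction t)) (add_zero i)).comp
        (Ext.mk₀ (innerAction s)) (add_zero i)
    rw [innerAction_mul, Ext.comp_assoc_of_third_deg_zero, Ext.mk₀_comp_mk₀]
  smul_zero t := by
    change Ext.comp 0 (Ext.mk₀ (innerAction t)) (add_zero i) = 0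
    rw [Ext.zero_comp]
  smul_add t e e' := Ext.add_comp _ _ _ _
  add_smul s t e := by
    change e.comp (Ext.mk₀ (innerAction (s + t))) (add_zero i) =
      e.comp (Ext.mk₀ (innerAction s)) (add_zero i) +
        e.comp (Ext.mk₀ (innerAction t)) (add_zero i)
    rw [innerAction_add, Ext.mk₀_add, Ext.comp_add]
  zero_smul e := by
    change e.comp (Ext.mk₀ (innerAction 0)) (add_zero i) = 0
    have h : innerAction (0 : Enveloping k A) = 0 := by
      have h := innerAction_add k A 0 0
      rw [add_zero] at h
      exact left_eq_add.mp h
    rw [h, Ext.mk₀_zero, Ext.comp_zero]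

variable {k A} in
/-- The bimodule given by a module over the enveloping algebra: `a m = (a ⊗ 1) m` and
`m a = (1 ⊗ a) m`. -/
def Bimodule.ofEnveloping (M : Type u) [AddCommGroup M] [Module (Enveloping k A) M] :
    Bimodule k A :=
  letI : Module k M := Module.compHom M (algebraMap k (Enveloping k A))
  letI : Module A M :=
    Module.compHom M (Algebra.TensorProduct.includeLeftRingHom : A →+* Enveloping k A)
  letI : Module Aᵐᵒᵖ M := Module.compHom M
    (Algebra.TensorProduct.includeRight : Aᵐᵒᵖ →ₐ[k] Enveloping k A).toRingHom
  { carrier := M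
    smulComm := ⟨fun a b m => by
      change (a ⊗ₜ[k] (1 : Aᵐᵒᵖ) : Enveloping k A) • ((1 : A) ⊗ₜ[k] b : Enveloping k A) • m =
        ((1 : A) ⊗ₜ[k] b : Enveloping k A) • (a ⊗ₜ[k] (1 : Aᵐᵒᵖ) : Enveloping k A) • m
      simp [← mul_smul]⟩
    towerLeft := ⟨fun c a m => by
      change ((c • a) ⊗ₜ[k] (1 : Aᵐᵒᵖ) : Enveloping k A) • m =
        algebraMap k (Enveloping k A) c • (a ⊗ₜ[k] (1 : Aᵐᵒᵖ) : Enveloping k A) • m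
      rw [← mul_smul, ← Algebra.smul_def, TensorProduct.smul_tmul']⟩
    towerRight := ⟨fun c a m => by
      change ((1 : A) ⊗ₜ[k] (c • a) : Enveloping k A) • m =
        algebraMap k (Enveloping k A) c • ((1 : A) ⊗ₜ[k] a : Enveloping k A) • m
      rw [← mul_smul, ← Algebra.smul_def, TensorProduct.tmul_smul]⟩ }

/-- The `A`-bimodule `Ext^i_{A^e}(A, A ⊗ A)`. -/
noncomputable def extBimodule (i : ℕ) : Bimodule k A :=
  letI := extModule k A i
  Bimodule.ofEnveloping (ExtGroup k A i)

/-- `A` has a resolution of finite length by finitely generated projective `A`-bimodules. -/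
def HasGoodResolution : Prop :=
  ∃ P : ProjectiveResolution (diagonalModule k A),
    (∀ i, Module.Finite (Enveloping k A) (P.complex.X i)) ∧
    ∃ n, ∀ i, n < i → Limits.IsZero (P.complex.X i)

/-- `A` satisfies the conditions for van den Bergh duality of dimension `d`. Its dualizing bimodule
is then `extBimodule k A d`. -/
structure HasVanDenBerghDuality (d : ℕ) : Prop where
  good : HasGoodResolution k A
  vanishing : ∀ i, i ≠ d → Subsingleton (ExtGroup k A i)
  invertible : (extBimodule k A d).IsInvertible

/-- `A` is Calabi-Yau of dimension `d`. -/
structure IsCalabiYau (d : ℕ) : Prop where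
  good : HasGoodResolution k A
  vanishing : ∀ i, i ≠ d → Subsingleton (ExtGroup k A i)
  dualizing : Nonempty (Bimodule.Iso (extBimodule k A d) (Bimodule.unit k A))

end Homological

/-! The algebra `C` is strongly `ℤ`-graded, with `A` in degree zero and `U` in degree one, and apart
from the choice of compatible pairings the argument rests on this structure, recorded in `Frame`.

Put `Y = C ⊗_A C`. Recording the degree of the right-hand factor as an exponent of `T` identifies
`Y` with `C[T;T⁻¹]`, where an element `b` of degree `m` acts from the right by `c Tⁿ ↦ c b Tⁿ⁺ᵐ`.
Multiplication by `T` is then a bimodule automorphism, and `0 → Y → Y → C → 0` with maps `1 - T` and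
`T ↦ 1` is exact (`mult_exact`). Moreover `Y` is induced from `A` along `A^e → C^e`, and `C^e` is
projective as a right `A^e`-module. So a finite resolution of `A` induces one of `Y`, and the
mapping cone of a lift of `1 - T` resolves `C` (`Frame.hasGoodResolution`).

For the same reason `Ext^i(Y, C ⊗ C)` vanishes for `i ≠ d` (`isOuterCoboundary_indRes`). In degree
`d` the cocycles on `P_d` have a finite dual basis `(p_i, φ_i)` (`exists_dual_cocycles`). With `u_i
∈ U` the class of `φ_i`, the sum of the `u_i ⊗ p_i` is a fundamental cycle in `U ⊗_{A^e} P_d`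
(`sum_balanced`). Evaluating cocycles on it gives a map `Ext^d(Y, C ⊗ C) → Y`; the universal
property of `Y` gives a map back, which is surjective. The composite on `Y` is multiplication by
`T`, so both maps are bijective (`toExt_surjective`, `evLinear_toExt`).

The decisive point is that `T`, acting on `Ext^d(Y, C ⊗ C)` through the first argument, becomes
exactly `T⁻¹` on `Y`, with no further twist (`evLinear_shift`). This is seen on bar complexes. In
`Y` one has `T⁰ u = u T` for `u ∈ U`, and a cocycle with values in `C ⊗ C`, flipped into `Y`, is a
trace for `A`. Such a trace takes the same value on `u T b` and on `b u` up to a term `β(u, ∂b)`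
balanced over `A^e` (`exists_slide`), and this term vanishes on the fundamental cycle.

The long exact sequence now identifies `Ext^{d+1}(C, C ⊗ C)` with the cokernel of `1 - T⁻¹` on `Y`,
which is `C` (`connect_eq_zero_iff`); injectivity of `1 - T⁻¹` kills `Ext^d(C, C ⊗ C)`
(`subsingleton_ext`).

Compatible pairings exist because two arbitrary isomorphisms `U ⊗_A V ≅ A` and `V ⊗_A U ≅ A` fail to
be compatible only by a bimodule automorphism of `U`, which can be absorbed into the second one
(`adjust_assoc_left`, `adjust_assoc_right`). -/

section

/-! ### Projective resolutions, and classes of cocycles in `Ext`. -/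

open CategoryTheory Abelian

/-- A projective resolution of a module, given by linear maps that are exact as functions. -/
structure ProjRes {R : Type u} [Ring R] (M : ModuleCat.{u} R) where
  X : ℕ → Type u
  [addCommGroup : ∀ n, AddCommGroup (X n)]
  [module : ∀ n, Module R (X n)]
  d : ∀ n, X (n + 1) →ₗ[R] X n
  aug : X 0 →ₗ[R] M
  projective : ∀ n, Module.Projective R (X n)
  aug_surjective : Function.Surjective aug
  exact_zero : Function.Exact (d 0) aug
  exact_succ : ∀ n, Function.Exact (d (n + 1)) (d n)

namespace ProjRes

attribute [instance] addCommGroup module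

variable {R : Type u} [Ring R] {M : ModuleCat.{u} R}

section

variable (P : ProjRes M)

theorem d_d (n : ℕ) (x : P.X (n + 2)) : P.d n (P.d (n + 1) x) = 0 :=
  (P.exact_succ n).apply_apply_eq_zero x

theorem aug_d (x : P.X 1) : P.aug (P.d 0 x) = 0 := P.exact_zero.apply_apply_eq_zero x

/-- The chain complex of a resolution. -/
noncomputable def complex : ChainComplex (ModuleCat.{u} R) ℕ :=
  ChainComplex.of (fun n => ModuleCat.of R (P.X n)) (fun n => ModuleCat.ofHom (P.d n))
    (fun n => by
      apply ModuleCat.hom_ext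
      ext x
      exact P.d_d n x)

theorem complex_d (n : ℕ) : P.complex.d (n + 1) n = ModuleCat.ofHom (P.d n) := by
  unfold complex
  exact ChainComplex.of_d (fun n => ModuleCat.of R (P.X n)) (fun n => ModuleCat.ofHom (P.d n)) n

theorem complex_exactAt (n : ℕ) : P.complex.ExactAt (n + 1) := by
  rw [HomologicalComplex.exactAt_iff' _ (n + 2) (n + 1) n (by simp) (by simp),
    ShortComplex.ShortExact.moduleCat_exact_iff_function_exact]
  change Function.Exact (P.complex.d (n + 2) (n + 1)) (P.complex.d (n + 1) n)
  rw [P.complex_d, P.complex_d]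
  exact P.exact_succ n

/-- The augmentation as a morphism of modules. -/
noncomputable def augHom : P.complex.X 0 ⟶ M := ModuleCat.ofHom P.aug

theorem complex_d_aug : P.complex.d 1 0 ≫ P.augHom = 0 := by
  rw [P.complex_d 0]
  apply ModuleCat.hom_ext
  ext x
  exact P.aug_d x

/-- The projective resolution in the sense of category theory. -/
noncomputable def resolution : ProjectiveResolution M where
  complex := P.complex
  projective n := by
    have := P.projective n
    exact (ModuleCat.of R (P.X n)).projective_of_categoryTheory_projective
  π := (ChainComplex.toSingle₀Equiv _ _).symm ⟨P.augHom, P.complex_d_aug⟩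
  quasiIso := ⟨fun n => by
    cases n
    -- In degree zero, being a quasi-isomorphism onto a complex concentrated there means that `X₁ →
    -- X₀ → M` is exact with surjective second map.
    · rw [ChainComplex.quasiIsoAt₀_iff, ShortComplex.quasiIso_iff_of_zeros']
      · refine (ShortComplex.exact_and_epi_g_iff_of_iso (S₂ := ShortComplex.mk _ _ P.complex_d_aug)
          ?_).2 ⟨?_, ?_⟩
        · exact ShortComplex.isoMk (Iso.refl _) (Iso.refl _) (Iso.refl _)
            ((Category.id_comp _).trans (Category.comp_id _).symm) (by
              refine (Category.id_comp _).trans (.trans ?_ (Category.comp_id _).symm)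
              exact (ChainComplex.toSingle₀Equiv_symm_apply_f_zero P.augHom P.complex_d_aug).symm)
        · rw [ShortComplex.ShortExact.moduleCat_exact_iff_function_exact]
          change Function.Exact (P.complex.d 1 0) P.augHom
          rw [P.complex_d 0]
          exact P.exact_zero
        · exact (ModuleCat.epi_iff_surjective _).2 P.aug_surjective
      all_goals rfl
    · rw [quasiIsoAt_iff_exactAt']
      · apply P.complex_exactAt
      · apply ChainComplex.exactAt_succ_single_obj⟩

/-- The resolution by modules given by a projective resolution. -/
noncomputable def ofResolution (Q : ProjectiveResolution M) : ProjRes M where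
  X n := Q.complex.X n
  d n := (Q.complex.d (n + 1) n).hom
  aug := (Q.π.f 0).hom
  projective n := ModuleCat.projective_of_module_projective (Q.complex.X n)
  aug_surjective := (ModuleCat.epi_iff_surjective (Q.π.f 0)).1 inferInstance
  exact_zero := (ShortComplex.ShortExact.moduleCat_exact_iff_function_exact _).1 Q.exact₀
  exact_succ n := (ShortComplex.ShortExact.moduleCat_exact_iff_function_exact _).1 (Q.exact_succ n)

variable {N : ModuleCat.{u} R}

theorem ofHom_cocycle {n : ℕ} {f : P.X n →ₗ[R] N} (hf : f ∘ₗ P.d n = 0) :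
    P.resolution.complex.d (n + 1) n ≫ ModuleCat.ofHom f = 0 := by
  refine (congrArg (· ≫ ModuleCat.ofHom f) (P.complex_d n)).trans ?_
  exact ModuleCat.hom_ext hf

/-- The class in `Ext` of a cocycle. -/
noncomputable def cls {n : ℕ} (f : P.X n →ₗ[R] N) (hf : f ∘ₗ P.d n = 0) : Ext.{u} M N n :=
  P.resolution.extMk (Y := N) (ModuleCat.ofHom f) (n + 1) rfl (P.ofHom_cocycle hf)

/-- A linear map on the `n`-th term of a resolution is a coboundary if it factors through the
differential. -/
def IsCoboundary : {n : ℕ} → (P.X n →ₗ[R] N) → Prop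
  | 0, f => f = 0
  | n + 1, f => ∃ g : P.X n →ₗ[R] N, g ∘ₗ P.d n = f

theorem cls_surjective {n : ℕ} (e : Ext.{u} M N n) :
    ∃ (f : P.X n →ₗ[R] N) (hf : f ∘ₗ P.d n = 0), P.cls f hf = e := by
  obtain ⟨f, hf, rfl⟩ := P.resolution.extMk_surjective e (n + 1) rfl
  refine ⟨f.hom, ?_, rfl⟩
  rw [← ModuleCat.ofHom_hom f] at hf
  have h : ModuleCat.ofHom (P.d n) ≫ ModuleCat.ofHom f.hom = 0 :=
    (congrArg (· ≫ ModuleCat.ofHom f.hom) (P.complex_d n)).symm.trans hf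
  exact congrArg ModuleCat.Hom.hom h

theorem cls_add {n : ℕ} (f g : P.X n →ₗ[R] N) (hf : f ∘ₗ P.d n = 0) (hg : g ∘ₗ P.d n = 0) :
    P.cls f hf + P.cls g hg = P.cls (f + g) (by rw [LinearMap.add_comp, hf, hg, add_zero]) :=
  P.resolution.add_extMk _ _ _ _ (P.ofHom_cocycle hf) (P.ofHom_cocycle hg)

theorem cls_comp {n : ℕ} (f : P.X n →ₗ[R] N) (hf : f ∘ₗ P.d n = 0) {N' : ModuleCat.{u} R}
    (g : N ⟶ N') :
    (P.cls f hf).comp (Ext.mk₀ g) (add_zero n) =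
      P.cls (g.hom ∘ₗ f) (by rw [LinearMap.comp_assoc, hf, LinearMap.comp_zero]) :=
  P.resolution.extMk_comp_mk₀ _ _ _ (P.ofHom_cocycle hf) g

theorem cls_succ_eq_zero_iff {n : ℕ} (f : P.X (n + 1) →ₗ[R] N) (hf : f ∘ₗ P.d (n + 1) = 0) :
    P.cls f hf = 0 ↔ ∃ g : P.X n →ₗ[R] N, g ∘ₗ P.d n = f := by
  refine (P.resolution.extMk_eq_zero_iff _ _ _ (P.ofHom_cocycle hf) n rfl).trans ⟨?_, ?_⟩
  · rintro ⟨g, hg⟩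
    refine ⟨g.hom, ?_⟩
    have h : ModuleCat.ofHom (P.d n) ≫ g = ModuleCat.ofHom f :=
      (congrArg (· ≫ g) (P.complex_d n)).symm.trans hg
    exact congrArg ModuleCat.Hom.hom h
  · rintro ⟨g, hg⟩
    refine ⟨ModuleCat.ofHom g, ?_⟩
    refine (congrArg (· ≫ ModuleCat.ofHom g) (P.complex_d n)).trans ?_
    exact ModuleCat.hom_ext hg

/-- The cochain complex of `Q` lives in degrees at most zero. Its term in degree one vanishes, so a
coboundary on the term in degree zero has nothing to factor through. -/
theorem extMk_zero_eq_zero_iff (Q : ProjectiveResolution M) (f : Q.complex.X 0 ⟶ N)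
    (hf : Q.complex.d 1 0 ≫ f = 0) : Q.extMk f 1 rfl hf = 0 ↔ f = 0 := by
  constructor
  · intro h
    rw [← Q.extEquivCohomologyClass.apply_eq_iff_eq,
      ProjectiveResolution.extEquivCohomologyClass_extMk,
      ProjectiveResolution.extEquivCohomologyClass_zero,
      CochainComplex.HomComplex.CohomologyClass.mk_eq_zero_iff,
      CochainComplex.HomComplex.Cocycle.toSingleMk_mem_coboundaries_iff _ _ _ _ _ 1 (by simp)] at h
    obtain ⟨g, hg⟩ := h
    have hz : Limits.IsZero (Q.cochainComplex.X 1) :=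
      CochainComplex.isZero_of_isStrictlyLE _ 0 1 (by lia)
    rw [hz.eq_of_src g 0, Limits.comp_zero] at hg
    exact (cancel_epi (Q.cochainComplexXIso (-(0 : ℕ)) 0 rfl).hom).1
      (hg.symm.trans Limits.comp_zero.symm)
  · rintro rfl
    exact Q.extMk_zero (n := 0) _ _

theorem cls_zero_eq_zero_iff (f : P.X 0 →ₗ[R] N) (hf : f ∘ₗ P.d 0 = 0) :
    P.cls f hf = 0 ↔ f = 0 :=
  (extMk_zero_eq_zero_iff P.resolution _ (P.ofHom_cocycle hf)).trans
    ⟨fun h => congrArg ModuleCat.Hom.hom h, fun h => ModuleCat.hom_ext h⟩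

theorem cls_eq_zero_iff {n : ℕ} (f : P.X n →ₗ[R] N) (hf : f ∘ₗ P.d n = 0) :
    P.cls f hf = 0 ↔ P.IsCoboundary f := by
  cases n with
  | zero => exact P.cls_zero_eq_zero_iff f hf
  | succ n => exact P.cls_succ_eq_zero_iff f hf

/-- Turns the vanishing hypotheses on `Ext` into statements about linear maps on one chosen
resolution, and back. -/
theorem subsingleton_iff {n : ℕ} : Subsingleton (Ext.{u} M N n) ↔
    ∀ f : P.X n →ₗ[R] N, f ∘ₗ P.d n = 0 → P.IsCoboundary f := by
  constructor
  · intro h f hf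
    exact (P.cls_eq_zero_iff f hf).1 (Subsingleton.elim _ _)
  · intro h
    refine subsingleton_of_forall_eq 0 fun e => ?_
    obtain ⟨f, hf, rfl⟩ := P.cls_surjective e
    exact (P.cls_eq_zero_iff f hf).2 (h f hf)

theorem cls_sub {n : ℕ} (f g : P.X n →ₗ[R] N) (hf : f ∘ₗ P.d n = 0) (hg : g ∘ₗ P.d n = 0) :
    P.cls f hf - P.cls g hg = P.cls (f - g) (by rw [LinearMap.sub_comp, hf, hg, sub_zero]) :=
  P.resolution.sub_extMk _ _ _ _ (P.ofHom_cocycle hf) (P.ofHom_cocycle hg)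

end

/-! ### Chain maps between resolutions. -/

section Maps

variable {M' : ModuleCat.{u} R} {N : ModuleCat.{u} R}

/-- A chain map between resolutions that covers a given map. -/
structure Lift (P : ProjRes M) (Q : ProjRes M') (g : M →ₗ[R] M') where
  f : ∀ n, P.X n →ₗ[R] Q.X n
  comm : ∀ n x, Q.d n (f (n + 1) x) = f n (P.d n x)
  comm_aug : ∀ x, Q.aug (f 0 x) = g (P.aug x)

/-- The chain map of resolutions in the sense of category theory. -/
noncomputable def Lift.hom {P : ProjRes M} {Q : ProjRes M'} {g : M →ₗ[R] M'} (φ : Lift P Q g) :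
    ProjectiveResolution.Hom P.resolution Q.resolution (ModuleCat.ofHom g) where
  hom :=
    { f := fun n => ModuleCat.ofHom (φ.f n)
      comm' := by
        rintro i j hij
        obtain rfl : j + 1 = i := hij
        change ModuleCat.ofHom (φ.f (j + 1)) ≫ Q.complex.d (j + 1) j =
          P.complex.d (j + 1) j ≫ ModuleCat.ofHom (φ.f j)
        rw [Q.complex_d, P.complex_d]
        apply ModuleCat.hom_ext
        ext x
        exact φ.comm j x }
  hom_f_zero_comp_π_f_zero := by
    have h : ModuleCat.ofHom (φ.f 0) ≫ Q.augHom = P.augHom ≫ ModuleCat.ofHom g := by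
      apply ModuleCat.hom_ext
      ext x
      exact φ.comm_aug x
    have hQ : Q.resolution.π.f 0 = Q.augHom :=
      ChainComplex.toSingle₀Equiv_symm_apply_f_zero Q.augHom Q.complex_d_aug
    have hP : P.resolution.π.f 0 = P.augHom :=
      ChainComplex.toSingle₀Equiv_symm_apply_f_zero P.augHom P.complex_d_aug
    refine (congrArg (ModuleCat.ofHom (φ.f 0) ≫ ·) hQ).trans (h.trans ?_)
    refine Eq.trans ?_ (congrArg (· ≫ _) hP.symm)
    congr 1

/-- Any chain map covering `g` computes precomposition with `g`, so different lifts may be exchanged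
without exhibiting a homotopy between them. -/
theorem Lift.cls_comp {P : ProjRes M} {Q : ProjRes M'} {g : M →ₗ[R] M'} (φ : Lift P Q g) {n : ℕ}
    (f : Q.X n →ₗ[R] N) (hf : f ∘ₗ Q.d n = 0) :
    (Ext.mk₀ (ModuleCat.ofHom g)).comp (Q.cls f hf) (zero_add n) =
      P.cls (f ∘ₗ φ.f n) (by
        ext x
        simpa [φ.comm] using LinearMap.congr_fun hf (φ.f (n + 1) x)) :=
  ProjectiveResolution.mk₀_comp_extMk _ _ _ (Q.ofHom_cocycle hf) φ.hom

theorem exists_lift (P : ProjRes M) (Q : ProjRes M') (g : M →ₗ[R] M') : Nonempty (Lift P Q g) := by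
  let φ := ProjectiveResolution.lift (ModuleCat.ofHom g) P.resolution Q.resolution
  refine ⟨⟨fun n => (φ.f n).hom, fun n x => ?_, fun x => ?_⟩⟩
  · have h : φ.f (n + 1) ≫ Q.complex.d (n + 1) n = P.complex.d (n + 1) n ≫ φ.f n :=
      φ.comm (n + 1) n
    rw [Q.complex_d, P.complex_d] at h
    exact LinearMap.congr_fun (congrArg ModuleCat.Hom.hom h) x
  · have h : φ.f 0 ≫ Q.resolution.π.f 0 = P.resolution.π.f 0 ≫ ModuleCat.ofHom g :=
      ProjectiveResolution.lift_commutes_zero _ _ _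
    have hQ : Q.resolution.π.f 0 = Q.augHom :=
      ChainComplex.toSingle₀Equiv_symm_apply_f_zero Q.augHom Q.complex_d_aug
    have hP : P.resolution.π.f 0 = P.augHom :=
      ChainComplex.toSingle₀Equiv_symm_apply_f_zero P.augHom P.complex_d_aug
    rw [hQ, hP] at h
    exact LinearMap.congr_fun (congrArg ModuleCat.Hom.hom h) x

end Maps

/-! ### The mapping cone of `1 - σ`. -/

section Cone

variable {Y : ModuleCat.{u} R}

/-- The terms of the mapping cone of `1 - σ`. -/
def ConeX (P : ProjRes Y) : ℕ → Type u
  | 0 => P.X 0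
  | n + 1 => P.X (n + 1) × P.X n

instance (P : ProjRes Y) : ∀ n, AddCommGroup (P.ConeX n)
  | 0 => inferInstanceAs (AddCommGroup (P.X 0))
  | n + 1 => inferInstanceAs (AddCommGroup (P.X (n + 1) × P.X n))

instance (P : ProjRes Y) : ∀ n, Module R (P.ConeX n)
  | 0 => inferInstanceAs (Module R (P.X 0))
  | n + 1 => inferInstanceAs (Module R (P.X (n + 1) × P.X n))

/-- The differential of the mapping cone of `1 - σ`. -/
def coneD (P : ProjRes Y) {t : Y →ₗ[R] Y} (σ : Lift P P t) : ∀ n, P.ConeX (n + 1) →ₗ[R] P.ConeX n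
  | 0 => LinearMap.coprod (P.d 0) (LinearMap.id - σ.f 0)
  | n + 1 => LinearMap.prod (LinearMap.coprod (P.d (n + 1)) (LinearMap.id - σ.f (n + 1)))
      (-(P.d n ∘ₗ LinearMap.snd R (P.X (n + 2)) (P.X (n + 1))))

theorem coneD_zero (P : ProjRes Y) {t : Y →ₗ[R] Y} (σ : Lift P P t) (x : P.X 1) (y : P.X 0) :
    P.coneD σ 0 (x, y) = P.d 0 x + (y - σ.f 0 y) := rfl

theorem coneD_succ (P : ProjRes Y) {t : Y →ₗ[R] Y} (σ : Lift P P t) (n : ℕ)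
    (x : P.X (n + 2)) (y : P.X (n + 1)) :
    P.coneD σ (n + 1) (x, y) = (P.d (n + 1) x + (y - σ.f (n + 1) y), - P.d n y) := rfl

/-- If `0 → Y → Y → M → 0` is exact, the first map being `1 - t`, then the mapping cone of `1 - σ`,
where `σ` covers `t`, is a resolution of `M`. -/
def cone (P : ProjRes Y) {t : Y →ₗ[R] Y} (σ : Lift P P t) (μ : Y →ₗ[R] M)
    (hμ : Function.Surjective μ) (hex : Function.Exact (fun y => y - t y) μ)
    (hinj : ∀ y, t y = y → y = 0) : ProjRes M where
  X := P.ConeX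
  d := P.coneD σ
  aug := μ ∘ₗ P.aug
  projective
    | 0 => P.projective 0
    | n + 1 => by
      have := P.projective n
      have := P.projective (n + 1)
      exact inferInstanceAs (Module.Projective R (P.X (n + 1) × P.X n))
  aug_surjective := hμ.comp P.aug_surjective
  exact_zero := by
    intro x
    change P.X 0 at x
    constructor
    · intro h
      obtain ⟨y, hy⟩ := (hex _).1 h
      obtain ⟨z, rfl⟩ := P.aug_surjective y
      have h2 : P.aug (x - (z - σ.f 0 z)) = 0 := by
        rw [map_sub, map_sub, σ.comm_aug]
        exact sub_eq_zero.2 hy.symm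
      obtain ⟨w, hw⟩ := (P.exact_zero _).1 h2
      exact ⟨(w, z), by rw [coneD_zero, hw, sub_add_cancel]⟩
    · rintro ⟨⟨w, z⟩, rfl⟩
      rw [coneD_zero]
      change μ (P.aug _) = 0
      rw [map_add, P.aug_d, zero_add, map_sub, σ.comm_aug]
      exact hex.apply_apply_eq_zero _
  exact_succ
    | 0 => by
      rintro ⟨x, y⟩
      rw [coneD_zero]
      constructor
      · intro h
        -- The augmentation kills boundaries, so the cycle condition leaves `(1 - t) (aug y) = 0`.
        -- Injectivity of `1 - t` makes `y` a boundary.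
        have h1 : P.aug y = 0 := by
          apply hinj
          have h2 : P.aug (P.d 0 x + (y - σ.f 0 y)) = P.aug 0 := congrArg P.aug h
          rw [map_add, P.aug_d, zero_add, map_sub, σ.comm_aug, map_zero] at h2
          exact (sub_eq_zero.1 h2).symm
        obtain ⟨z, rfl⟩ := (P.exact_zero _).1 h1
        have h3 : P.d 0 (x + (z - σ.f 1 z)) = 0 := by
          rw [map_add, map_sub, σ.comm]
          exact h
        obtain ⟨w, hw⟩ := (P.exact_succ 0 _).1 h3
        -- The sign of `z` compensates for the differential `-d` on the second summand of the cone;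
        -- `w` is a primitive of `x` corrected by `(1 - σ) z`.
        refine ⟨(w, -z), ?_⟩
        rw [coneD_succ, hw]
        simp only [map_neg, neg_neg]
        congr 1
        abel
      · rintro ⟨⟨w, z⟩, h⟩
        rw [coneD_succ] at h
        obtain ⟨rfl, rfl⟩ := Prod.mk.inj h
        simp only [map_add, map_sub, P.d_d, σ.comm, map_neg]
        abel
    | n + 1 => by
      rintro ⟨x, y⟩
      rw [coneD_succ]
      constructor
      · intro h
        obtain ⟨h0, h1⟩ := Prod.mk.inj h
        obtain ⟨z, rfl⟩ := (P.exact_succ n _).1 (neg_eq_zero.1 h1)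
        have h3 : P.d (n + 1) (x + (z - σ.f (n + 2) z)) = 0 := by
          rw [map_add, map_sub, σ.comm]
          exact h0
        obtain ⟨w, hw⟩ := (P.exact_succ (n + 1) _).1 h3
        refine ⟨(w, -z), ?_⟩
        rw [coneD_succ, hw]
        simp only [map_neg, neg_neg]
        congr 1
        abel
      · rintro ⟨⟨w, z⟩, h⟩
        rw [coneD_succ] at h
        obtain ⟨rfl, rfl⟩ := Prod.mk.inj h
        simp only [map_add, map_sub, P.d_d, σ.comm, map_neg, neg_zero]
        refine Prod.ext ?_ rfl
        change 0 + (_ - _) + (-_ - -_) = (0 : P.X (n + 1))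
        abel

theorem cone_finite (P : ProjRes Y) [∀ n, Module.Finite R (P.X n)] :
    ∀ n, Module.Finite R (P.ConeX n)
  | 0 => inferInstanceAs (Module.Finite R (P.X 0))
  | n + 1 => inferInstanceAs (Module.Finite R (P.X (n + 1) × P.X n))

theorem cone_subsingleton (P : ProjRes Y) {m : ℕ} (h : ∀ n, m < n → Subsingleton (P.X n)) :
    ∀ n, m + 1 < n → Subsingleton (P.ConeX n)
  | 0, h0 => by lia
  | n + 1, hn => by
    have := h n (by lia)
    have := h (n + 1) (by lia)
    exact inferInstanceAs (Subsingleton (P.X (n + 1) × P.X n))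

end Cone

end ProjRes

theorem ProjRes.hasGoodResolution {k A : Type u} [CommRing k] [Ring A] [Algebra k A]
    (P : ProjRes (diagonalModule k A)) (hfin : ∀ n, Module.Finite (Enveloping k A) (P.X n))
    {m : ℕ} (h : ∀ n, m < n → Subsingleton (P.X n)) : HasGoodResolution k A :=
  ⟨P.resolution, hfin, m, fun n hn =>
    have := h n hn
    ModuleCat.isZero_of_subsingleton (ModuleCat.of _ (P.X n))⟩

end

/-! ### Compatible pairings on an invertible bimodule. -/

namespace Bimodule

variable {k A : Type u} [CommRing k] [Ring A] [Algebra k A] {U V : Bimodule k A}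

theorem Iso.pairing_apply {M N : Bimodule k A} (e : Iso (tensor M N) (unit k A)) (m : M) (n : N) :
    e.pairing.toFun m n = toAlg (e.toLinearEquiv (tmul m n)) := rfl

/-- If a property of elements of `A` is additive and holds for all `⟨m, n⟩`, it holds on `A`. -/
theorem Iso.pairing_induction {M N : Bimodule k A} (e : Iso (tensor M N) (unit k A)) {p : A → Prop}
    (h : ∀ m n, p (e.pairing.toFun m n)) (add : ∀ a b, p a → p b → p (a + b)) (a : A) : p a := by
  obtain ⟨t, rfl⟩ := e.toLinearEquiv.surjective (a : unit k A)
  induction t using tensor_induction with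
  | tmul m n => exact h m n
  | add x y hx hy =>
    rw [map_add]
    exact add _ _ hx hy

/-- The map `v ⊗ u' ↦ ⟨u, v⟩ u'`. -/
def Pairing.twist (p : Pairing U V) (u : U) : tensor V U →ₗ[k] U :=
  lift ((Algebra.lsmul k k U).toLinearMap.comp (p.toFun u)) (by
    intro v a w
    change p.toFun u (op a • v) • w = p.toFun u v • a • w
    rw [p.map_right, mul_smul])

theorem Pairing.twist_tmul (p : Pairing U V) (u : U) (v : V) (w : U) :
    p.twist u (tmul v w) = p.toFun u v • w := lift_tmul _ _ _ _

theorem Pairing.twist_add (p : Pairing U V) (u u' : U) (t : tensor V U) :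
    p.twist (u + u') t = p.twist u t + p.twist u' t := by
  refine LinearMap.congr_fun (f := p.twist (u + u')) (g := p.twist u + p.twist u')
    (hom_ext fun v w => ?_) t
  rw [LinearMap.add_apply, twist_tmul, twist_tmul, twist_tmul, map_add, LinearMap.add_apply,
    add_smul]

theorem Pairing.twist_smul (p : Pairing U V) (a : A) (u : U) (t : tensor V U) :
    p.twist (a • u) t = a • p.twist u t := by
  induction t using tensor_induction with
  | tmul v w => rw [twist_tmul, twist_tmul, p.map_left, mul_smul]
  | add x y hx hy => rw [map_add, map_add, smul_add, hx, hy]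

theorem Pairing.twist_op_smul (p : Pairing U V) (a : A) (u : U) (t : tensor V U) :
    p.twist (op a • u) t = p.twist u (a • t) := by
  induction t using tensor_induction with
  | tmul v w => rw [smul_tmul, twist_tmul, twist_tmul, p.balanced]
  | add x y hx hy => rw [smul_add, map_add, map_add, hx, hy]

theorem Pairing.op_smul_twist (p : Pairing U V) (a : A) (u : U) (t : tensor V U) :
    p.twist u (op a • t) = op a • p.twist u t := by
  induction t using tensor_induction with
  | tmul v w => rw [op_smul_tmul, twist_tmul, twist_tmul, smul_comm]
  | add x y hx hy => rw [smul_add, map_add, map_add, smul_add, hx, hy]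

/-- The map `u ⊗ v ↦ u ⟨v, w⟩`. -/
def Pairing.cotwist (q : Pairing V U) (w : U) : tensor U V →ₗ[k] U :=
  lift (LinearMap.flip ((Algebra.lsmul k k U).toLinearMap.comp
      ((opLinearEquiv k).toLinearMap.comp (q.toFun.flip w)))) (by
    intro u a v
    change op (q.toFun v w) • op a • u = op (q.toFun (a • v) w) • u
    rw [q.map_left, op_mul, mul_smul])

theorem Pairing.cotwist_tmul (q : Pairing V U) (w : U) (u : U) (v : V) :
    q.cotwist w (tmul u v) = op (q.toFun v w) • u := lift_tmul _ _ _ _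

theorem Pairing.cotwist_add (q : Pairing V U) (u u' : U) (t : tensor U V) :
    q.cotwist (u + u') t = q.cotwist u t + q.cotwist u' t := by
  refine LinearMap.congr_fun (f := q.cotwist (u + u')) (g := q.cotwist u + q.cotwist u')
    (hom_ext fun v w => ?_) t
  rw [LinearMap.add_apply, cotwist_tmul, cotwist_tmul, cotwist_tmul, map_add,
    MulOpposite.op_add, add_smul]

theorem Pairing.cotwist_smul (q : Pairing V U) (a : A) (u : U) (t : tensor U V) :
    q.cotwist (a • u) t = q.cotwist u (op a • t) := by
  induction t using tensor_induction with
  | tmul v w => rw [op_smul_tmul, cotwist_tmul, cotwist_tmul, q.balanced]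
  | add x y hx hy => rw [smul_add, map_add, map_add, hx, hy]

section Adjust

variable (e : Iso (tensor U V) (unit k A)) (f : Iso (tensor V U) (unit k A))

/-- The element corresponding to `1`. -/
def Iso.one {M : Bimodule k A} (e : Iso M (unit k A)) : M := e.toLinearEquiv.symm (1 : A)

theorem Iso.apply_one {M : Bimodule k A} (e : Iso M (unit k A)) :
    toAlg (e.toLinearEquiv e.one) = 1 := e.toLinearEquiv.apply_symm_apply (1 : A)

theorem Iso.apply_smul {M : Bimodule k A} (e : Iso M (unit k A)) (a : A) (m : M) :
    toAlg (e.toLinearEquiv (a • m)) = a * toAlg (e.toLinearEquiv m) := e.map_left a m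

theorem Iso.apply_op_smul {M : Bimodule k A} (e : Iso M (unit k A)) (a : A) (m : M) :
    toAlg (e.toLinearEquiv (op a • m)) = toAlg (e.toLinearEquiv m) * a := e.map_right a m

theorem Iso.toAlg_injective {M : Bimodule k A} (e : Iso M (unit k A)) {m n : M}
    (h : toAlg (e.toLinearEquiv m) = toAlg (e.toLinearEquiv n)) : m = n :=
  e.toLinearEquiv.injective h

theorem Iso.smul_one {M : Bimodule k A} (e : Iso M (unit k A)) (m : M) :
    toAlg (e.toLinearEquiv m) • e.one = m :=
  e.toAlg_injective (by rw [e.apply_smul, e.apply_one, mul_one])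

theorem Iso.op_smul_one {M : Bimodule k A} (e : Iso M (unit k A)) (m : M) :
    op (toAlg (e.toLinearEquiv m)) • e.one = m :=
  e.toAlg_injective (by rw [e.apply_op_smul, e.apply_one, one_mul])

/-- The automorphism measuring the incompatibility of two pairings. -/
def defect : U →+ U where
  -- If `f.one` is a sum of tensors `v_j ⊗ w_j`, so that the `⟨v_j, w_j⟩` add up to `1`, this is the
  -- sum of the `⟨u, v_j⟩ w_j`. For compatible pairings it would equal `u`.
  toFun u := e.pairing.twist u f.one
  map_zero' := by
    have h := e.pairing.twist_add 0 0 f.one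
    rw [add_zero] at h
    exact left_eq_add.1 h
  map_add' u w := e.pairing.twist_add u w _

/-- The inverse of `defect`. -/
def codefect : U →+ U where
  toFun u := f.pairing.cotwist u e.one
  map_zero' := by
    have h := f.pairing.cotwist_add 0 0 e.one
    rw [add_zero] at h
    exact left_eq_add.1 h
  map_add' u u' := f.pairing.cotwist_add u u' _

/-- The factor `⟨v, w⟩` on `u` can be moved onto `f.one`, where it produces the tensor `v ⊗ w`. Thus
the two sides of the desired compatibility differ exactly by the defect. -/
theorem defect_pairing (u : U) (v : V) (w : U) :
    defect e f (op (f.pairing.toFun v w) • u) = e.pairing.toFun u v • w := by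
  change e.pairing.twist (op (f.pairing.toFun v w) • u) _ = _
  rw [Pairing.twist_op_smul, Iso.pairing_apply, Iso.smul_one, Pairing.twist_tmul]

theorem codefect_pairing (u : U) (v : V) (w : U) :
    codefect e f (e.pairing.toFun u v • w) = op (f.pairing.toFun v w) • u := by
  change f.pairing.cotwist (e.pairing.toFun u v • w) _ = _
  rw [Pairing.cotwist_smul, Iso.pairing_apply, Iso.op_smul_one, Pairing.cotwist_tmul]

/-- The values `⟨v, w⟩` span `A`, so the elements `u ⟨v, w⟩` span `U`, and on these the two pairing
formulas are visibly inverse to each other. -/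
theorem codefect_defect (u : U) : codefect e f (defect e f u) = u := by
  have h : ∀ a : A, codefect e f (defect e f (op a • u)) = op a • u :=
    f.pairing_induction (fun v w => by rw [defect_pairing, codefect_pairing])
      (fun a b ha hb => by rw [MulOpposite.op_add, add_smul, map_add, map_add, ha, hb])
  simpa using h 1

theorem defect_codefect (u : U) : defect e f (codefect e f u) = u := by
  have h : ∀ a : A, defect e f (codefect e f (a • u)) = a • u :=
    e.pairing_induction (fun v w => by rw [codefect_pairing, defect_pairing])
      (fun a b ha hb => by rw [add_smul, map_add, map_add, ha, hb])
  simpa using h 1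

theorem defect_smul (a : A) (u : U) : defect e f (a • u) = a • defect e f u :=
  e.pairing.twist_smul a u _

theorem defect_op_smul (a : A) (u : U) : defect e f (op a • u) = op a • defect e f u := by
  change e.pairing.twist (op a • u) _ = op a • e.pairing.twist u _
  rw [Pairing.twist_op_smul, ← Pairing.op_smul_twist]
  congr 1
  -- `f.one` commutes with `A`: both products with `a` are the element that corresponds to `a`.
  exact f.toAlg_injective (by
    rw [f.apply_smul, f.apply_op_smul, f.apply_one, mul_one, one_mul])

theorem codefect_smul (a : A) (u : U) : codefect e f (a • u) = a • codefect e f u := by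
  conv_lhs => rw [← defect_codefect e f u, ← defect_smul, codefect_defect]

/-- `defect` as a linear equivalence. -/
def defectEquiv : U ≃ₗ[k] U where
  toFun := defect e f
  map_add' := map_add _
  map_smul' c u := by
    rw [RingHom.id_apply, ← algebraMap_smul A c u, defect_smul, algebraMap_smul]
  invFun := codefect e f
  left_inv := codefect_defect e f
  right_inv := defect_codefect e f

theorem defectEquiv_apply (u : U) : defectEquiv e f u = defect e f u := rfl

theorem defectEquiv_smul (a : A) (u : U) : defectEquiv e f (a • u) = a • defectEquiv e f u :=
  defect_smul e f a u

/-- The map `v ⊗ u ↦ v ⊗ θ u` for an automorphism `θ` of left modules. -/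
def tensorCongrRight (θ : U ≃ₗ[k] U) (hθ : ∀ (a : A) u, θ (a • u) = a • θ u) :
    tensor V U ≃ₗ[k] tensor V U :=
  LinearEquiv.ofLinearMap
    (lift ((mkTensor V U).compl₂ θ.toLinearMap) fun v a u => by
      change tmul (op a • v) (θ u) = tmul v (θ (a • u))
      rw [hθ, tmul_balanced])
    (lift ((mkTensor V U).compl₂ θ.symm.toLinearMap) fun v a u => by
      change tmul (op a • v) (θ.symm u) = tmul v (θ.symm (a • u))
      rw [tmul_balanced]
      congr 1
      apply θ.injective
      rw [hθ, θ.apply_symm_apply, θ.apply_symm_apply])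
    (hom_ext fun v u => by
      rw [LinearMap.comp_apply, lift_tmul]
      change lift _ _ (tmul v (θ.symm u)) = _
      rw [lift_tmul]
      exact congrArg (tmul v) (θ.apply_symm_apply u))
    (hom_ext fun v u => by
      rw [LinearMap.comp_apply, lift_tmul]
      change lift _ _ (tmul v (θ u)) = _
      rw [lift_tmul]
      exact congrArg (tmul v) (θ.symm_apply_apply u))

theorem tensorCongrRight_tmul (θ : U ≃ₗ[k] U) (hθ : ∀ (a : A) u, θ (a • u) = a • θ u) (v : V)
    (u : U) : tensorCongrRight θ hθ (tmul v u) = tmul v (θ u) := by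
  unfold tensorCongrRight
  refine lift_tmul ((mkTensor V U).compl₂ θ.toLinearMap) (fun v a u => ?_) v u
  change tmul (op a • v) (θ u) = tmul v (θ (a • u))
  rw [hθ, tmul_balanced]

/-- The isomorphism `v ⊗ u ↦ ⟨v, θ u⟩` with `θ` the defect. -/
def adjust : Iso (tensor V U) (unit k A) where
  toLinearEquiv := (tensorCongrRight (defectEquiv e f) (defectEquiv_smul e f)).trans f.toLinearEquiv
  map_left a t := by
    change f.toLinearEquiv (tensorCongrRight (defectEquiv e f) (defectEquiv_smul e f) (a • t)) =
      a • f.toLinearEquiv (tensorCongrRight (defectEquiv e f) (defectEquiv_smul e f) t)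
    refine Eq.trans (congrArg _ ?_) (f.map_left a _)
    induction t using tensor_induction with
    | tmul v u => rw [smul_tmul, tensorCongrRight_tmul, tensorCongrRight_tmul, smul_tmul]
    | add x y hx hy =>
      rw [smul_add, map_add, map_add, hx, hy, smul_add]
  map_right a t := by
    change f.toLinearEquiv (tensorCongrRight (defectEquiv e f) (defectEquiv_smul e f) (op a • t)) =
      op a • f.toLinearEquiv (tensorCongrRight (defectEquiv e f) (defectEquiv_smul e f) t)
    refine Eq.trans (congrArg _ ?_) (f.map_right a _)
    induction t using tensor_induction with
    | tmul v u =>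
      rw [op_smul_tmul, tensorCongrRight_tmul, tensorCongrRight_tmul, op_smul_tmul,
        defectEquiv_apply, defect_op_smul, defectEquiv_apply]
    | add x y hx hy =>
      rw [smul_add, map_add, map_add, hx, hy, smul_add]

theorem adjust_pairing (v : V) (u : U) :
    (adjust e f).pairing.toFun v u = f.pairing.toFun v (defect e f u) :=
  congrArg f.toLinearEquiv (tensorCongrRight_tmul (defectEquiv e f) (defectEquiv_smul e f) v u)

/-- With `θ` the defect, `codefect_pairing` gives `u ⟨v, θ w⟩ = θ⁻¹ (⟨u, v⟩ θ w)`, and `θ⁻¹` is left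
linear. -/
theorem adjust_assoc_left (u : U) (v : V) (w : U) :
    e.pairing.toFun u v • w = op ((adjust e f).pairing.toFun v w) • u := by
  rw [adjust_pairing, ← codefect_pairing, codefect_smul, codefect_defect]

/-- Nondegeneracy: all `u ⊗ x` vanish because `e` is injective, hence so do all `⟨v, u⟩ x`, and the
`⟨v, u⟩` span `A`. -/
theorem eq_zero_of_pairing_eq_zero (e : Iso (tensor U V) (unit k A))
    (f : Iso (tensor V U) (unit k A)) (x : V) (hx : ∀ u, e.pairing.toFun u x = 0) : x = 0 := by
  have h0 : ∀ u : U, tmul u x = 0 := fun u => by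
    apply e.toLinearEquiv.injective
    exact (hx u).trans (map_zero e.toLinearEquiv).symm
  have h1 : ∀ a : A, a • x = 0 :=
    f.pairing_induction (fun v u => by
      have h := congrArg (f.pairing.twist v) (h0 u)
      rwa [Pairing.twist_tmul, map_zero] at h)
      (fun a b ha hb => by rw [add_smul, ha, hb, add_zero])
  simpa using h1 1

/-- The second compatibility follows from the first. Pairing with any `w` gives `⟨w, ⟨v, u⟩ v'⟩ = ⟨w
⟨v, u⟩, v'⟩ = ⟨⟨w, v⟩ u, v'⟩ = ⟨w, v⟩ ⟨u, v'⟩ = ⟨w, v ⟨u, v'⟩⟩`, and the pairing is nondegenerate.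
-/
theorem adjust_assoc_right (v : V) (u : U) (v' : V) :
    (adjust e f).pairing.toFun v u • v' = op (e.pairing.toFun u v') • v := by
  rw [← sub_eq_zero]
  apply eq_zero_of_pairing_eq_zero e f
  intro w
  rw [map_sub, sub_eq_zero, ← e.pairing.balanced, ← adjust_assoc_left, e.pairing.map_left,
    e.pairing.map_right]

end Adjust

/-- An invertible bimodule has an inverse with compatible pairings. -/
theorem IsInvertible.nonempty_inverse (h : U.IsInvertible) : Nonempty U.Inverse := by
  obtain ⟨V, ⟨e⟩, ⟨f⟩⟩ := h
  exact ⟨⟨V, e, adjust e f, adjust_assoc_left e f, adjust_assoc_right e f⟩⟩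

end Bimodule

/-! ### Strongly graded algebras. -/

/-- A strongly `ℤ`-graded `k`-algebra `C` with degree zero part `A`. The grading is given by the
coaction `x ↦ x Tⁿ` for `x` of degree `n`. -/
structure Frame (k A C : Type u) [CommRing k] [Ring A] [Algebra k A] [Ring C] [Algebra k C] where
  incl : A →ₐ[k] C
  coact : C →ₐ[k] AddMonoidAlgebra C ℤ
  incl_injective : Function.Injective incl
  coact_incl : ∀ a, coact (incl a) = .single 0 (incl a)
  exists_incl : ∀ x, coact x = .single 0 x → ∃ a, incl a = x
  coact_coeff : ∀ x n, coact ((coact x).coeff n) = .single n ((coact x).coeff n)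
  counit : ∀ x, ((coact x).coeff.sum fun _ c => c) = x
  -- This is strongness of the grading: `1` lies in `C₋ₙ Cₙ` for every `n`.
  exists_partition : ∀ n : ℤ, ∃ (m : ℕ) (y x : Fin m → C), (∀ j, coact (y j) = .single (-n) (y j)) ∧
    (∀ j, coact (x j) = .single n (x j)) ∧ ∑ j, y j * x j = 1

namespace Frame

variable {k A C : Type u} [CommRing k] [Ring A] [Algebra k A] [Ring C] [Algebra k C]
  (F : Frame k A C)

/-- Homogeneous elements. -/
def IsHom (n : ℤ) (x : C) : Prop := F.coact x = .single n x

variable {F}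

theorem isHom_incl (a : A) : F.IsHom 0 (F.incl a) := F.coact_incl a

theorem isHom_zero (n : ℤ) : F.IsHom n 0 := by
  rw [IsHom, map_zero, AddMonoidAlgebra.single_zero]

theorem IsHom.mul {m n : ℤ} {x y : C} (hx : F.IsHom m x) (hy : F.IsHom n y) :
    F.IsHom (m + n) (x * y) := by
  rw [IsHom, map_mul, hx, hy, AddMonoidAlgebra.single_mul_single]

theorem IsHom.add {n : ℤ} {x y : C} (hx : F.IsHom n x) (hy : F.IsHom n y) : F.IsHom n (x + y) := by
  rw [IsHom, map_add, hx, hy, AddMonoidAlgebra.single_add]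

theorem IsHom.cast {m n : ℤ} {x : C} (hx : F.IsHom m x) (h : m = n) : F.IsHom n x := h ▸ hx

@[elab_as_elim]
theorem hom_induction {p : C → Prop} (x : C) (hom : ∀ n x, F.IsHom n x → p x)
    (add : ∀ x y, p x → p y → p (x + y)) : p x := by
  rw [← F.counit x]
  unfold Finsupp.sum
  exact Finset.sum_induction _ p add (hom 0 0 (isHom_zero 0))
    fun n _ => hom n _ (F.coact_coeff x n)

end Frame

/-! ### The algebra of all tensor powers of `U` is strongly graded. -/

namespace Bimodule.Inverse.Laurent

open AddMonoidAlgebra (single)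

variable {k A : Type u} [CommRing k] [Ring A] [Algebra k A] {U : Bimodule k A} {D : Inverse U}

variable (D) in
/-- The inclusion of `U`. -/
noncomputable def inU (u : U) : D.Laurent := mulU D u 1

variable (D) in
/-- The inclusion of the inverse of `U`. -/
noncomputable def inInv (v : D.inv) : D.Laurent := mulInv D v 1

theorem one_def : (1 : D.Laurent) = ofAlg D 1 := rfl

theorem ofAlg_mul (a : A) (x : D.Laurent) : ofAlg D a * x = a • x := mulMap_ofAlg a x

theorem inU_mul (u : U) (x : D.Laurent) : inU D u * x = mulU D u x := by
  rw [mul_def, inU, mulMap_mulU, ← mul_def, one_mul]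

theorem inInv_mul (v : D.inv) (x : D.Laurent) : inInv D v * x = mulInv D v x := by
  rw [mul_def, inInv, mulMap_mulInv, ← mul_def, one_mul]

variable (D) in
/-- The inclusion of `A` as a homomorphism of algebras. -/
noncomputable def inclHom : A →ₐ[k] D.Laurent :=
  AlgHom.ofLinearMap (ofAlg D) rfl fun a b => by rw [ofAlg_mul, smul_ofAlg]

theorem inclHom_apply (a : A) : inclHom D a = ofAlg D a := rfl

theorem inU_smul (a : A) (u : U) : inU D (a • u) = inclHom D a * inU D u := by
  rw [inclHom_apply, ofAlg_mul]
  exact (actU D).map_left a u 1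

theorem inU_op_smul (a : A) (u : U) : inU D (op a • u) = inU D u * inclHom D a := by
  rw [inU_mul, inclHom_apply, inU, ← mulU_smul, one_def, smul_ofAlg, mul_one]

theorem inU_add (u u' : U) : inU D (u + u') = inU D u + inU D u' :=
  LinearMap.congr_fun (map_add (actU D).toFun u u') 1

theorem inInv_mul_inU (v : D.inv) (u : U) :
    inInv D v * inU D u = inclHom D (D.evLeft.pairing.toFun v u) := by
  rw [inInv_mul, inU, mulInv_mulU, one_def, smul_ofAlg, mul_one, inclHom_apply]

theorem inU_mul_inInv (u : U) (v : D.inv) :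
    inU D u * inInv D v = inclHom D (D.evRight.pairing.toFun u v) := by
  rw [inU_mul, inInv, mulU_mulInv, one_def, smul_ofAlg, mul_one, inclHom_apply]

/-- `x ↦ x Tⁿ` as a linear map. -/
noncomputable def monomialHom (n : ℤ) : D.Laurent →ₗ[k] AddMonoidAlgebra D.Laurent ℤ where
  toFun x := single n x
  map_add' x y := AddMonoidAlgebra.single_add n x y
  map_smul' c x := (AddMonoidAlgebra.smul_single c n x).symm

variable (D) in
/-- The linear map that is `x ↦ x Tⁿ` in degree `n`. -/
noncomputable def coactLinear : D.Laurent →ₗ[k] AddMonoidAlgebra D.Laurent ℤ :=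
  desc D (fun n => (monomialHom n).comp (ofPos D n))
    (fun n => (monomialHom (-(n + 1))).comp (ofNeg D (n + 1)))

theorem coactLinear_ofPos (n : ℕ) (p : pow U n) :
    coactLinear D (ofPos D n p) = single (n : ℤ) (ofPos D n p) := desc_ofPos _ _ n p

theorem coactLinear_ofAlg (a : A) : coactLinear D (ofAlg D a) = single 0 (ofAlg D a) :=
  coactLinear_ofPos 0 _

theorem coactLinear_ofNeg (n : ℕ) (p : pow D.inv n) :
    coactLinear D (ofNeg D n p) = single (-n : ℤ) (ofNeg D n p) := by
  cases n with
  | zero => exact coactLinear_ofAlg _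
  | succ n =>
    refine (desc_ofNeg _ _ n p).trans ?_
    rw [Nat.cast_add, Nat.cast_one]
    rfl

theorem coactLinear_smul (a : A) (x : D.Laurent) :
    coactLinear D (a • x) = single 0 (ofAlg D a) * coactLinear D x := by
  induction x using induction with
  | alg b =>
    rw [smul_ofAlg, coactLinear_ofAlg, coactLinear_ofAlg, AddMonoidAlgebra.single_mul_single,
      ofAlg_mul, smul_ofAlg, add_zero]
  | pos n u p =>
    rw [smul_ofPos, coactLinear_ofPos, coactLinear_ofPos, AddMonoidAlgebra.single_mul_single,
      ofAlg_mul, smul_ofPos, zero_add]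
  | neg n v p =>
    rw [smul_ofNeg, coactLinear_ofNeg, coactLinear_ofNeg, AddMonoidAlgebra.single_mul_single,
      ofAlg_mul, smul_ofNeg, zero_add]
  | add x y hx hy => rw [smul_add, map_add, map_add, hx, hy, mul_add]

theorem coactLinear_mulU (u : U) (x : D.Laurent) :
    coactLinear D (mulU D u x) = single 1 (inU D u) * coactLinear D x := by
  induction x using induction with
  | alg b =>
    rw [mulU_ofAlg, coactLinear_ofPos, coactLinear_ofAlg, AddMonoidAlgebra.single_mul_single,
      inU_mul, mulU_ofAlg]
    rfl
  | pos n w p =>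
    rw [mulU_ofPos, coactLinear_ofPos, coactLinear_ofPos, AddMonoidAlgebra.single_mul_single,
      inU_mul, mulU_ofPos, Nat.cast_succ (n + 1), add_comm (1 : ℤ)]
  | neg n v p =>
    rw [mulU_ofNeg, smul_ofNeg, coactLinear_ofNeg, coactLinear_ofNeg,
      AddMonoidAlgebra.single_mul_single, inU_mul, mulU_ofNeg, smul_ofNeg]
    congr 1
    push_cast
    ring
  | add x y hx hy => rw [map_add, map_add, map_add, hx, hy, mul_add]

theorem coactLinear_mulInv (v : D.inv) (x : D.Laurent) :
    coactLinear D (mulInv D v x) = single (-1) (inInv D v) * coactLinear D x := by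
  induction x using induction with
  | alg b =>
    rw [mulInv_ofAlg, coactLinear_ofNeg, coactLinear_ofAlg, AddMonoidAlgebra.single_mul_single,
      inInv_mul, mulInv_ofAlg]
    rfl
  | pos n w p =>
    rw [mulInv_ofPos, smul_ofPos, coactLinear_ofPos, coactLinear_ofPos,
      AddMonoidAlgebra.single_mul_single, inInv_mul, mulInv_ofPos, smul_ofPos]
    congr 1
    push_cast
    ring
  | neg n w p =>
    rw [mulInv_ofNeg, coactLinear_ofNeg, coactLinear_ofNeg,
      AddMonoidAlgebra.single_mul_single, inInv_mul, mulInv_ofNeg]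
    congr 1
    push_cast
    ring
  | add x y hx hy => rw [map_add, map_add, map_add, hx, hy, mul_add]

/-- `A`, `U` and the inverse generate the algebra, and left multiplication by each of them shifts
the degree by `0`, `1` and `-1`. -/
theorem coactLinear_mul (x y : D.Laurent) :
    coactLinear D (x * y) = coactLinear D x * coactLinear D y := by
  induction x using generation with
  | alg a => rw [ofAlg_mul, coactLinear_smul, coactLinear_ofAlg]
  | actU u x ih => rw [← inU_mul, mul_assoc, inU_mul, coactLinear_mulU, ih, inU_mul,
      coactLinear_mulU, mul_assoc]
  | actInv v x ih => rw [← inInv_mul, mul_assoc, inInv_mul, coactLinear_mulInv, ih, inInv_mul,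
      coactLinear_mulInv, mul_assoc]
  | add x x' hx hx' => rw [add_mul, map_add, map_add, hx, hx', add_mul]

variable (D) in
/-- The coaction defining the grading. -/
noncomputable def coactHom : D.Laurent →ₐ[k] AddMonoidAlgebra D.Laurent ℤ :=
  AlgHom.ofLinearMap (coactLinear D) (coactLinear_ofAlg 1) coactLinear_mul

theorem coactHom_inU (u : U) : coactHom D (inU D u) = single 1 (inU D u) := by
  have h := coactLinear_mulU (D := D) u 1
  rw [one_def, coactLinear_ofAlg, AddMonoidAlgebra.single_mul_single, ← one_def, mul_one,
    add_zero] at h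
  exact h

theorem coactHom_inInv (v : D.inv) : coactHom D (inInv D v) = single (-1) (inInv D v) := by
  have h := coactLinear_mulInv (D := D) v 1
  rw [one_def, coactLinear_ofAlg, AddMonoidAlgebra.single_mul_single, ← one_def, mul_one,
    add_zero] at h
  exact h

/-- An additive property holds for all elements if it holds for those of the components. -/
@[elab_as_elim]
theorem component_induction {p : D.Laurent → Prop} (x : D.Laurent)
    (pos : ∀ n q, p (ofPos D n q)) (neg : ∀ n q, p (ofNeg D (n + 1) q))
    (add : ∀ x y, p x → p y → p (x + y)) : p x :=
  induction x (fun a => pos 0 (powZero U a)) (fun _ _ _ => pos _ _) (fun _ _ _ => neg _ _) add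

theorem coactLinear_coeff (x : D.Laurent) (n : ℤ) :
    coactLinear D ((coactLinear D x).coeff n) = single n ((coactLinear D x).coeff n) := by
  induction x using component_induction with
  | pos m q =>
    rw [coactLinear_ofPos, AddMonoidAlgebra.coeff_single, Finsupp.single_apply]
    split_ifs with h
    · rw [coactLinear_ofPos, h]
    · rw [map_zero, AddMonoidAlgebra.single_zero]
  | neg m q =>
    rw [coactLinear_ofNeg, AddMonoidAlgebra.coeff_single, Finsupp.single_apply]
    split_ifs with h
    · rw [coactLinear_ofNeg, h]
    · rw [map_zero, AddMonoidAlgebra.single_zero]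
  | add x y hx hy =>
    rw [map_add, AddMonoidAlgebra.coeff_add, Finsupp.add_apply, map_add, hx, hy,
      AddMonoidAlgebra.single_add]

theorem coactLinear_counit (x : D.Laurent) : ((coactLinear D x).coeff.sum fun _ c => c) = x := by
  induction x using component_induction with
  | pos m q =>
    rw [coactLinear_ofPos, AddMonoidAlgebra.coeff_single, Finsupp.sum_single_index rfl]
  | neg m q =>
    rw [coactLinear_ofNeg, AddMonoidAlgebra.coeff_single, Finsupp.sum_single_index rfl]
  | add x y hx hy =>
    rw [map_add, AddMonoidAlgebra.coeff_add,
      Finsupp.sum_add_index' (fun _ => rfl) (fun _ _ _ => rfl), hx, hy]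

theorem coactLinear_coeff_zero (x : D.Laurent) : ∃ a, ofAlg D a = (coactLinear D x).coeff 0 := by
  induction x using component_induction with
  | pos m q =>
    rw [coactLinear_ofPos, AddMonoidAlgebra.coeff_single, Finsupp.single_apply]
    split_ifs with h
    · obtain rfl : m = 0 := by simpa using h
      exact ⟨toAlg q, rfl⟩
    · exact ⟨0, map_zero _⟩
  | neg m q =>
    rw [coactLinear_ofNeg, AddMonoidAlgebra.coeff_single, Finsupp.single_apply, if_neg (by lia)]
    exact ⟨0, map_zero _⟩
  | add x y hx hy =>
    obtain ⟨a, ha⟩ := hx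
    obtain ⟨b, hb⟩ := hy
    exact ⟨a + b, by rw [map_add, map_add, ha, hb]; rfl⟩

/-- The component of degree one is by construction `U ⊗_A A`; collapsing its last factor identifies
it with `U`. -/
theorem ofPos_one (u : U) (p : pow U 0) :
    ofPos D 1 (powCons U 0 u p) = inU D (op (toAlg p) • u) := by
  rw [inU_op_smul, inU_mul, inclHom_apply, mulU_ofAlg]
  rfl

theorem coactLinear_coeff_one (x : D.Laurent) : ∃ u, inU D u = (coactLinear D x).coeff 1 := by
  have h0 : inU D 0 = 0 := by
    have h := inU_add (D := D) 0 0
    rw [add_zero] at h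
    exact left_eq_add.1 h
  have hadd : ∀ x y : D.Laurent, (∃ u, inU D u = x) → (∃ u, inU D u = y) →
      ∃ u, inU D u = x + y := by
    rintro _ _ ⟨u, rfl⟩ ⟨u', rfl⟩
    exact ⟨u + u', inU_add u u'⟩
  induction x using component_induction with
  | pos m q =>
    rw [coactLinear_ofPos, AddMonoidAlgebra.coeff_single, Finsupp.single_apply]
    split_ifs with h
    · obtain rfl : m = 1 := by exact_mod_cast h
      induction q using pow_induction with
      | cons u p => exact ⟨_, (ofPos_one u p).symm⟩
      | add p q hp hq =>
        rw [map_add]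
        exact hadd _ _ hp hq
    · exact ⟨0, h0⟩
  | neg m q =>
    rw [coactLinear_ofNeg, AddMonoidAlgebra.coeff_single, Finsupp.single_apply, if_neg (by lia)]
    exact ⟨0, h0⟩
  | add x y hx hy =>
    rw [map_add]
    exact hadd _ _ hx hy

theorem ofAlg_injective : Function.Injective (ofAlg D) :=
  fun _ _ h => DirectSum.of_injective (β := fun n => D.zpow n) (Int.ofNat 0) h

/-- If `u` becomes zero, then every `⟨v, u⟩` vanishes, because `A` embeds. Hence `⟨w, v⟩ u = w ⟨v,
u⟩ = 0`, and the values `⟨w, v⟩` span `A`. -/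
theorem inU_injective : Function.Injective (inU D) := by
  have key : ∀ u, inU D u = 0 → u = 0 := by
    intro u hu
    have h1 : ∀ a : A, a • u = 0 := by
      refine D.evRight.pairing_induction (fun w v => ?_) (fun a b ha hb => ?_)
      · rw [D.assoc_left]
        have h2 : inInv D v * inU D u = 0 := by rw [hu, mul_zero]
        rw [inInv_mul_inU, inclHom_apply] at h2
        rw [ofAlg_injective (h2.trans (map_zero _).symm), op_zero, zero_smul]
      · rw [add_smul, ha, hb, add_zero]
    simpa using h1 1
  intro u u' h
  have h2 : inU D (u - u') + inU D u' = inU D u' := by rw [← inU_add, sub_add_cancel, h]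
  exact sub_eq_zero.1 (key _ (by simpa using h2))

theorem exists_sum_eq_inclHom_left (a : A) : ∃ (m : ℕ) (v : Fin m → D.inv) (u : Fin m → U),
    ∑ j, inInv D (v j) * inU D (u j) = inclHom D a := by
  revert a
  refine D.evLeft.pairing_induction (fun v u => ?_) ?_
  · exact ⟨1, fun _ => v, fun _ => u, by simp [inInv_mul_inU]⟩
  · rintro a b ⟨m, v, u, h⟩ ⟨m', v', u', h'⟩
    exact ⟨m + m', Fin.append v v', Fin.append u u', by simp [Fin.sum_univ_add, h', h]⟩

theorem exists_sum_eq_inclHom_right (a : A) : ∃ (m : ℕ) (u : Fin m → U) (v : Fin m → D.inv),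
    ∑ j, inU D (u j) * inInv D (v j) = inclHom D a := by
  revert a
  refine D.evRight.pairing_induction (fun u v => ?_) ?_
  · exact ⟨1, fun _ => u, fun _ => v, by simp [inU_mul_inInv]⟩
  · rintro a b ⟨m, v, u, h⟩ ⟨m', v', u', h'⟩
    exact ⟨m + m', Fin.append v v', Fin.append u u', by simp [Fin.sum_univ_add, h', h]⟩

/-- Partitions of unity in degrees `m` and `n` give one in degree `m + n`. -/
theorem exists_partition_add {m n : ℤ} (hm : ∃ (r : ℕ) (y x : Fin r → D.Laurent),
      (∀ j, coactHom D (y j) = single (-m) (y j)) ∧ (∀ j, coactHom D (x j) = single m (x j)) ∧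
      ∑ j, y j * x j = 1)
    (hn : ∃ (r : ℕ) (y x : Fin r → D.Laurent),
      (∀ j, coactHom D (y j) = single (-n) (y j)) ∧ (∀ j, coactHom D (x j) = single n (x j)) ∧
      ∑ j, y j * x j = 1) :
    ∃ (r : ℕ) (y x : Fin r → D.Laurent),
      (∀ j, coactHom D (y j) = single (-(m + n)) (y j)) ∧
      (∀ j, coactHom D (x j) = single (m + n) (x j)) ∧ ∑ j, y j * x j = 1 := by
  obtain ⟨r, y, x, hy, hx, h⟩ := hm
  obtain ⟨s, z, w, hz, hw, h'⟩ := hn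
  let e := finProdFinEquiv (m := s) (n := r)
  -- The two partitions are nested as `z_i y_j · x_j w_i`: the inner sum over `j` collapses to `1`,
  -- then the outer one does.
  refine ⟨s * r, fun i => z (e.symm i).1 * y (e.symm i).2, fun i => x (e.symm i).2 * w (e.symm i).1,
    fun i => ?_, fun i => ?_, ?_⟩
  · rw [map_mul, hz, hy, AddMonoidAlgebra.single_mul_single, neg_add_rev]
  · rw [map_mul, hx, hw, AddMonoidAlgebra.single_mul_single]
  · rw [e.symm.sum_comp (fun i => z i.1 * y i.2 * (x i.2 * w i.1)), Fintype.sum_prod_type]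
    have : ∀ i, ∑ j, z i * y j * (x j * w i) = z i * w i := fun i => by
      calc ∑ j, z i * y j * (x j * w i) = z i * (∑ j, y j * x j) * w i := by
            simp only [Finset.mul_sum, Finset.sum_mul, mul_assoc]
        _ = z i * w i := by rw [h, mul_one]
    simp only [this, h']

/-- Writing `1` as a sum of values `⟨v, u⟩` gives degree `1`, and as a sum of values `⟨u, v⟩` degree
`-1`; all other degrees are sums of these. -/
theorem exists_partition (n : ℤ) : ∃ (r : ℕ) (y x : Fin r → D.Laurent),
    (∀ j, coactHom D (y j) = single (-n) (y j)) ∧ (∀ j, coactHom D (x j) = single n (x j)) ∧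
      ∑ j, y j * x j = 1 := by
  induction n using Int.induction_on with
  | zero =>
    refine ⟨1, fun _ => 1, fun _ => 1, fun _ => ?_, fun _ => ?_, by simp⟩ <;> rw [map_one] <;> rfl
  | succ n ih =>
    refine exists_partition_add ih ?_
    obtain ⟨r, v, u, h⟩ := exists_sum_eq_inclHom_left (D := D) 1
    exact ⟨r, fun j => inInv D (v j), fun j => inU D (u j), fun j => coactHom_inInv _,
      fun j => coactHom_inU _, by rw [h, map_one]⟩
  | pred n ih =>
    rw [sub_eq_add_neg]
    refine exists_partition_add ih ?_
    obtain ⟨r, v, u, h⟩ := exists_sum_eq_inclHom_right (D := D) 1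
    exact ⟨r, fun j => inU D (v j), fun j => inInv D (u j),
      fun j => by rw [neg_neg]; exact coactHom_inU _,
      fun j => coactHom_inInv _, by rw [h, map_one]⟩

variable (D) in
/-- The graded structure of the algebra `⨁ n : ℤ, U^{⊗_A n}`. -/
noncomputable def frame : Frame k A D.Laurent where
  incl := inclHom D
  coact := coactHom D
  incl_injective := ofAlg_injective
  coact_incl := coactLinear_ofAlg
  exists_incl x hx := by
    obtain ⟨a, ha⟩ := coactLinear_coeff_zero x
    refine ⟨a, ha.trans ?_⟩
    have h : coactLinear D x = single 0 x := hx
    rw [h, AddMonoidAlgebra.coeff_single, Finsupp.single_eq_same]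
  coact_coeff := coactLinear_coeff
  counit := coactLinear_counit
  exists_partition := exists_partition

theorem frame_isHom_inU (u : U) : (frame D).IsHom 1 (inU D u) := coactHom_inU u

theorem exists_inU (x : D.Laurent) (hx : (frame D).IsHom 1 x) : ∃ u, inU D u = x := by
  obtain ⟨u, hu⟩ := coactLinear_coeff_one x
  refine ⟨u, hu.trans ?_⟩
  have h : coactLinear D x = single 1 x := hx
  rw [h, AddMonoidAlgebra.coeff_single, Finsupp.single_eq_same]

end Bimodule.Inverse.Laurent

/-! ### Bimodules as modules over the enveloping algebra. -/

section Env

variable {k A : Type u} [CommRing k] [Ring A] [Algebra k A]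

/-- A bimodule is a module over the enveloping algebra. -/
noncomputable instance Bimodule.envModule (M : Bimodule k A) : Module (Enveloping k A) M :=
  TensorProduct.Algebra.module

theorem Bimodule.env_smul (M : Bimodule k A) (a : A) (b : Aᵐᵒᵖ) (m : M) :
    (a ⊗ₜ[k] b : Enveloping k A) • m = a • b • m := rfl

theorem Bimodule.smul_eq_env (M : Bimodule k A) (a : A) (m : M) :
    a • m = (a ⊗ₜ[k] 1 : Enveloping k A) • m := by rw [env_smul, one_smul]

theorem Bimodule.op_smul_eq_env (M : Bimodule k A) (b : Aᵐᵒᵖ) (m : M) :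
    b • m = (1 ⊗ₜ[k] b : Enveloping k A) • m := by rw [env_smul, one_smul]

@[elab_as_elim]
theorem Enveloping.induction {p : Enveloping k A → Prop} (s : Enveloping k A)
    (tmul : ∀ (a : A) (b : Aᵐᵒᵖ), p (a ⊗ₜ[k] b)) (add : ∀ s t, p s → p t → p (s + t)) : p s := by
  induction s using TensorProduct.induction_on with
  | zero =>
    have h := tmul 0 0
    rwa [TensorProduct.zero_tmul] at h
  | tmul a b => exact tmul a b
  | add s t hs ht => exact add s t hs ht

theorem Enveloping.zero_tmul_smul {H : Type*} [AddCommGroup H] [Module (Enveloping k A) H]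
    (b : Aᵐᵒᵖ) (h : H) : ((0 : A) ⊗ₜ[k] b : Enveloping k A) • h = 0 := by
  rw [TensorProduct.zero_tmul]
  exact zero_smul (Enveloping k A) h

theorem Enveloping.tmul_zero_smul {H : Type*} [AddCommGroup H] [Module (Enveloping k A) H]
    (a : A) (h : H) : (a ⊗ₜ[k] (0 : Aᵐᵒᵖ) : Enveloping k A) • h = 0 := by
  rw [TensorProduct.tmul_zero]
  exact zero_smul (Enveloping k A) h

/-- A map compatible with the left and right actions is linear over the enveloping algebra. -/
def Bimodule.envLinear {M : Bimodule k A} {H : Type*} [AddCommGroup H] [Module (Enveloping k A) H]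
    (f : M →+ H) (hl : ∀ (a : A) m, f (a • m) = (a ⊗ₜ[k] 1 : Enveloping k A) • f m)
    (hr : ∀ (b : Aᵐᵒᵖ) m, f (b • m) = (1 ⊗ₜ[k] b : Enveloping k A) • f m) :
    M →ₗ[Enveloping k A] H where
  toFun := f
  map_add' := map_add f
  map_smul' s m := by
    rw [RingHom.id_apply]
    induction s using Enveloping.induction with
    | tmul a b =>
      rw [env_smul, hl, hr, ← mul_smul, Algebra.TensorProduct.tmul_mul_tmul, one_mul, mul_one]
    | add s t hs ht => rw [add_smul, add_smul, map_add, hs, ht]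

end Env

/-! ### The bimodule `Y = C ⊗_A C`, its universal property, and the sequence `0 → Y → Y → C → 0`. -/

namespace Frame

open AddMonoidAlgebra (single)

variable {k A C : Type u} [CommRing k] [Ring A] [Algebra k A] [Ring C] [Algebra k C]
  (F : Frame k A C)

/-- The underlying module of `C ⊗_A C`. -/
def YCarrier (_ : Frame k A C) : Type u := AddMonoidAlgebra C ℤ

noncomputable instance : AddCommGroup F.YCarrier :=
  inferInstanceAs (AddCommGroup (AddMonoidAlgebra C ℤ))

noncomputable instance : Module k F.YCarrier := inferInstanceAs (Module k (AddMonoidAlgebra C ℤ))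

noncomputable instance : Module (AddMonoidAlgebra C ℤ) F.YCarrier :=
  inferInstanceAs (Module (AddMonoidAlgebra C ℤ) (AddMonoidAlgebra C ℤ))

noncomputable instance : Module (AddMonoidAlgebra C ℤ)ᵐᵒᵖ F.YCarrier :=
  inferInstanceAs (Module (AddMonoidAlgebra C ℤ)ᵐᵒᵖ (AddMonoidAlgebra C ℤ))

/-- The bimodule `C ⊗_A C`, realised as `C[T;T⁻¹]` with `c y c' = c y δ(c')`, where `δ` is the
coaction. -/
noncomputable def Y : Bimodule k C :=
  letI : Module C F.YCarrier :=
    Module.compHom _ (AddMonoidAlgebra.singleZeroRingHom : C →+* AddMonoidAlgebra C ℤ)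
  letI : Module Cᵐᵒᵖ F.YCarrier :=
    Module.compHom _ (RingHom.op (F.coact : C →+* AddMonoidAlgebra C ℤ))
  { carrier := F.YCarrier
    smulComm := ⟨fun a b (y : AddMonoidAlgebra C ℤ) =>
      (mul_assoc (single 0 a) y (F.coact b.unop)).symm⟩
    towerLeft := ⟨fun r a (y : AddMonoidAlgebra C ℤ) => by
      change single 0 (r • a) * y = r • (single 0 a * y)
      rw [← AddMonoidAlgebra.smul_single, smul_mul_assoc]⟩
    towerRight := ⟨fun r b (y : AddMonoidAlgebra C ℤ) => by
      change y * F.coact (r • b.unop) = r • (y * F.coact b.unop)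
      rw [map_smul, mul_smul_comm]⟩ }

/-- The element `c Tⁿ` of `Y`. -/
noncomputable def mono (n : ℤ) (c : C) : F.Y := (single n c : AddMonoidAlgebra C ℤ)

/-- The coefficients of an element of `Y`. -/
def ycoeff (y : F.Y) : ℤ →₀ C := AddMonoidAlgebra.coeff (y : AddMonoidAlgebra C ℤ)

variable {F}

theorem ycoeff_injective : Function.Injective F.ycoeff := AddMonoidAlgebra.coeff_injective

theorem ycoeff_add (y z : F.Y) : F.ycoeff (y + z) = F.ycoeff y + F.ycoeff z := rfl

theorem ycoeff_mono (n : ℤ) (c : C) : F.ycoeff (F.mono n c) = Finsupp.single n c := rfl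

theorem smul_mono (a : C) (n : ℤ) (c : C) : a • F.mono n c = F.mono n (a * c) := by
  change single 0 a * single n c = single n (a * c)
  rw [AddMonoidAlgebra.single_mul_single, zero_add]

/-- As the grading is strong, multiplication `C ⊗_A Cₙ → C` is bijective, and `c Tⁿ` stands for the
tensor corresponding to `c`. The exponent is the degree of the right-hand factor, which `b` raises
by `m`. -/
theorem op_smul_mono {m : ℤ} {b : C} (hb : F.IsHom m b) (n : ℤ) (c : C) :
    op b • F.mono n c = F.mono (n + m) (c * b) := by
  change single n c * F.coact b = single (n + m) (c * b)
  rw [hb, AddMonoidAlgebra.single_mul_single]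

theorem mono_add (n : ℤ) (c c' : C) : F.mono n (c + c') = F.mono n c + F.mono n c' :=
  AddMonoidAlgebra.single_add n c c'

theorem mono_zero (n : ℤ) : F.mono n 0 = 0 := AddMonoidAlgebra.single_zero n

theorem mono_sum {ι : Type*} (s : Finset ι) (n : ℤ) (c : ι → C) :
    F.mono n (∑ i ∈ s, c i) = ∑ i ∈ s, F.mono n (c i) :=
  map_sum (⟨⟨F.mono n, mono_zero n⟩, mono_add n⟩ : C →+ F.Y) c s

@[elab_as_elim]
theorem y_induction {p : F.Y → Prop} (y : F.Y) (mono : ∀ n c, p (F.mono n c))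
    (add : ∀ x z, p x → p z → p (x + z)) : p y := by
  refine AddMonoidAlgebra.induction_linear (motive := p) (y : AddMonoidAlgebra C ℤ) ?_ add mono
  have h := mono 0 0
  rwa [mono_zero] at h

/-- An additive map on `Y` with given values on `c Tⁿ`. -/
noncomputable def ylift {H : Type*} [AddCommGroup H] (f : ℤ → C →+ H) : F.Y →+ H where
  toFun y := Finsupp.liftAddHom f (F.ycoeff y)
  map_zero' := map_zero (Finsupp.liftAddHom f)
  map_add' _ _ := map_add (Finsupp.liftAddHom f) _ _

theorem ylift_mono {H : Type*} [AddCommGroup H] (f : ℤ → C →+ H) (n : ℤ) (c : C) :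
    ylift f (F.mono n c) = f n c := by
  change Finsupp.liftAddHom f (F.ycoeff (F.mono n c)) = f n c
  rw [ycoeff_mono, Finsupp.liftAddHom_apply_single]

/-- A map on `Y` is right linear if it is so on monomials and homogeneous elements. -/
theorem y_map_op_smul {H : Type*} [AddCommGroup H] (f : F.Y →+ H) (φ : C →+ (H →+ H))
    (h : ∀ m b, F.IsHom m b → ∀ n c, f (F.mono (n + m) (c * b)) = φ b (f (F.mono n c)))
    (b : C) (y : F.Y) : f (op b • y) = φ b (f y) := by
  induction b using hom_induction (F := F) with
  | hom m b hb =>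
    induction y using y_induction with
    | mono n c => rw [op_smul_mono hb, h m b hb]
    | add y z hy hz => rw [smul_add, map_add, map_add, map_add, hy, hz]
  | add b b' hb hb' =>
    rw [MulOpposite.op_add, add_smul, map_add, map_add, hb, hb', AddMonoidHom.add_apply]

/-- Right multiplication in a module over the enveloping algebra. -/
noncomputable def rightMulHom {H : Type*} [AddCommGroup H] [Module (Enveloping k C) H] :
    C →+ (H →+ H) where
  toFun b := DistribSMul.toAddMonoidHom H (1 ⊗ₜ[k] op b : Enveloping k C)
  map_zero' := by
    ext h
    change (1 ⊗ₜ[k] op (0 : C) : Enveloping k C) • h = 0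
    exact Enveloping.tmul_zero_smul 1 h
  map_add' b b' := by
    ext h
    change (1 ⊗ₜ[k] op (b + b') : Enveloping k C) • h =
      (1 ⊗ₜ[k] op b : Enveloping k C) • h + (1 ⊗ₜ[k] op b' : Enveloping k C) • h
    rw [MulOpposite.op_add, TensorProduct.tmul_add, add_smul]

/-- An enveloping-linear map on `Y` with given values on monomials. -/
noncomputable def yliftEnv {H : Type*} [AddCommGroup H] [Module (Enveloping k C) H]
    (f : ℤ → C →+ H)
    (hl : ∀ n a c, f n (a * c) = (a ⊗ₜ[k] 1 : Enveloping k C) • f n c)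
    (hr : ∀ m b, F.IsHom m b → ∀ n c, f (n + m) (c * b) = (1 ⊗ₜ[k] op b : Enveloping k C) • f n c) :
    F.Y →ₗ[Enveloping k C] H :=
  Bimodule.envLinear (ylift f)
    (fun a y => by
      induction y using y_induction with
      | mono n c => rw [smul_mono, ylift_mono, ylift_mono, hl]
      | add y z hy hz => rw [smul_add, map_add, map_add, smul_add, hy, hz])
    (fun b y => y_map_op_smul (ylift f) rightMulHom (fun m b hb n c => by
      rw [ylift_mono, ylift_mono, hr m b hb]; rfl) b.unop y)

theorem yliftEnv_mono {H : Type*} [AddCommGroup H] [Module (Enveloping k C) H]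
    (f : ℤ → C →+ H)
    (hl : ∀ n a c, f n (a * c) = (a ⊗ₜ[k] 1 : Enveloping k C) • f n c)
    (hr : ∀ m b, F.IsHom m b → ∀ n c, f (n + m) (c * b) = (1 ⊗ₜ[k] op b : Enveloping k C) • f n c)
    (n : ℤ) (c : C) : yliftEnv f hl hr (F.mono n c) = f n c := ylift_mono f n c

variable (F) in
/-- `c ↦ c Tⁿ` as an additive map. -/
noncomputable def monoHom (n : ℤ) : C →+ F.Y where
  toFun := F.mono n
  map_zero' := mono_zero n
  map_add' := mono_add n

variable (F) in
/-- Multiplication by `Tⁱ` on `Y`. -/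
noncomputable def shift (i : ℤ) : F.Y →ₗ[Enveloping k C] F.Y :=
  yliftEnv (fun n => F.monoHom (n + i))
    (fun n a c => by
      change F.mono (n + i) (a * c) = _ • F.mono (n + i) c
      rw [← Bimodule.smul_eq_env, smul_mono])
    (fun m b hb n c => by
      change F.mono (n + m + i) (c * b) = _ • F.mono (n + i) c
      rw [← Bimodule.op_smul_eq_env, op_smul_mono hb, add_right_comm])

theorem shift_mono (i n : ℤ) (c : C) : F.shift i (F.mono n c) = F.mono (n + i) c :=
  yliftEnv_mono _ _ _ n c

theorem shift_shift (i j : ℤ) (y : F.Y) : F.shift i (F.shift j y) = F.shift (j + i) y := by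
  induction y using y_induction with
  | mono n c => rw [shift_mono, shift_mono, shift_mono, add_assoc]
  | add y z hy hz => rw [map_add, map_add, map_add, hy, hz]

theorem shift_zero (y : F.Y) : F.shift 0 y = y := by
  induction y using y_induction with
  | mono n c => rw [shift_mono, add_zero]
  | add y z hy hz => rw [map_add, hy, hz]

variable (k C) in
/-- The identity map from `C` to the bimodule `C`. -/
def unitHom : C →+ Bimodule.unit k C := AddMonoidHom.id C

variable (F) in
/-- The multiplication map `Y → C`, `c Tⁿ ↦ c`. -/
noncomputable def mult : F.Y →ₗ[Enveloping k C] (Bimodule.unit k C) :=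
  yliftEnv (fun _ => unitHom k C)
    (fun n a c => by
      rw [← Bimodule.smul_eq_env]
      rfl)
    (fun m b hb n c => by
      rw [← Bimodule.op_smul_eq_env]
      rfl)

theorem mult_mono (n : ℤ) (c : C) : F.mult (F.mono n c) = unitHom k C c :=
  yliftEnv_mono _ _ _ n c

theorem mult_surjective : Function.Surjective F.mult :=
  fun c => ⟨F.mono 0 (Bimodule.toAlg c), mult_mono 0 (Bimodule.toAlg c)⟩

theorem mult_shift (i : ℤ) (y : F.Y) : F.mult (F.shift i y) = F.mult y := by
  induction y using y_induction with
  | mono n c => rw [shift_mono, mult_mono, mult_mono]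
  | add y z hy hz => rw [map_add, map_add, map_add, hy, hz]

theorem ycoeff_shift (i n : ℤ) (y : F.Y) : F.ycoeff (F.shift i y) (n + i) = F.ycoeff y n := by
  induction y using y_induction with
  | mono m c =>
    rw [shift_mono, ycoeff_mono, ycoeff_mono, Finsupp.single_apply, Finsupp.single_apply]
    simp only [add_left_inj]
  | add y z hy hz =>
    rw [map_add (F.shift i), ycoeff_add, ycoeff_add, Finsupp.add_apply, Finsupp.add_apply, hy, hz]

/-- All coefficients of a shift-invariant element coincide, but only finitely many can be nonzero.
-/
theorem eq_zero_of_shift_eq {y : F.Y} (h : F.shift 1 y = y) : y = 0 := by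
  have h1 : ∀ n : ℤ, F.ycoeff y (n + 1) = F.ycoeff y n := fun n => by
    conv_lhs => rw [← h]
    exact ycoeff_shift 1 n y
  have h2 : ∀ n : ℕ, ∀ m : ℤ, F.ycoeff y (m + n) = F.ycoeff y m := by
    intro n
    induction n with
    | zero => intro m; rw [Nat.cast_zero, add_zero]
    | succ n ih => intro m; rw [Nat.cast_succ, ← add_assoc, h1, ih]
  apply ycoeff_injective
  change F.ycoeff y = 0
  ext m
  by_contra hm
  have hs : Set.range (fun n : ℕ => m + (n : ℤ)) ⊆ ((F.ycoeff y).support : Set ℤ) := by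
    rintro _ ⟨n, rfl⟩
    rw [Finset.mem_coe, Finsupp.mem_support_iff, h2]
    exact hm
  exact Set.infinite_range_of_injective (fun a b h => by simpa using h)
    ((F.ycoeff y).support.finite_toSet.subset hs)

/-- Telescoping: `1 - T` divides `Tⁿ - 1` for every integer `n`, negative ones included. -/
theorem exists_sub_shift_mono (n : ℤ) (c : C) :
    ∃ z : F.Y, z - F.shift 1 z = F.mono n c - F.mono 0 c := by
  induction n using Int.induction_on with
  | zero => exact ⟨0, by rw [map_zero, sub_self, sub_self]⟩
  | succ n ih =>
    obtain ⟨z, hz⟩ := ih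
    refine ⟨z - F.mono n c, ?_⟩
    rw [map_sub, shift_mono, sub_sub_sub_comm, hz]
    abel
  | pred n ih =>
    obtain ⟨z, hz⟩ := ih
    refine ⟨z + F.mono (-n - 1) c, ?_⟩
    rw [map_add, shift_mono, add_sub_add_comm, hz, sub_add_cancel]
    abel

/-- Modulo the image of `1 - T`, all exponents can be moved to zero, and an element is then
represented by the sum of its coefficients, placed in exponent zero. -/
theorem mult_exact : Function.Exact (fun y => y - F.shift 1 y) F.mult := by
  intro y
  constructor
  · intro hy
    have key : ∃ z : F.Y, z - F.shift 1 z = y - F.mono 0 (F.mult y) := by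
      clear hy
      induction y using y_induction with
      | mono n c =>
        rw [mult_mono]
        exact exists_sub_shift_mono n c
      | add x y hx hy =>
        obtain ⟨z, hz⟩ := hx
        obtain ⟨w, hw⟩ := hy
        refine ⟨z + w, ?_⟩
        rw [map_add, map_add, add_sub_add_comm, hz, hw]
        refine Eq.trans ?_ (congrArg (x + y - ·) (mono_add 0 _ _).symm)
        abel
    obtain ⟨z, hz⟩ := key
    refine ⟨z, hz.trans ?_⟩
    rw [hy]
    exact (congrArg (y - ·) (mono_zero 0)).trans (sub_zero y)
  · rintro ⟨z, rfl⟩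
    change F.mult (z - F.shift 1 z) = 0
    rw [map_sub, mult_shift, sub_self]

section Desc

variable {H : Type*} [AddCommGroup H] [Module (Enveloping k C) H]

variable (F) in
/-- A partition of unity of degree `n`. -/
noncomputable def size (n : ℤ) : ℕ := (F.exists_partition n).choose

variable (F) in
/-- The elements of degree `-n` of the partition of unity. -/
noncomputable def lo (n : ℤ) : Fin (F.size n) → C := (F.exists_partition n).choose_spec.choose

variable (F) in
/-- The elements of degree `n` of the partition of unity. -/
noncomputable def hi (n : ℤ) : Fin (F.size n) → C :=
  (F.exists_partition n).choose_spec.choose_spec.choose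

theorem isHom_lo (n : ℤ) (j) : F.IsHom (-n) (F.lo n j) :=
  (F.exists_partition n).choose_spec.choose_spec.choose_spec.1 j

theorem isHom_hi (n : ℤ) (j) : F.IsHom n (F.hi n j) :=
  (F.exists_partition n).choose_spec.choose_spec.choose_spec.2.1 j

theorem sum_lo_hi (n : ℤ) : ∑ j, F.lo n j * F.hi n j = 1 :=
  (F.exists_partition n).choose_spec.choose_spec.choose_spec.2.2

variable (F) in
/-- The element `∑ y η x`, for the partition of unity `∑ y x = 1` of degree `n`. -/
noncomputable def conj (η : H) (n : ℤ) : H :=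
  ∑ j, (F.lo n j ⊗ₜ[k] op (F.hi n j) : Enveloping k C) • η

variable (k F) in
/-- Elements commuting with `A`. -/
def IsCentral (η : H) : Prop := ∀ a : A,
  (F.incl a ⊗ₜ[k] 1 : Enveloping k C) • η = (1 ⊗ₜ[k] op (F.incl a) : Enveloping k C) • η

theorem IsCentral.hom {η : H} (hη : IsCentral k F η) {x : C} (hx : F.IsHom 0 x) :
    (x ⊗ₜ[k] 1 : Enveloping k C) • η = (1 ⊗ₜ[k] op x : Enveloping k C) • η := by
  obtain ⟨a, rfl⟩ := F.exists_incl x hx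
  exact hη a

/-- `conj η n` is to be the image of `Tⁿ`, so the relation `Tⁿ b = b Tⁿ⁺ᵐ` has to hold. With
partitions `y_j, x_j` of degree `n` and `y'_i, x'_i` of degree `n + m`, insert `1 = ∑ y'_i x'_i`
after `b`: the elements `x_j b y'_i` have degree zero, hence lie in `A` and may cross `η`, after
which `∑ y_j x_j = 1` collapses. -/
theorem IsCentral.op_smul_conj {η : H} (hη : IsCentral k F η) (n : ℤ) {m : ℤ} {b : C}
    (hb : F.IsHom m b) :
    (1 ⊗ₜ[k] op b : Enveloping k C) • F.conj η n =
      (b ⊗ₜ[k] 1 : Enveloping k C) • F.conj η (n + m) := by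
  have h1 : ∀ j i, (F.lo n j ⊗ₜ[k] op (F.hi n j * b * F.lo (n + m) i * F.hi (n + m) i) :
      Enveloping k C) • η = ((F.lo n j * (F.hi n j * b * F.lo (n + m) i)) ⊗ₜ[k]
        op (F.hi (n + m) i) : Enveloping k C) • η := by
    intro j i
    have hx : F.IsHom 0 (F.hi n j * b * F.lo (n + m) i) :=
      (((isHom_hi n j).mul hb).mul (isHom_lo (n + m) i)).cast (by ring)
    have e1 : (F.lo n j ⊗ₜ[k] op (F.hi n j * b * F.lo (n + m) i * F.hi (n + m) i) :
        Enveloping k C) = (F.lo n j ⊗ₜ[k] op (F.hi (n + m) i)) *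
          (1 ⊗ₜ[k] op (F.hi n j * b * F.lo (n + m) i)) := by
      rw [Algebra.TensorProduct.tmul_mul_tmul, mul_one, ← op_mul]
    have e2 : ((F.lo n j * (F.hi n j * b * F.lo (n + m) i)) ⊗ₜ[k]
        op (F.hi (n + m) i) : Enveloping k C) = (F.lo n j ⊗ₜ[k] op (F.hi (n + m) i)) *
          ((F.hi n j * b * F.lo (n + m) i) ⊗ₜ[k] 1) := by
      rw [Algebra.TensorProduct.tmul_mul_tmul, mul_one]
    rw [e1, e2, mul_smul, mul_smul, hη.hom hx]
  have l1 : ∀ j, (1 ⊗ₜ[k] op b : Enveloping k C) •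
      (F.lo n j ⊗ₜ[k] op (F.hi n j) : Enveloping k C) • η =
      ∑ i, (F.lo n j ⊗ₜ[k] op (F.hi n j * b * F.lo (n + m) i * F.hi (n + m) i) :
        Enveloping k C) • η := by
    intro j
    rw [← mul_smul, Algebra.TensorProduct.tmul_mul_tmul, one_mul, ← op_mul, ← Finset.sum_smul,
      ← TensorProduct.tmul_sum, ← Finset.op_sum]
    simp only [mul_assoc (F.hi n j * b)]
    rw [← Finset.mul_sum, sum_lo_hi, mul_one]
  have l2 : ∀ i, (b ⊗ₜ[k] 1 : Enveloping k C) •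
      (F.lo (n + m) i ⊗ₜ[k] op (F.hi (n + m) i) : Enveloping k C) • η =
      ∑ j, ((F.lo n j * (F.hi n j * b * F.lo (n + m) i)) ⊗ₜ[k]
        op (F.hi (n + m) i) : Enveloping k C) • η := by
    intro i
    rw [← mul_smul, Algebra.TensorProduct.tmul_mul_tmul, one_mul, ← Finset.sum_smul,
      ← TensorProduct.sum_tmul]
    simp only [← mul_assoc]
    rw [← Finset.sum_mul, ← Finset.sum_mul, sum_lo_hi, one_mul]
  rw [conj, conj, Finset.smul_sum, Finset.smul_sum]
  simp only [l1, l2, h1]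
  exact Finset.sum_comm

theorem IsCentral.conj_zero {η : H} (hη : IsCentral k F η) : F.conj η 0 = η := by
  have h : ∀ j, (F.lo 0 j ⊗ₜ[k] op (F.hi 0 j) : Enveloping k C) • η =
      ((F.lo 0 j * F.hi 0 j) ⊗ₜ[k] 1 : Enveloping k C) • η := by
    intro j
    have e1 : (F.lo 0 j ⊗ₜ[k] op (F.hi 0 j) : Enveloping k C) =
        (F.lo 0 j ⊗ₜ[k] 1) * (1 ⊗ₜ[k] op (F.hi 0 j)) := by
      rw [Algebra.TensorProduct.tmul_mul_tmul, mul_one, one_mul]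
    have e2 : ((F.lo 0 j * F.hi 0 j) ⊗ₜ[k] 1 : Enveloping k C) =
        (F.lo 0 j ⊗ₜ[k] 1) * (F.hi 0 j ⊗ₜ[k] 1) := by
      rw [Algebra.TensorProduct.tmul_mul_tmul, mul_one]
    rw [e1, e2, mul_smul, mul_smul, hη.hom (isHom_hi 0 j)]
  rw [conj]
  simp only [h]
  rw [← Finset.sum_smul, ← TensorProduct.sum_tmul, sum_lo_hi, ← Algebra.TensorProduct.one_def,
    one_smul]

/-- The linear map on `Y` that sends `1` to a given `A`-central element. -/
noncomputable def desc (η : H) (hη : IsCentral k F η) : F.Y →ₗ[Enveloping k C] H :=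
  yliftEnv (fun n =>
    { toFun := fun c => (c ⊗ₜ[k] 1 : Enveloping k C) • F.conj η n
      map_zero' := Enveloping.zero_tmul_smul _ _
      map_add' := fun c c' => by rw [TensorProduct.add_tmul, add_smul] })
    (fun n a c => by
      change ((a * c) ⊗ₜ[k] 1 : Enveloping k C) • F.conj η n =
        (a ⊗ₜ[k] 1 : Enveloping k C) • (c ⊗ₜ[k] 1 : Enveloping k C) • F.conj η n
      rw [← mul_smul, Algebra.TensorProduct.tmul_mul_tmul, mul_one])
    (fun m b hb n c => by
      change ((c * b) ⊗ₜ[k] 1 : Enveloping k C) • F.conj η (n + m) =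
        (1 ⊗ₜ[k] op b : Enveloping k C) • (c ⊗ₜ[k] 1 : Enveloping k C) • F.conj η n
      rw [← mul_smul, Algebra.TensorProduct.tmul_mul_tmul, one_mul, mul_one,
        ← mul_one c, ← one_mul (op b), ← Algebra.TensorProduct.tmul_mul_tmul, mul_smul,
        hη.op_smul_conj n hb, ← mul_smul, Algebra.TensorProduct.tmul_mul_tmul, mul_one, mul_one])

theorem desc_mono (η : H) (hη : IsCentral k F η) (n : ℤ) (c : C) :
    desc η hη (F.mono n c) = (c ⊗ₜ[k] 1 : Enveloping k C) • F.conj η n := yliftEnv_mono _ _ _ n c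

theorem desc_one (η : H) (hη : IsCentral k F η) : desc η hη (F.mono 0 1) = η := by
  rw [desc_mono, hη.conj_zero, ← Algebra.TensorProduct.one_def, one_smul]

/-- The partition of unity expresses `c Tⁿ` through `T⁰`. So `T⁰` generates `Y` as a bimodule, and
maps out of `Y` are determined by its image. -/
theorem mono_eq_sum (n : ℤ) (c : C) : F.mono n c =
    ∑ j, ((c * F.lo n j) ⊗ₜ[k] op (F.hi n j) : Enveloping k C) • F.mono 0 1 := by
  simp only [Bimodule.env_smul, op_smul_mono (isHom_hi _ _), smul_mono, one_mul, zero_add]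
  rw [← mono_sum]
  simp only [mul_assoc]
  rw [← Finset.mul_sum, sum_lo_hi, mul_one]

theorem y_hom_ext {f g : F.Y →ₗ[Enveloping k C] H} (h : f (F.mono 0 1) = g (F.mono 0 1)) :
    f = g := by
  ext y
  induction y using y_induction with
  | mono n c => rw [mono_eq_sum, map_sum, map_sum]; simp only [map_smul, h]
  | add y z hy hz => rw [map_add, map_add, hy, hz]

end Desc

end Frame

/-! ### Projectivity of `C` over `A` and over `k`, and of `Y` as a right module. -/

theorem Module.Projective.of_tower {k A M : Type*} [CommRing k] [Ring A] [Algebra k A]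
    [AddCommGroup M] [Module A M] [Module k M] [IsScalarTower k A M] [Module.Projective k A]
    [Module.Projective A M] : Module.Projective k M := by
  classical
  obtain ⟨s, hs⟩ := ‹Module.Projective A M›
  have : Module.Projective k (M →₀ A) :=
    .of_equiv' (finsuppLequivDFinsupp (ι := M) (M := A) k).symm
  exact .of_split (M := M →₀ A) (s.restrictScalars k)
    ((Finsupp.linearCombination A id).restrictScalars k) (LinearMap.ext hs)

namespace Frame

open AddMonoidAlgebra (single)

variable {k A C : Type u} [CommRing k] [Ring A] [Algebra k A] [Ring C] [Algebra k C]
  (F : Frame k A C)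

/-- The underlying module of `C` as an `A`-bimodule. -/
def ResCarrier (_ : Frame k A C) : Type u := C

instance : AddCommGroup F.ResCarrier := inferInstanceAs (AddCommGroup C)
instance : Module k F.ResCarrier := inferInstanceAs (Module k C)
instance : Module C F.ResCarrier := inferInstanceAs (Module C C)
instance : Module Cᵐᵒᵖ F.ResCarrier := inferInstanceAs (Module Cᵐᵒᵖ C)

/-- `C` as an `A`-bimodule. -/
def res : Bimodule k A :=
  letI : Module A F.ResCarrier := Module.compHom _ (F.incl : A →+* C)
  letI : Module Aᵐᵒᵖ F.ResCarrier := Module.compHom _ (RingHom.op (F.incl : A →+* C))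
  { carrier := F.ResCarrier
    smulComm := ⟨fun a b (x : C) => (mul_assoc (F.incl a) x (F.incl b.unop)).symm⟩
    towerLeft := ⟨fun r a (x : C) => by
      change F.incl (r • a) * x = r • (F.incl a * x)
      rw [map_smul, smul_mul_assoc]⟩
    towerRight := ⟨fun r b (x : C) => by
      change x * F.incl (r • b.unop) = r • (x * F.incl b.unop)
      rw [map_smul, mul_smul_comm]⟩ }

/-- An element of `C` as an element of the `A`-bimodule `C`. -/
def toRes : C ≃ₗ[k] F.res := (LinearEquiv.refl k C : C ≃ₗ[k] C)

variable {F}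

theorem smul_toRes (a : A) (x : C) : a • F.toRes x = F.toRes (F.incl a * x) := rfl

theorem op_smul_toRes (a : A) (x : C) : op a • F.toRes x = F.toRes (x * F.incl a) := rfl

variable (F) in
/-- The projection onto the degree zero part. -/
noncomputable def proj : C →+ A where
  toFun x := (F.exists_incl _ (F.coact_coeff x 0)).choose
  map_zero' := F.incl_injective (by
    refine (F.exists_incl _ (F.coact_coeff 0 0)).choose_spec.trans ?_
    rw [map_zero F.coact, map_zero F.incl]
    rfl)
  map_add' x y := F.incl_injective (by
    refine (F.exists_incl _ (F.coact_coeff (x + y) 0)).choose_spec.trans ?_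
    refine Eq.trans ?_ (map_add F.incl _ _).symm
    refine Eq.trans ?_ (congrArg₂ (· + ·) (F.exists_incl _ (F.coact_coeff x 0)).choose_spec
      (F.exists_incl _ (F.coact_coeff y 0)).choose_spec).symm
    rw [map_add F.coact]
    rfl)

theorem incl_proj (x : C) : F.incl (F.proj x) = (F.coact x).coeff 0 :=
  (F.exists_incl _ (F.coact_coeff x 0)).choose_spec

theorem proj_incl_mul (a : A) (x : C) : F.proj (F.incl a * x) = a * F.proj x :=
  F.incl_injective (by
    rw [incl_proj, map_mul, map_mul, incl_proj, F.coact_incl,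
      AddMonoidAlgebra.coeff_single_zero_mul])

theorem proj_mul_incl (a : A) (x : C) : F.proj (x * F.incl a) = F.proj x * a :=
  F.incl_injective (by
    rw [incl_proj, map_mul, map_mul, incl_proj, F.coact_incl,
      AddMonoidAlgebra.coeff_mul_single_zero])

theorem IsHom.incl_proj {x : C} (hx : F.IsHom 0 x) : F.incl (F.proj x) = x := by
  rw [Frame.incl_proj, hx, AddMonoidAlgebra.coeff_single, Finsupp.single_eq_same]

/-- An additive map on `C` with prescribed values in each degree. -/
noncomputable def gradedHom {H : Type*} [AddCommGroup H] (f : ℤ → C →+ H) : C →+ H where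
  toFun x := Finsupp.liftAddHom f (F.coact x).coeff
  map_zero' := by rw [map_zero]; exact map_zero (Finsupp.liftAddHom f)
  map_add' x y := by rw [map_add]; exact map_add (Finsupp.liftAddHom f) _ _

theorem IsHom.gradedHom {H : Type*} [AddCommGroup H] (f : ℤ → C →+ H) {n : ℤ} {x : C}
    (hx : F.IsHom n x) : gradedHom (F := F) f x = f n x := by
  change Finsupp.liftAddHom f (F.coact x).coeff = f n x
  rw [hx, AddMonoidAlgebra.coeff_single, Finsupp.liftAddHom_apply_single]

variable (F) in
/-- The coordinates of an element of `C` with respect to left multiplication by `A`. -/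
noncomputable def leftCoord (n : ℤ) : C →+ (⨁ n : ℤ, (Fin (F.size n) → A)) :=
  (DirectSum.of (fun n : ℤ => Fin (F.size n) → A) n).comp
    (AddMonoidHom.mk' (fun x j => F.proj (x * F.lo n j)) fun x y => by
      ext j
      rw [add_mul, map_add, Pi.add_apply])

/-- For `x` of degree `n` and the partition `y_j, x_j` of degree `n`, one has `x = ∑ (x y_j) x_j`
with coefficients `x y_j` in `A`. So each `Cₙ` is a retract of a finite free module. -/
instance projective_left : Module.Projective A F.res := by
  let i : F.res →ₗ[A] (⨁ n : ℤ, (Fin (F.size n) → A)) :=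
    { toFun := fun x => gradedHom (F := F) F.leftCoord (F.toRes.symm x)
      map_add' := fun x y => by rw [map_add, map_add]
      map_smul' := fun a x => by
        obtain ⟨x, rfl⟩ := F.toRes.surjective x
        rw [smul_toRes, LinearEquiv.symm_apply_apply, LinearEquiv.symm_apply_apply,
          RingHom.id_apply]
        induction x using hom_induction (F := F) with
        | hom n x hx =>
          rw [hx.gradedHom, (((isHom_incl a).mul hx).cast (zero_add n)).gradedHom]
          change DirectSum.lof A ℤ (fun n : ℤ => Fin (F.size n) → A) n _ =
            a • DirectSum.lof A ℤ (fun n : ℤ => Fin (F.size n) → A) n _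
          rw [← map_smul]
          congr 1
          ext j
          change F.proj (F.incl a * x * F.lo n j) = a * F.proj (x * F.lo n j)
          rw [mul_assoc, proj_incl_mul]
        | add x y hx hy => rw [mul_add, map_add, map_add, hx, hy, smul_add] }
  let s : (⨁ n : ℤ, (Fin (F.size n) → A)) →ₗ[A] F.res :=
    DirectSum.toModule A ℤ F.res fun n =>
      Fintype.linearCombination A (fun j => F.toRes (F.hi n j))
  refine .of_split i s (LinearMap.ext fun x => ?_)
  obtain ⟨x, rfl⟩ := F.toRes.surjective x
  change s (gradedHom (F := F) F.leftCoord (F.toRes.symm (F.toRes x))) = F.toRes x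
  rw [LinearEquiv.symm_apply_apply]
  induction x using hom_induction (F := F) with
  | hom n x hx =>
    rw [hx.gradedHom]
    refine (DirectSum.toModule_lof A n _).trans ?_
    rw [Fintype.linearCombination_apply]
    change ∑ j, F.proj (x * F.lo n j) • F.toRes (F.hi n j) = F.toRes x
    simp only [smul_toRes]
    rw [← map_sum]
    congr 1
    have : ∀ j, F.incl (F.proj (x * F.lo n j)) = x * F.lo n j := fun j =>
      ((hx.mul (isHom_lo n j)).cast (add_neg_cancel n)).incl_proj
    simp only [this, mul_assoc]
    rw [← Finset.mul_sum, sum_lo_hi, mul_one]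
  | add x y hx hy => rw [map_add, map_add, map_add, hx, hy]

variable (F) in
/-- The coordinates of an element of `C` with respect to right multiplication by `A`. -/
noncomputable def rightCoord (n : ℤ) : C →+ (⨁ n : ℤ, (Fin (F.size (-n)) → Aᵐᵒᵖ)) :=
  (DirectSum.of (fun n : ℤ => Fin (F.size (-n)) → Aᵐᵒᵖ) n).comp
    (AddMonoidHom.mk' (fun x j => op (F.proj (F.hi (-n) j * x))) fun x y => by
      ext j
      rw [mul_add, map_add, Pi.add_apply, MulOpposite.op_add])

/-- Mirror image of the left-hand case: `x = ∑ y_j (x_j x)`. The partition is taken in degree `-n`,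
so that `x_j x` has degree zero when `x` has degree `n`. -/
instance projective_right : Module.Projective Aᵐᵒᵖ F.res := by
  let i : F.res →ₗ[Aᵐᵒᵖ] (⨁ n : ℤ, (Fin (F.size (-n)) → Aᵐᵒᵖ)) :=
    { toFun := fun x => gradedHom (F := F) F.rightCoord (F.toRes.symm x)
      map_add' := fun x y => by rw [map_add, map_add]
      map_smul' := fun a x => by
        obtain ⟨x, rfl⟩ := F.toRes.surjective x
        obtain ⟨a, rfl⟩ := op_surjective a
        rw [op_smul_toRes, LinearEquiv.symm_apply_apply, LinearEquiv.symm_apply_apply,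
          RingHom.id_apply]
        induction x using hom_induction (F := F) with
        | hom n x hx =>
          rw [hx.gradedHom, ((hx.mul (isHom_incl a)).cast (add_zero n)).gradedHom]
          change DirectSum.lof Aᵐᵒᵖ ℤ (fun n : ℤ => Fin (F.size (-n)) → Aᵐᵒᵖ) n _ =
            op a • DirectSum.lof Aᵐᵒᵖ ℤ (fun n : ℤ => Fin (F.size (-n)) → Aᵐᵒᵖ) n _
          rw [← map_smul]
          congr 1
          ext j
          change op (F.proj (F.hi (-n) j * (x * F.incl a))) =
            op a * op (F.proj (F.hi (-n) j * x))
          rw [← mul_assoc, proj_mul_incl, op_mul]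
        | add x y hx hy => rw [add_mul, map_add, map_add, hx, hy, smul_add] }
  let s : (⨁ n : ℤ, (Fin (F.size (-n)) → Aᵐᵒᵖ)) →ₗ[Aᵐᵒᵖ] F.res :=
    DirectSum.toModule Aᵐᵒᵖ ℤ F.res fun n =>
      Fintype.linearCombination Aᵐᵒᵖ (fun j => F.toRes (F.lo (-n) j))
  refine .of_split i s (LinearMap.ext fun x => ?_)
  obtain ⟨x, rfl⟩ := F.toRes.surjective x
  change s (gradedHom (F := F) F.rightCoord (F.toRes.symm (F.toRes x))) = F.toRes x
  rw [LinearEquiv.symm_apply_apply]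
  induction x using hom_induction (F := F) with
  | hom n x hx =>
    rw [hx.gradedHom]
    refine (DirectSum.toModule_lof Aᵐᵒᵖ n _).trans ?_
    rw [Fintype.linearCombination_apply]
    change ∑ j, op (F.proj (F.hi (-n) j * x)) • F.toRes (F.lo (-n) j) = F.toRes x
    simp only [op_smul_toRes]
    rw [← map_sum]
    congr 1
    have : ∀ j, F.incl (F.proj (F.hi (-n) j * x)) = F.hi (-n) j * x := fun j =>
      (((isHom_hi (-n) j).mul hx).cast (neg_add_cancel n)).incl_proj
    simp only [this, ← mul_assoc]
    rw [← Finset.sum_mul, sum_lo_hi, one_mul]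
  | add x y hx hy => rw [map_add, map_add, map_add, hx, hy]

theorem projective_base (F : Frame k A C) [Module.Projective k A] : Module.Projective k C :=
  have : Module.Projective k F.res := .of_tower (A := A)
  .of_equiv' F.toRes.symm

/-- `Y` is projective as a right module. -/
instance projective_Y : Module.Projective Cᵐᵒᵖ F.Y := by
  classical
  -- `Y` is free as a right module on the powers of `T`: for `c` of degree `m`, `c Tⁿ = Tⁿ⁻ᵐ · c`.
  let i0 : F.Y →+ (ℤ →₀ C) :=
    ylift fun n => gradedHom (F := F) fun m => Finsupp.singleAddHom (n - m)
  have hi0 : ∀ n m c, F.IsHom m c → i0 (F.mono n c) = Finsupp.single (n - m) c := fun n m c hc => by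
    rw [ylift_mono, hc.gradedHom]
    rfl
  have hi1 : ∀ (b : C) (y : F.Y), i0 (op b • y) = op b • i0 y := by
    refine fun b y => y_map_op_smul i0 (AddMonoidHom.mk' (fun b =>
      DistribSMul.toAddMonoidHom (ℤ →₀ C) (op b)) fun b b' =>
        AddMonoidHom.ext fun x => add_smul (op b) (op b') x) (fun m b hb n c => ?_) b y
    change i0 _ = op b • i0 _
    induction c using hom_induction (F := F) with
    | hom l c hc =>
      rw [hi0 _ _ _ (hc.mul hb), hi0 _ _ _ hc]
      refine Eq.trans ?_ (Finsupp.smul_single (op b) _ _).symm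
      congr 1
      ring
    | add c c' hc hc' => rw [add_mul, mono_add, mono_add, map_add, map_add, smul_add, hc, hc']
  let i : F.Y →ₗ[Cᵐᵒᵖ] (ℤ →₀ C) := { i0 with map_smul' := fun b y => hi1 b.unop y }
  let s : (ℤ →₀ C) →ₗ[Cᵐᵒᵖ] F.Y := Finsupp.lsum ℕ fun n =>
    { toFun := fun c => op c • F.mono n 1
      map_add' := fun c c' => by rw [MulOpposite.op_add, add_smul]
      map_smul' := fun b c => by
        rw [RingHom.id_apply, ← mul_smul]
        rfl }
  have : Module.Projective Cᵐᵒᵖ C := by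
    let e : Cᵐᵒᵖ ≃ₗ[Cᵐᵒᵖ] C :=
      { opAddEquiv.symm with map_smul' := fun a b => rfl }
    exact .of_equiv' e
  have : Module.Projective Cᵐᵒᵖ (ℤ →₀ C) :=
    .of_equiv' (finsuppLequivDFinsupp (ι := ℤ) (M := C) Cᵐᵒᵖ).symm
  refine .of_split i s (LinearMap.ext fun y => ?_)
  change s (i0 y) = y
  induction y using y_induction with
  | mono n c =>
    induction c using hom_induction (F := F) with
    | hom m c hc =>
      rw [hi0 n m c hc]
      refine (Finsupp.lsum_single ℕ _ _ _).trans ?_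
      change op c • F.mono (n - m) 1 = F.mono n c
      rw [op_smul_mono hc, sub_add_cancel, one_mul]
    | add c c' hc hc' => rw [mono_add, map_add, map_add, hc, hc']
  | add y z hy hz => rw [map_add, map_add, hy, hz]

end Frame

/-! ### Induction of modules and of resolutions along a ring homomorphism. -/

section Ind

variable {R S : Type u} [Ring R] [Ring S] (f : R →+* S)

/-- The relations `f r ⊗ m = 1 ⊗ r m` in `S ⊗ M`. -/
def indRel (M : Type u) [AddCommGroup M] [Module R M] : Submodule S (S ⊗[ℤ] M) :=
  Submodule.span S {t | ∃ (r : R) (m : M), t = f r ⊗ₜ[ℤ] m - 1 ⊗ₜ[ℤ] (r • m)}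

/-- The module induced along a homomorphism of rings. -/
def Ind (M : Type u) [AddCommGroup M] [Module R M] : Type u := (S ⊗[ℤ] M) ⧸ indRel f M

namespace Ind

variable {M M' M'' : Type u} [AddCommGroup M] [Module R M] [AddCommGroup M'] [Module R M']
  [AddCommGroup M''] [Module R M''] {N : Type u} [AddCommGroup N] [Module S N]

noncomputable instance : AddCommGroup (Ind f M) :=
  inferInstanceAs (AddCommGroup ((S ⊗[ℤ] M) ⧸ indRel f M))
noncomputable instance : Module S (Ind f M) := inferInstanceAs (Module S ((S ⊗[ℤ] M) ⧸ indRel f M))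

variable (M) in
/-- The quotient map. -/
def mkHom : (S ⊗[ℤ] M) →ₗ[S] Ind f M := (indRel f M).mkQ

variable (M) in
/-- The canonical semilinear map. -/
noncomputable def ι : M →ₛₗ[f] Ind f M where
  toFun m := mkHom f M (1 ⊗ₜ m)
  map_add' m m' := by rw [TensorProduct.tmul_add, map_add]
  map_smul' r m := by
    rw [← map_smul, TensorProduct.smul_tmul', smul_eq_mul, mul_one, ← sub_eq_zero, ← map_sub,
      ← neg_sub, map_neg, neg_eq_zero]
    exact (Submodule.Quotient.mk_eq_zero _).2 (Submodule.subset_span ⟨r, m, rfl⟩)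

variable {f}

theorem mkHom_tmul (s : S) (m : M) : mkHom f M (s ⊗ₜ m) = s • ι f M m := by
  change _ = s • mkHom f M (1 ⊗ₜ m)
  rw [← map_smul, TensorProduct.smul_tmul', smul_eq_mul, mul_one]

theorem mkHom_surjective : Function.Surjective (mkHom f M) := Submodule.mkQ_surjective _

@[elab_as_elim]
theorem induction {p : Ind f M → Prop} (x : Ind f M) (smul : ∀ (s : S) m, p (s • ι f M m))
    (add : ∀ x y, p x → p y → p (x + y)) : p x := by
  obtain ⟨t, rfl⟩ := mkHom_surjective x
  induction t using TensorProduct.induction_on with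
  | zero =>
    have h := smul 0 0
    rwa [zero_smul, ← map_zero (mkHom f M)] at h
  | tmul s m => rw [mkHom_tmul]; exact smul s m
  | add x y hx hy => rw [map_add]; exact add _ _ hx hy

/-- An additive map on the induced module. -/
noncomputable def addLift {Q : Type*} [AddCommGroup Q] (φ : S →+ M →+ Q)
    (hφ : ∀ s r m, φ (s * f r) m = φ s (r • m)) : Ind f M →+ Q :=
  QuotientAddGroup.lift (indRel f M).toAddSubgroup
    (TensorProduct.liftAddHom φ fun n s m => by rw [map_zsmul, map_zsmul]; rfl) (by
      intro t ht
      -- The relations span an `S`-submodule while the lifted map is only additive, so the vanishing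
      -- is proved on all `S`-multiples at once to make span induction work.
      suffices h : ∀ s : S, TensorProduct.liftAddHom φ
          (fun n s m => by rw [map_zsmul, map_zsmul]; rfl) (s • t) = 0 by
        have h1 := h 1
        rwa [one_smul] at h1
      replace ht : t ∈ indRel f M := ht
      unfold indRel at ht
      induction ht using Submodule.span_induction with
      | mem t ht =>
        obtain ⟨r, m, rfl⟩ := ht
        intro s
        rw [smul_sub, map_sub, TensorProduct.smul_tmul', TensorProduct.smul_tmul',
          TensorProduct.liftAddHom_tmul, TensorProduct.liftAddHom_tmul, smul_eq_mul, smul_eq_mul,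
          mul_one, hφ, sub_self]
      | zero => intro s; rw [smul_zero, map_zero]
      | add x y hx hy ihx ihy =>
        intro s
        rw [smul_add, map_add, ihx, ihy, add_zero]
      | smul a x hx ih => intro s; rw [← mul_smul]; exact ih (s * a))

theorem addLift_smul_ι {Q : Type*} [AddCommGroup Q] (φ : S →+ M →+ Q)
    (hφ : ∀ s r m, φ (s * f r) m = φ s (r • m)) (s : S) (m : M) :
    addLift φ hφ (s • ι f M m) = φ s m := by
  rw [← mkHom_tmul]
  exact TensorProduct.liftAddHom_tmul (R := ℤ) φ
    (fun n s m => by rw [map_zsmul, map_zsmul]; rfl) s m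

/-- The biadditive map `(s, m) ↦ s φ(m)`. -/
def smulHom (φ : M →ₛₗ[f] N) : S →+ M →+ N :=
  AddMonoidHom.mk' (fun s => (DistribSMul.toAddMonoidHom N s).comp φ.toAddMonoidHom)
    fun s t => AddMonoidHom.ext fun m => add_smul s t (φ m)

theorem smulHom_apply (φ : M →ₛₗ[f] N) (s : S) (m : M) : smulHom φ s m = s • φ m := rfl

theorem smulHom_balanced (φ : M →ₛₗ[f] N) (s : S) (r : R) (m : M) :
    smulHom φ (s * f r) m = smulHom φ s (r • m) := by
  rw [smulHom_apply, smulHom_apply, map_smulₛₗ, mul_smul]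

/-- The linear map on the induced module given by a semilinear map. -/
noncomputable def lift (φ : M →ₛₗ[f] N) : Ind f M →ₗ[S] N where
  toFun := addLift (smulHom φ) (smulHom_balanced φ)
  map_add' := map_add _
  map_smul' s x := by
    rw [RingHom.id_apply]
    induction x using induction with
    | smul t m =>
      rw [← mul_smul, addLift_smul_ι, addLift_smul_ι, smulHom_apply, smulHom_apply, mul_smul]
    | add x y hx hy => rw [smul_add, map_add, map_add, smul_add, hx, hy]

theorem lift_ι (φ : M →ₛₗ[f] N) (m : M) : lift φ (ι f M m) = φ m := by
  rw [← one_smul S (ι f M m)]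
  exact (addLift_smul_ι (smulHom φ) (smulHom_balanced φ) 1 m).trans (one_smul S (φ m))

theorem hom_ext {g h : Ind f M →ₗ[S] N} (e : ∀ m, g (ι f M m) = h (ι f M m)) : g = h := by
  ext x
  induction x using induction with
  | smul s m => rw [map_smul, map_smul, e]
  | add x y hx hy => rw [map_add, map_add, hx, hy]

variable (f) in
/-- Functoriality of induction. -/
noncomputable def map (g : M →ₗ[R] M') : Ind f M →ₗ[S] Ind f M' := lift ((ι f M').comp g)

theorem map_ι (g : M →ₗ[R] M') (m : M) : map f g (ι f M m) = ι f M' (g m) := lift_ι _ m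

theorem map_surjective {g : M →ₗ[R] M'} (hg : Function.Surjective g) :
    Function.Surjective (map f g) := by
  intro x
  induction x using induction with
  | smul s m =>
    obtain ⟨m, rfl⟩ := hg m
    exact ⟨s • ι f M m, by rw [map_smul, map_ι]⟩
  | add x y hx hy =>
    obtain ⟨x, rfl⟩ := hx
    obtain ⟨y, rfl⟩ := hy
    exact ⟨x + y, map_add _ _ _⟩

instance [Subsingleton M] : Subsingleton (Ind f M) := by
  have h : (LinearMap.id : Ind f M →ₗ[S] Ind f M) = 0 := hom_ext fun m => by
    rw [Subsingleton.elim m 0, map_zero, map_zero, map_zero]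
  exact subsingleton_of_forall_eq 0 fun x => LinearMap.congr_fun h x

/-- A section of the free cover of `M` has coordinates in `R`; pushing them to `S` gives a section
of the free cover of the induced module. -/
instance [Module.Projective R M] : Module.Projective S (Ind f M) := by
  obtain ⟨s, hs⟩ := ‹Module.Projective R M›
  let i : Ind f M →ₗ[S] (M →₀ S) := lift
    { toFun := fun m => (s m).mapRange f (map_zero f)
      map_add' := fun m m' => by rw [map_add, Finsupp.mapRange_add (map_add f)]
      map_smul' := fun r m => by
        ext x
        rw [map_smul, Finsupp.mapRange_apply, Finsupp.smul_apply, Finsupp.smul_apply,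
          Finsupp.mapRange_apply, smul_eq_mul, smul_eq_mul, map_mul] }
  refine .of_split i (Finsupp.linearCombination S (ι f M)) (hom_ext fun m => ?_)
  rw [LinearMap.comp_apply, lift_ι, LinearMap.id_apply]
  change Finsupp.linearCombination S (ι f M) ((s m).mapRange f (map_zero f)) = _
  conv_rhs => rw [← hs m]
  rw [Finsupp.linearCombination_apply, Finsupp.linearCombination_apply,
    Finsupp.sum_mapRange_index (fun i => zero_smul S (ι f M i)), map_finsuppSum]
  simp only [map_smulₛₗ, id]

instance [Module.Finite R M] : Module.Finite S (Ind f M) := by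
  classical
  obtain ⟨n, s, hs⟩ := Module.Finite.exists_fin (R := R) (M := M)
  refine ⟨⟨Finset.univ.image (fun i => ι f M (s i)), ?_⟩⟩
  rw [eq_top_iff]
  rintro x -
  induction x using induction with
  | smul t m =>
    refine Submodule.smul_mem _ _ ?_
    have hm : m ∈ Submodule.span R (Set.range s) := hs ▸ Submodule.mem_top
    induction hm using Submodule.span_induction with
    | mem m hm =>
      obtain ⟨i, rfl⟩ := hm
      exact Submodule.subset_span (by simp)
    | zero => rw [map_zero]; exact Submodule.zero_mem _
    | add x y _ _ hx hy => rw [map_add]; exact Submodule.add_mem _ hx hy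
    | smul r x _ hx => rw [map_smulₛₗ]; exact Submodule.smul_mem _ _ hx
  | add x y hx hy => exact Submodule.add_mem _ hx hy

end Ind

/-- A presentation of `S` as a retract of a free right module over `R`. -/
structure RightSection (f : R →+* S) where
  J : Type u
  gen : J → S
  coord : S →+ (J →₀ R)
  coord_mul : ∀ s r j, coord (s * f r) j = coord s j * r
  sum_coord : ∀ s, ((coord s).sum fun j r => gen j * f r) = s

namespace Ind

variable {f} (σ : RightSection f)
variable {M M' M'' : Type u} [AddCommGroup M] [AddCommGroup M'] [AddCommGroup M'']
  [Module R M'] [Module R M''] [Module R M]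

/-- The coordinates of an element of the induced module. -/
noncomputable def coord : Ind f M →+ (σ.J →₀ M) :=
  addLift
    (AddMonoidHom.mk' (fun s => AddMonoidHom.mk'
      (fun m => (σ.coord s).mapRange (fun r => r • m) (zero_smul R m)) fun m m' => by
        ext j
        simp only [Finsupp.mapRange_apply, Finsupp.add_apply, smul_add]) fun s t => by
      ext m j
      change (σ.coord (s + t)).mapRange (fun r => r • m) (zero_smul R m) j =
        (σ.coord s).mapRange (fun r => r • m) (zero_smul R m) j +
        (σ.coord t).mapRange (fun r => r • m) (zero_smul R m) j
      simp only [Finsupp.mapRange_apply, map_add, Finsupp.add_apply, add_smul])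
    fun s r m => by
      ext j
      change (σ.coord (s * f r)).mapRange (fun r => r • m) (zero_smul R m) j =
        (σ.coord s).mapRange (fun t => t • r • m) (zero_smul R (r • m)) j
      simp only [Finsupp.mapRange_apply, σ.coord_mul, mul_smul]

theorem coord_smul_ι (s : S) (m : M) (j : σ.J) : coord σ (s • ι f M m) j = σ.coord s j • m := by
  unfold coord
  rw [addLift_smul_ι]
  rfl

theorem coord_map (g : M →ₗ[R] M') (x : Ind f M) (j : σ.J) :
    coord σ (map f g x) j = g (coord σ x j) := by
  induction x using induction with
  | smul s m => rw [map_smul, map_ι, coord_smul_ι, coord_smul_ι, map_smul]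
  | add x y hx hy =>
    rw [map_add (map f g), map_add (coord σ), map_add (coord σ), Finsupp.add_apply,
      Finsupp.add_apply, hx, hy, map_add]

theorem sum_coord (x : Ind f M) : ((coord σ x).sum fun j m => σ.gen j • ι f M m) = x := by
  induction x using induction with
  | smul s m =>
    have h : coord σ (s • ι f M m) = (σ.coord s).mapRange (fun r => r • m) (zero_smul R m) := by
      ext j
      rw [coord_smul_ι, Finsupp.mapRange_apply]
    rw [h, Finsupp.sum_mapRange_index (fun _ => by rw [map_zero, smul_zero])]
    conv_rhs => rw [← σ.sum_coord s]
    simp only [Finsupp.sum, Finset.sum_smul, map_smulₛₗ, mul_smul]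
  | add x y hx hy =>
    rw [map_add, Finsupp.sum_add_index' (fun _ => by rw [map_zero, smul_zero])
      (fun _ _ _ => by rw [map_add, smul_add]), hx, hy]

/-- Flatness made explicit: the coordinates given by `σ` make the induced module a retract of a
direct sum of copies of `M`, naturally in `M`, so preimages can be chosen coordinate by coordinate.
-/
theorem map_exact (σ : RightSection f) {a : M →ₗ[R] M'} {b : M' →ₗ[R] M''}
    (h : Function.Exact a b) :
    Function.Exact (map f a) (map f b) := by
  intro z
  constructor
  · intro hz
    have h1 : ∀ j, ∃ w, a w = coord σ z j := fun j => by
      apply (h _).1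
      rw [← coord_map, hz, map_zero, Finsupp.zero_apply]
    choose w hw using h1
    refine ⟨∑ j ∈ (coord σ z).support, σ.gen j • ι f M (w j), ?_⟩
    conv_rhs => rw [← sum_coord σ z]
    rw [map_sum]
    refine Finset.sum_congr rfl fun j _ => ?_
    rw [map_smul, map_ι, hw]
  · rintro ⟨x, rfl⟩
    refine LinearMap.congr_fun (f := (map f b).comp (map f a)) (g := 0) (hom_ext fun m => ?_) x
    rw [LinearMap.comp_apply, map_ι, map_ι, h.apply_apply_eq_zero, map_zero, LinearMap.zero_apply]

end Ind

/-- The resolution induced along a homomorphism of rings. -/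
noncomputable def ProjRes.ind {f : R →+* S} (σ : RightSection f) {M : ModuleCat.{u} R}
    (P : ProjRes M)
    {N : ModuleCat.{u} S} (e : Ind f M ≃ₗ[S] N) : ProjRes N where
  X n := Ind f (P.X n)
  d n := Ind.map f (P.d n)
  aug := e.toLinearMap ∘ₗ Ind.map f P.aug
  projective n := have := P.projective n; inferInstance
  aug_surjective := e.surjective.comp (Ind.map_surjective P.aug_surjective)
  exact_zero := by
    intro x
    refine Iff.trans ?_ (Ind.map_exact σ P.exact_zero x)
    exact e.map_eq_zero_iff
  exact_succ n := Ind.map_exact σ (P.exact_succ n)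

end Ind

/-! ### `Y` is induced from `A`; the finite resolution of `C`. -/

section Diagonal

variable (k A : Type u) [CommRing k] [Ring A] [Algebra k A]

/-- The element of the diagonal bimodule given by an element of the algebra. -/
def diag (a : A) : diagonalModule k A := a

variable {k A}

theorem env_smul_diag (a : A) (b : Aᵐᵒᵖ) (x : A) :
    (a ⊗ₜ[k] b : Enveloping k A) • diag k A x = diag k A (a * x * b.unop) := 
  (mul_assoc a x b.unop).symm

theorem diag_surjective (x : diagonalModule k A) : ∃ a, diag k A a = x := ⟨x, rfl⟩

variable (k A) in
/-- The element of the algebra given by an element of the diagonal bimodule. -/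
def undiag : diagonalModule k A →+ A := AddMonoidHom.id A

theorem undiag_diag (a : A) : undiag k A (diag k A a) = a := rfl

end Diagonal

namespace Frame

variable {k A C : Type u} [CommRing k] [Ring A] [Algebra k A] [Ring C] [Algebra k C]
  (F : Frame k A C)

/-- The inclusion of enveloping algebras. -/
noncomputable def env : Enveloping k A →+* Enveloping k C :=
  (Algebra.TensorProduct.map F.incl (AlgHom.op F.incl) : Enveloping k A →ₐ[k] Enveloping k C)

variable {F}

theorem env_tmul (a : A) (b : Aᵐᵒᵖ) :
    F.env (a ⊗ₜ[k] b) = F.incl a ⊗ₜ[k] op (F.incl b.unop) := rfl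

/-- Coordinates on the enveloping algebra of `C` given by coordinates on both factors. -/
noncomputable def envCoord (sr : F.res →ₗ[Aᵐᵒᵖ] (F.res →₀ Aᵐᵒᵖ)) (sl : F.res →ₗ[A] (F.res →₀ A)) :
    Enveloping k C →ₗ[k] ((F.res × F.res) →₀ Enveloping k A) :=
  (finsuppTensorFinsupp k k A Aᵐᵒᵖ F.res F.res).toLinearMap ∘ₗ
    TensorProduct.map
      (Finsupp.mapRange.linearMap (opLinearEquiv k).symm.toLinearMap ∘ₗ sr.restrictScalars k ∘ₗ
        F.toRes.toLinearMap)
      (Finsupp.mapRange.linearMap (opLinearEquiv k).toLinearMap ∘ₗ sl.restrictScalars k ∘ₗ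
        F.toRes.toLinearMap ∘ₗ (opLinearEquiv k).symm.toLinearMap)

theorem envCoord_tmul (sr : F.res →ₗ[Aᵐᵒᵖ] (F.res →₀ Aᵐᵒᵖ)) (sl : F.res →ₗ[A] (F.res →₀ A))
    (c : C) (c' : Cᵐᵒᵖ) (x y : F.res) :
    envCoord sr sl (c ⊗ₜ c') (x, y) =
      unop (sr (F.toRes c) x) ⊗ₜ[k] op (sl (F.toRes c'.unop) y) := by
  unfold envCoord
  rw [LinearMap.comp_apply, TensorProduct.map_tmul]
  exact finsuppTensorFinsupp_apply ..

/-- Reassembling from coordinates may be done in each tensor factor separately. Both sides are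
biadditive in `p` and `q`, which reduces this to single terms. -/
theorem sum_finsuppTensorFinsupp (p : F.res →₀ A) (q : F.res →₀ Aᵐᵒᵖ) :
    ((finsuppTensorFinsupp k k A Aᵐᵒᵖ F.res F.res (p ⊗ₜ[k] q)).sum fun j r =>
        (F.toRes.symm j.1 ⊗ₜ[k] op (F.toRes.symm j.2)) * F.env r) =
      (p.sum fun x a => F.toRes.symm x * F.incl a) ⊗ₜ[k]
        (q.sum fun y b => op (F.incl b.unop * F.toRes.symm y)) := by
  have h0 : ∀ j : F.res × F.res,
      (F.toRes.symm j.1 ⊗ₜ[k] op (F.toRes.symm j.2)) * F.env 0 = 0 := fun _ => by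
    rw [map_zero, mul_zero]
  have h1 : ∀ (j : F.res × F.res) (r r' : Enveloping k A),
      (F.toRes.symm j.1 ⊗ₜ[k] op (F.toRes.symm j.2)) * F.env (r + r') =
      (F.toRes.symm j.1 ⊗ₜ[k] op (F.toRes.symm j.2)) * F.env r +
      (F.toRes.symm j.1 ⊗ₜ[k] op (F.toRes.symm j.2)) * F.env r' := fun _ _ _ => by
    rw [map_add, mul_add]
  induction p using Finsupp.induction_linear with
  | zero =>
    rw [TensorProduct.zero_tmul, map_zero, Finsupp.sum_zero_index, Finsupp.sum_zero_index,
      TensorProduct.zero_tmul]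
  | add p p' hp hp' =>
    rw [TensorProduct.add_tmul, map_add, Finsupp.sum_add_index' h0 h1, hp, hp',
      ← TensorProduct.add_tmul, Finsupp.sum_add_index' (fun _ => by rw [map_zero, mul_zero])
        (fun _ _ _ => by rw [map_add, mul_add])]
  | single x a =>
    induction q using Finsupp.induction_linear with
    | zero =>
      rw [TensorProduct.tmul_zero, map_zero, Finsupp.sum_zero_index, Finsupp.sum_zero_index,
        TensorProduct.tmul_zero]
    | add q q' hq hq' =>
      rw [TensorProduct.tmul_add, map_add, Finsupp.sum_add_index' h0 h1, hq, hq',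
        ← TensorProduct.tmul_add, Finsupp.sum_add_index'
          (fun _ => by rw [unop_zero, map_zero, zero_mul, op_zero])
          (fun _ _ _ => by rw [unop_add, map_add, add_mul, MulOpposite.op_add])]
    | single y b =>
      rw [finsuppTensorFinsupp_single, Finsupp.sum_single_index (h0 _),
        Finsupp.sum_single_index (by rw [map_zero, mul_zero]),
        Finsupp.sum_single_index (by rw [unop_zero, map_zero, zero_mul, op_zero]), env_tmul,
        Algebra.TensorProduct.tmul_mul_tmul, op_mul]

variable (F) in
/-- The enveloping algebra of `C` is projective as a right module over that of `A`. -/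
noncomputable def rightSection : RightSection F.env :=
  -- Right multiplication by `a ⊗ op a'` sends `c ⊗ op c'` to `c a ⊗ op (a' c')`. So the first
  -- factor needs coordinates for the right `A`-module `C`, the second for the left one.
  let sr := (projective_right (F := F)).out.choose
  let hr := (projective_right (F := F)).out.choose_spec
  let sl := (projective_left (F := F)).out.choose
  let hl := (projective_left (F := F)).out.choose_spec
  { J := F.res × F.res
    gen := fun p => F.toRes.symm p.1 ⊗ₜ op (F.toRes.symm p.2)
    coord := (envCoord sr sl).toAddMonoidHom
    coord_mul := by
      rintro s r ⟨x, y⟩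
      change envCoord sr sl (s * F.env r) (x, y) = envCoord sr sl s (x, y) * r
      induction s using Enveloping.induction with
      | tmul c c' =>
        induction r using Enveloping.induction with
        | tmul a a' =>
          rw [env_tmul, Algebra.TensorProduct.tmul_mul_tmul, envCoord_tmul, envCoord_tmul,
            Algebra.TensorProduct.tmul_mul_tmul, ← op_smul_toRes, map_smul]
          have h : F.toRes (c' * op (F.incl a'.unop)).unop = a'.unop • F.toRes c'.unop := rfl
          rw [h, map_smul]
          rfl
        | add r r' h h' =>
          rw [map_add, mul_add, map_add, Finsupp.add_apply, h, h', mul_add]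
      | add s s' h h' =>
        rw [add_mul, map_add (envCoord sr sl), map_add (envCoord sr sl), Finsupp.add_apply,
          Finsupp.add_apply, h, h', add_mul]
    sum_coord := by
      intro s
      change ((envCoord sr sl s).sum fun j r =>
        (F.toRes.symm j.1 ⊗ₜ[k] op (F.toRes.symm j.2)) * F.env r) = s
      induction s using Enveloping.induction with
      | tmul c c' =>
        have h1 : (envCoord sr sl (c ⊗ₜ c')) =
            finsuppTensorFinsupp k k A Aᵐᵒᵖ F.res F.res
              ((sr (F.toRes c)).mapRange unop rfl ⊗ₜ[k]
                (sl (F.toRes c'.unop)).mapRange op rfl) := by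
          ext ⟨x, y⟩
          rw [envCoord_tmul, finsuppTensorFinsupp_apply]
          rfl
        rw [h1, sum_finsuppTensorFinsupp]
        congr 1
        · rw [Finsupp.sum_mapRange_index (fun _ => by rw [map_zero, mul_zero])]
          apply F.toRes.injective
          conv_rhs => rw [← hr (F.toRes c)]
          exact map_finsuppSum F.toRes _ _
        · rw [Finsupp.sum_mapRange_index (fun _ => by rw [unop_zero, map_zero, zero_mul, op_zero])]
          apply unop_injective
          apply F.toRes.injective
          conv_rhs => rw [← hl (F.toRes c'.unop)]
          exact map_finsuppSum (F.toRes.toLinearMap.comp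
            (opLinearEquiv k (M := C)).symm.toLinearMap) _ _
      | add s s' h h' =>
        rw [map_add, Finsupp.sum_add_index' (fun _ => by rw [map_zero, mul_zero])
          (fun _ _ _ => by rw [map_add, mul_add]), h, h'] }

theorem isCentral_ι : IsCentral k F (Ind.ι F.env (diagonalModule k A) (diag k A 1)) := by
  intro a
  have h1 := (Ind.ι F.env (diagonalModule k A)).map_smulₛₗ (a ⊗ₜ[k] 1) (diag k A 1)
  have h2 := (Ind.ι F.env (diagonalModule k A)).map_smulₛₗ (1 ⊗ₜ[k] op a) (diag k A 1)
  rw [env_smul_diag, env_tmul] at h1 h2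
  simp only [mul_one, one_mul, unop_one, unop_op, map_one, op_one] at h1 h2
  rw [← h1, ← h2]

variable (F) in
/-- The map `A → Y`. -/
noncomputable def diagY : diagonalModule k A →ₛₗ[F.env] F.Y where
  toFun a := F.mono 0 (F.incl (undiag k A a))
  map_add' a b := by rw [← mono_add, ← map_add, ← map_add]
  map_smul' s x := by
    obtain ⟨x, rfl⟩ := diag_surjective x
    induction s using Enveloping.induction with
    | tmul a b =>
      rw [env_smul_diag, env_tmul, Bimodule.env_smul, undiag_diag, undiag_diag,
        op_smul_mono (isHom_incl _), smul_mono, map_mul, map_mul, mul_assoc, add_zero]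
    | add s t hs ht =>
      rw [map_add F.env, add_smul, map_add (undiag k A), map_add F.incl, mono_add, hs, ht, add_smul]

theorem diagY_diag (a : A) : F.diagY (diag k A a) = F.mono 0 (F.incl a) := rfl

variable (F) in
/-- The bimodule induced from `A` is `Y`. -/
noncomputable def indEquiv : Ind F.env (diagonalModule k A) ≃ₗ[Enveloping k C]
    ModuleCat.of (Enveloping k C) F.Y :=
  -- Maps out of either module correspond to `A`-central elements, so the universal maps in both
  -- directions are inverse to each other as soon as the generators match.
  LinearEquiv.ofLinearMap (Ind.lift F.diagY) (desc _ isCentral_ι)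
    (y_hom_ext (by
      rw [LinearMap.comp_apply, desc_one, Ind.lift_ι, diagY_diag, map_one]
      rfl))
    (Ind.hom_ext fun m => by
      obtain ⟨a, rfl⟩ := diag_surjective m
      rw [LinearMap.comp_apply, Ind.lift_ι, diagY_diag, ← mul_one (F.incl a), ← smul_mono,
        Bimodule.smul_eq_env, map_smul, desc_one, LinearMap.id_apply]
      have h1 := (Ind.ι F.env (diagonalModule k A)).map_smulₛₗ (a ⊗ₜ[k] 1) (diag k A 1)
      rw [env_smul_diag, env_tmul] at h1
      simp only [mul_one, unop_one, map_one, op_one] at h1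
      exact h1.symm)

theorem indEquiv_ι (a : A) :
    F.indEquiv (Ind.ι F.env (diagonalModule k A) (diag k A a)) = F.mono 0 (F.incl a) :=
  Ind.lift_ι F.diagY _

variable (F) in
/-- The resolution of `Y` induced from a resolution of `A`. -/
noncomputable def indRes (P : ProjRes (diagonalModule k A)) :
    ProjRes (ModuleCat.of (Enveloping k C) F.Y) :=
  P.ind F.rightSection F.indEquiv

/-- If `A` has a finite resolution by finitely generated projective bimodules, then so has `C`. -/
theorem hasGoodResolution (F : Frame k A C) (h : HasGoodResolution k A) :
    HasGoodResolution k C := by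
  obtain ⟨Q, hfin, n, hn⟩ := h
  let P := ProjRes.ofResolution Q
  have hX : ∀ i, Module.Finite (Enveloping k A) (P.X i) := hfin
  have hX' : ∀ i, n < i → Subsingleton (P.X i) := fun i hi =>
    ModuleCat.subsingleton_of_isZero (hn i hi)
  have : ∀ i, Module.Finite (Enveloping k C) ((F.indRes P).X i) := fun i =>
    inferInstanceAs (Module.Finite (Enveloping k C) (Ind F.env (P.X i)))
  -- `C` is the cokernel of the injective map `1 - T` on `Y`, so the cone over a lift of `T`
  -- resolves it, with one more term than the given resolution.
  obtain ⟨σ⟩ := ProjRes.exists_lift (F.indRes P) (F.indRes P) (F.shift 1)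
  let Z : ProjRes (diagonalModule k C) := (F.indRes P).cone σ F.mult mult_surjective mult_exact
    fun y hy => eq_zero_of_shift_eq hy
  refine Z.hasGoodResolution (m := n + 1) (ProjRes.cone_finite _)
    (ProjRes.cone_subsingleton (F.indRes P) fun i hi => ?_)
  have := hX' i hi
  exact inferInstanceAs (Subsingleton (Ind F.env (P.X i)))

end Frame

/-! ### The bar resolution. -/

namespace Bimodule

variable {k R : Type u} [CommRing k] [Ring R] [Algebra k R]

/-- The underlying module of `R ⊗ B`. -/
def OuterCarrier (B : Bimodule k R) : Type u := R ⊗[k] B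

section

variable (B : Bimodule k R)

noncomputable instance : AddCommGroup (OuterCarrier B) := inferInstanceAs (AddCommGroup (R ⊗[k] B))
noncomputable instance : Module k (OuterCarrier B) := inferInstanceAs (Module k (R ⊗[k] B))
noncomputable instance : Module R (OuterCarrier B) := inferInstanceAs (Module R (R ⊗[k] B))
noncomputable instance : Module (Module.End k (R ⊗[k] B)) (OuterCarrier B) :=
  inferInstanceAs (Module (Module.End k (R ⊗[k] B)) (R ⊗[k] B))

/-- The bimodule `R ⊗ B` with `a (x ⊗ b) c = a x ⊗ b c`. -/
noncomputable def outer : Bimodule k R :=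
  letI : Module Rᵐᵒᵖ (OuterCarrier B) := Module.compHom _
    ((Module.End.lTensorAlgHom k B R).comp (Algebra.lsmul k k B : Rᵐᵒᵖ →ₐ[k] Module.End k B) :
      Rᵐᵒᵖ →+* Module.End k (R ⊗[k] B))
  { carrier := OuterCarrier B
    smulComm := ⟨fun a c (t : R ⊗[k] B) => by
      change a • LinearMap.lTensor R (Algebra.lsmul k k B c) t =
        LinearMap.lTensor R (Algebra.lsmul k k B c) (a • t)
      induction t using TensorProduct.induction_on with
      | zero => simp
      | tmul x b => simp [TensorProduct.smul_tmul']
      | add s t hs ht => rw [map_add, smul_add, smul_add, map_add, hs, ht]⟩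
    towerLeft := inferInstanceAs (IsScalarTower k R (R ⊗[k] B))
    towerRight := ⟨fun r c (t : R ⊗[k] B) => by
      change LinearMap.lTensor R (Algebra.lsmul k k B (r • c)) t =
        r • LinearMap.lTensor R (Algebra.lsmul k k B c) t
      rw [map_smul, LinearMap.lTensor_smul, LinearMap.smul_apply]⟩ }

/-- The bilinear map `(x, b) ↦ x ⊗ b`. -/
noncomputable def cons : R →ₗ[k] B →ₗ[k] B.outer := TensorProduct.mk k R B

end

variable {B : Bimodule k R}

theorem smul_cons (a x : R) (b : B) : a • cons B x b = cons B (a * x) b := rfl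

theorem op_smul_cons (c : Rᵐᵒᵖ) (x : R) (b : B) : c • cons B x b = cons B x (c • b) := rfl

@[elab_as_elim]
theorem outer_induction {p : B.outer → Prop} (t : B.outer) (cons : ∀ x b, p (cons B x b))
    (add : ∀ s t, p s → p t → p (s + t)) : p t := by
  refine TensorProduct.induction_on (motive := p) (t : R ⊗[k] B) ?_ cons add
  have h := cons 0 0
  rwa [map_zero] at h

/-- The linear map on `R ⊗ B` given by a bilinear map. -/
noncomputable def outerLift {Q : Type*} [AddCommGroup Q] [Module k Q] (f : R →ₗ[k] B →ₗ[k] Q) :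
    B.outer →ₗ[k] Q := (TensorProduct.lift f : R ⊗[k] B →ₗ[k] Q)

theorem outerLift_cons {Q : Type*} [AddCommGroup Q] [Module k Q] (f : R →ₗ[k] B →ₗ[k] Q)
    (x : R) (b : B) : outerLift f (cons B x b) = f x b := TensorProduct.lift.tmul x b

/-- `R ⊗ B` is projective as a bimodule if `B` is projective as a right module. -/
theorem projective_outer [Module.Projective Rᵐᵒᵖ B] :
    Module.Projective (Enveloping k R) B.outer := by
  obtain ⟨s, hs⟩ := ‹Module.Projective Rᵐᵒᵖ B›
  -- A section of the free cover of `B` as a right module, tensored with `R`, has coordinates in `R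
  -- ⊗ Rᵐᵒᵖ`, which is the enveloping algebra.
  let i0 : B.outer →ₗ[k] (B →₀ Enveloping k R) := outerLift (LinearMap.mk₂ k
    (fun x b => (s b).mapRange (fun c => (x ⊗ₜ[k] c : Enveloping k R))
      (TensorProduct.tmul_zero _ _))
    (fun x y b => by
      ext c; simp only [Finsupp.mapRange_apply, Finsupp.add_apply, TensorProduct.add_tmul])
    (fun r x b => by
      ext c; simp only [Finsupp.mapRange_apply, Finsupp.smul_apply, TensorProduct.smul_tmul'])
    (fun x b b' => by
      ext c; simp only [Finsupp.mapRange_apply, Finsupp.add_apply, map_add, TensorProduct.tmul_add])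
    (fun r x b => by
      ext c
      rw [← algebraMap_smul Rᵐᵒᵖ r b, map_smul, algebraMap_smul]
      simp only [Finsupp.mapRange_apply, Finsupp.smul_apply, TensorProduct.tmul_smul]))
  have hi0 : ∀ x b c, i0 (cons B x b) c = x ⊗ₜ[k] s b c := fun x b c => by
    rw [outerLift_cons]
    rfl
  let i : B.outer →ₗ[Enveloping k R] (B →₀ Enveloping k R) :=
    envLinear (H := B →₀ Enveloping k R) i0.toAddMonoidHom
    (fun a t => by
      change i0 (a • t) = (a ⊗ₜ[k] (1 : Rᵐᵒᵖ) : Enveloping k R) • i0 t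
      induction t using outer_induction with
      | cons x b =>
        ext c
        rw [smul_cons, hi0, Finsupp.smul_apply, hi0, smul_eq_mul,
          Algebra.TensorProduct.tmul_mul_tmul, one_mul]
      | add t t' h h' => rw [smul_add, map_add, map_add, smul_add, h, h'])
    (fun a t => by
      change i0 (a • t) = ((1 : R) ⊗ₜ[k] a : Enveloping k R) • i0 t
      induction t using outer_induction with
      | cons x b =>
        ext c
        rw [op_smul_cons, hi0, map_smul, Finsupp.smul_apply, Finsupp.smul_apply, hi0, smul_eq_mul,
          smul_eq_mul, Algebra.TensorProduct.tmul_mul_tmul, one_mul]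
      | add t t' h h' => rw [smul_add, map_add, map_add, smul_add, h, h'])
  refine .of_split i (Finsupp.linearCombination _ fun b => cons B 1 b) (LinearMap.ext fun t => ?_)
  change Finsupp.linearCombination _ (fun b => cons B 1 b) (i0 t) = t
  induction t using outer_induction with
  | cons x b =>
    have h : i0 (cons B x b) = (s b).mapRange (fun c => (x ⊗ₜ[k] c : Enveloping k R))
        (TensorProduct.tmul_zero _ _) := outerLift_cons _ _ _
    rw [h, Finsupp.linearCombination_apply, Finsupp.sum_mapRange_index
      (h := fun c (a : Enveloping k R) => a • cons B 1 c)
      (fun c => zero_smul (Enveloping k R) (cons B 1 c))]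
    conv_rhs => rw [← hs b, Finsupp.linearCombination_apply, map_finsuppSum]
    refine Finsupp.sum_congr fun c _ => ?_
    rw [env_smul, op_smul_cons, smul_cons, mul_one]
    rfl
  | add s t hs ht => rw [map_add, map_add, hs, ht]

/-- `R ⊗ B` is projective as a right module if `B` is and `R` is projective over `k`. -/
theorem projective_right_outer [Module.Projective Rᵐᵒᵖ B] [Module.Projective k R] :
    Module.Projective Rᵐᵒᵖ B.outer := by
  classical
  obtain ⟨s, hs⟩ := ‹Module.Projective k R›
  -- A `k`-linear section of the free cover of `R` makes `R ⊗ B` a retract of a direct sum of copies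
  -- of `B`.
  let i0 : B.outer →ₗ[k] (R →₀ B) := outerLift (LinearMap.mk₂ k
    (fun x b => (s x).mapRange (fun c => c • b) (zero_smul _ _))
    (fun x y b => by
      ext c; simp only [map_add, Finsupp.mapRange_apply, Finsupp.add_apply, add_smul])
    (fun r x b => by
      ext c
      simp only [map_smul, Finsupp.mapRange_apply, Finsupp.smul_apply, smul_assoc])
    (fun x b b' => by
      ext c; simp only [Finsupp.mapRange_apply, Finsupp.add_apply, smul_add])
    (fun r x b => by
      ext c
      simp only [Finsupp.mapRange_apply, Finsupp.smul_apply, smul_comm r]))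
  have hi0 : ∀ x b c, i0 (cons B x b) c = s x c • b := fun x b c => by
    rw [outerLift_cons]
    rfl
  let i : B.outer →ₗ[Rᵐᵒᵖ] (R →₀ B) :=
    { i0 with
      map_smul' := fun a t => by
        change i0 (a • t) = a • i0 t
        induction t using outer_induction with
        | cons x b =>
          ext c
          rw [op_smul_cons, hi0, Finsupp.smul_apply, hi0, smul_comm]
        | add t t' h h' => rw [smul_add, map_add, map_add, smul_add, h, h'] }
  let r : (R →₀ B) →ₗ[Rᵐᵒᵖ] B.outer := Finsupp.lsum ℕ fun x =>
    { (cons B x) with map_smul' := fun c b => rfl }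
  have : Module.Projective Rᵐᵒᵖ (R →₀ B) :=
    .of_equiv' (finsuppLequivDFinsupp (ι := R) (M := B) Rᵐᵒᵖ).symm
  refine .of_split i r (LinearMap.ext fun t => ?_)
  change r (i0 t) = t
  induction t using outer_induction with
  | cons x b =>
    have h : i0 (cons B x b) = (s x).mapRange (fun c => c • b) (zero_smul _ _) :=
      outerLift_cons _ _ _
    rw [h]
    refine (Finsupp.lsum_apply ..).trans ?_
    rw [Finsupp.sum_mapRange_index (fun _ => map_zero _)]
    conv_rhs => rw [← hs x, Finsupp.linearCombination_apply]
    change ((s x).sum fun y c => cons B y (c • b)) = (cons B).flip b _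
    rw [map_finsuppSum]
    refine Finsupp.sum_congr fun y _ => ?_
    rw [map_smul, map_smul]
    rfl
  | add s t hs ht => rw [map_add, map_add, hs, ht]

/-- The terms `R ⊗ ⋯ ⊗ R ⊗ M` of the bar resolution. -/
noncomputable def bar (M : Bimodule k R) : ℕ → Bimodule k R
  | 0 => M
  | n + 1 => outer (bar M n)

variable (M : Bimodule k R)

/-- The bilinear map `(x, b) ↦ x ⊗ b`. -/
noncomputable def bcons (n : ℕ) : R →ₗ[k] bar M n →ₗ[k] bar M (n + 1) := cons (bar M n)

variable {M}

theorem smul_bcons (n : ℕ) (a x : R) (b : bar M n) : a • bcons M n x b = bcons M n (a * x) b := rfl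

theorem op_smul_bcons (n : ℕ) (c : Rᵐᵒᵖ) (x : R) (b : bar M n) :
    c • bcons M n x b = bcons M n x (c • b) := rfl

@[elab_as_elim]
theorem bar_induction {n : ℕ} {p : bar M (n + 1) → Prop} (t : bar M (n + 1))
    (cons : ∀ x b, p (bcons M n x b)) (add : ∀ s t, p s → p t → p (s + t)) : p t :=
  outer_induction (B := bar M n) t cons add

/-- The linear map on `R ⊗ B` given by a bilinear map. -/
noncomputable def barLift {n : ℕ} {Q : Type*} [AddCommGroup Q] [Module k Q]
    (f : R →ₗ[k] bar M n →ₗ[k] Q) : bar M (n + 1) →ₗ[k] Q := outerLift f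

theorem barLift_bcons {n : ℕ} {Q : Type*} [AddCommGroup Q] [Module k Q]
    (f : R →ₗ[k] bar M n →ₗ[k] Q) (x : R) (b : bar M n) : barLift f (bcons M n x b) = f x b :=
  outerLift_cons f x b

variable (M) in
/-- The action as a bilinear map. -/
noncomputable def actMap : R →ₗ[k] M →ₗ[k] M := (Algebra.lsmul k k M).toLinearMap

variable (M) in
/-- The differential of the bar resolution. -/
noncomputable def barD : ∀ n, bar M (n + 1) →ₗ[k] bar M n
  | 0 => barLift (actMap (bar M 0))
  | n + 1 => barLift (actMap (bar M (n + 1)) - (bcons M n).compl₂ (barD n))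

theorem barD_zero (x : R) (m : bar M 0) : barD M 0 (bcons M 0 x m) = x • m :=
  barLift_bcons _ x m

theorem barD_succ (n : ℕ) (x : R) (b : bar M (n + 1)) :
    barD M (n + 1) (bcons M (n + 1) x b) = x • b - bcons M n x (barD M n b) :=
  barLift_bcons _ x b

theorem barD_smul (n : ℕ) (a : R) (t : bar M (n + 1)) : barD M n (a • t) = a • barD M n t := by
  induction t using bar_induction with
  | cons x b =>
    cases n with
    | zero => rw [smul_bcons, barD_zero, barD_zero, mul_smul]
    | succ n => rw [smul_bcons, barD_succ, barD_succ, mul_smul, smul_sub, smul_bcons]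
  | add s t hs ht => rw [smul_add, map_add, map_add, smul_add, hs, ht]

theorem barD_op_smul (n : ℕ) (c : Rᵐᵒᵖ) (t : bar M (n + 1)) :
    barD M n (c • t) = c • barD M n t := by
  induction n with
  | zero =>
    induction t using bar_induction with
    | cons x b => rw [op_smul_bcons, barD_zero, barD_zero, smul_comm]
    | add s t hs ht => rw [smul_add, map_add, map_add, smul_add, hs, ht]
  | succ n ih =>
    induction t using bar_induction with
    | cons x b =>
      rw [op_smul_bcons, barD_succ, barD_succ, ih, smul_sub, op_smul_bcons, smul_comm]
    | add s t hs ht => rw [smul_add, map_add, map_add, smul_add, hs, ht]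

theorem barD_barD (n : ℕ) (t : bar M (n + 2)) : barD M n (barD M (n + 1) t) = 0 := by
  induction n with
  | zero =>
    induction t using bar_induction with
    | cons x b => rw [barD_succ, map_sub, barD_smul, barD_zero, sub_self]
    | add s t hs ht => rw [map_add, map_add, hs, ht, add_zero]
  | succ n ih =>
    induction t using bar_induction with
    | cons x b =>
      rw [barD_succ, map_sub, barD_smul, barD_succ, ih, map_zero, sub_zero, sub_self]
    | add s t hs ht => rw [map_add, map_add, hs, ht, add_zero]

/-- The map `t ↦ 1 ⊗ t` is a contracting homotopy; this is the source of exactness. -/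
theorem barD_one_cons (n : ℕ) (t : bar M (n + 1)) (ht : barD M n t = 0) :
    barD M (n + 1) (bcons M (n + 1) 1 t) = t := by
  rw [barD_succ, ht, map_zero, sub_zero, one_smul]

variable (M) in
/-- The differential as a map of bimodules. -/
noncomputable def barDEnv (n : ℕ) : bar M (n + 1) →ₗ[Enveloping k R] bar M n :=
  envLinear (barD M n).toAddMonoidHom
    (fun a t => (barD_smul n a t).trans (smul_eq_env _ _ _))
    (fun c t => (barD_op_smul n c t).trans (op_smul_eq_env _ _ _))

/-- Projectivity of `R` over `k` enters here: for the right action, the factors to the left of `M`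
are mere `k`-modules. -/
theorem projective_right_bar [Module.Projective Rᵐᵒᵖ M] [Module.Projective k R] (n : ℕ) :
    Module.Projective Rᵐᵒᵖ (bar M n) := by
  induction n with
  | zero => exact ‹Module.Projective Rᵐᵒᵖ M›
  | succ n ih => exact projective_right_outer

variable (M) in
/-- The bar resolution of a bimodule that is projective as a right module. -/
noncomputable def barRes [Module.Projective Rᵐᵒᵖ M] [Module.Projective k R] :
    ProjRes (ModuleCat.of (Enveloping k R) M) where
  X n := bar M (n + 1)
  d n := barDEnv M (n + 1)
  aug := barDEnv M 0
  projective n := have := projective_right_bar (M := M) n; projective_outer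
  aug_surjective m := ⟨bcons M 0 1 m, (barD_zero 1 m).trans (one_smul R m)⟩
  exact_zero t := ⟨fun h => ⟨_, barD_one_cons 0 t h⟩, by rintro ⟨t, rfl⟩; exact barD_barD 0 t⟩
  exact_succ n t := ⟨fun h => ⟨_, barD_one_cons (n + 1) t h⟩,
    by rintro ⟨t, rfl⟩; exact barD_barD (n + 1) t⟩

end Bimodule

/-! ### Operators on cochains of the bar complex. -/

namespace Bimodule

variable {k R : Type u} [CommRing k] [Ring R] [Algebra k R]

/-- Families of linear maps on the terms of the bar complex of `M`. -/
abbrev BarMaps (M : Bimodule k R) (Q : Type u) [AddCommGroup Q] [Module k Q] : Type u :=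
  ∀ n, bar M n →ₗ[k] Q

/-- An element of `M`, seen in the bar complex. -/
def barBase {M : Bimodule k R} (m : M) : bar M 0 := m

variable (k) in
/-- An element of the algebra, seen in its bar complex. -/
def barAlg (a : R) : bar (unit k R) 0 := a

theorem barAlg_surjective (b : bar (unit k R) 0) : ∃ a, barAlg k a = b := ⟨b, rfl⟩

theorem op_smul_barAlg (x y : R) : op x • barAlg k y = barAlg k (y * x) := rfl

theorem smul_barAlg (x y : R) : x • barAlg k y = barAlg k (x * y) := rfl

namespace BarMaps

variable {M : Bimodule k R} {Q : Type u} [AddCommGroup Q] [Module k Q]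

theorem ext {G H : BarMaps M Q} (h : ∀ n b, G n b = H n b) : G = H :=
  funext fun n => LinearMap.ext (h n)

/-- The family `b ↦ G (x ⊗ b)`. -/
noncomputable def slot (x : R) : BarMaps M Q →ₗ[k] BarMaps M Q where
  toFun G n := (G (n + 1)).comp (bcons M n x)
  map_add' _ _ := rfl
  map_smul' _ _ := rfl

/-- The family `b ↦ G (x b)`. -/
noncomputable def left (x : R) : BarMaps M Q →ₗ[k] BarMaps M Q where
  toFun G n := (G n).comp (Algebra.lsmul k k (bar M n) x)
  map_add' _ _ := rfl
  map_smul' _ _ := rfl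

/-- The family `b ↦ G (b x)`. -/
noncomputable def right (x : R) : BarMaps M Q →ₗ[k] BarMaps M Q where
  toFun G n := (G n).comp (Algebra.lsmul k k (bar M n) (op x))
  map_add' _ _ := rfl
  map_smul' _ _ := rfl

/-- The family `b ↦ G (∂ b)`. -/
noncomputable def diff : BarMaps M Q →ₗ[k] BarMaps M Q where
  toFun G
    | 0 => 0
    | n + 1 => (G n).comp (barD M n)
  map_add' G H := funext fun n => by cases n <;> simp [LinearMap.add_comp]
  map_smul' c G := funext fun n => by cases n <;> simp [LinearMap.smul_comp]

theorem slot_apply (x : R) (G : BarMaps M Q) (n : ℕ) (b : bar M n) :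
    slot x G n b = G (n + 1) (bcons M n x b) := rfl

theorem left_apply (x : R) (G : BarMaps M Q) (n : ℕ) (b : bar M n) :
    left x G n b = G n (x • b) := rfl

theorem right_apply (x : R) (G : BarMaps M Q) (n : ℕ) (b : bar M n) :
    right x G n b = G n (op x • b) := rfl

theorem diff_zero (G : BarMaps M Q) : diff G 0 = 0 := rfl

theorem diff_succ (G : BarMaps M Q) (n : ℕ) (b : bar M (n + 1)) :
    diff G (n + 1) b = G n (barD M n b) := rfl

theorem slot_add (x y : R) (G : BarMaps M Q) : slot (x + y) G = slot x G + slot y G :=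
  ext fun n b => by
    change G (n + 1) _ = G (n + 1) _ + G (n + 1) _
    rw [map_add, LinearMap.add_apply, map_add]

theorem slot_smul (c : k) (x : R) (G : BarMaps M Q) : slot (c • x) G = c • slot x G :=
  ext fun n b => by
    change G (n + 1) _ = c • G (n + 1) _
    rw [map_smul, LinearMap.smul_apply, map_smul]

theorem left_add (x y : R) (G : BarMaps M Q) : left (x + y) G = left x G + left y G :=
  ext fun n b => by
    change G n ((x + y) • b) = G n (x • b) + G n (y • b)
    rw [add_smul, map_add]

theorem left_smul (c : k) (x : R) (G : BarMaps M Q) : left (c • x) G = c • left x G :=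
  ext fun n b => by
    change G n ((c • x) • b) = c • G n (x • b)
    rw [smul_assoc, map_smul]

theorem right_add (x y : R) (G : BarMaps M Q) : right (x + y) G = right x G + right y G :=
  ext fun n b => by
    change G n (op (x + y) • b) = G n (op x • b) + G n (op y • b)
    rw [MulOpposite.op_add, add_smul, map_add]

theorem right_smul (c : k) (x : R) (G : BarMaps M Q) : right (c • x) G = c • right x G :=
  ext fun n b => by
    change G n (op (c • x) • b) = c • G n (op x • b)
    rw [MulOpposite.op_smul, smul_assoc, map_smul]

/-- Dual to `∂ (x ⊗ b) = x b - x ⊗ ∂ b`. In other words, `slot x` is a null-homotopy of left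
multiplication by `x`. -/
theorem slot_diff (x : R) (G : BarMaps M Q) : slot x (diff G) = left x G - diff (slot x G) :=
  ext fun n b => by
    cases n with
    | zero =>
      change G 0 (barD M 0 (bcons M 0 x b)) = G 0 (x • b) - 0
      rw [barD_zero, sub_zero]
    | succ n =>
      change G (n + 1) (barD M (n + 1) (bcons M (n + 1) x b)) =
        G (n + 1) (x • b) - G (n + 1) (bcons M n x (barD M n b))
      rw [barD_succ, map_sub]

theorem left_diff (x : R) (G : BarMaps M Q) : left x (diff G) = diff (left x G) :=
  ext fun n b => by
    cases n with
    | zero => rfl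
    | succ n => exact congrArg (G n) (barD_smul n x b)

theorem slot_left (x y : R) (G : BarMaps M Q) : slot y (left x G) = slot (x * y) G := rfl

theorem slot_right (x y : R) (G : BarMaps M Q) : slot x (right y G) = right y (slot x G) := rfl

theorem left_left (x y : R) (G : BarMaps M Q) : left x (left y G) = left (y * x) G :=
  ext fun n b => congrArg (G n) (mul_smul y x b).symm

theorem left_one (G : BarMaps M Q) : left 1 G = G :=
  ext fun n b => congrArg (G n) (one_smul R b)

theorem left_right (x y : R) (G : BarMaps M Q) : left x (right y G) = right y (left x G) :=
  ext fun n b => congrArg (G n) (smul_comm x (op y) b).symm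

/-- Postcomposition commutes with the differential. -/
theorem diff_comp {Q' : Type u} [AddCommGroup Q'] [Module k Q'] (f : Q →ₗ[k] Q') (G : BarMaps M Q) :
    diff (fun n => f.comp (G n)) = fun n => f.comp (diff G n) :=
  ext fun n b => by
    cases n with
    | zero => exact (map_zero f).symm
    | succ n => rfl

end BarMaps

section Append

variable (k R) in
/-- The map `b ↦ b ⊗ 1` on the bar complex of the algebra. -/
noncomputable def append : ∀ n, bar (unit k R) n →ₗ[k] bar (unit k R) (n + 1)
  | 0 => (bcons (unit k R) 0).flip (1 : R)
  | n + 1 => barLift ((bcons (unit k R) (n + 1)).compl₂ (append n))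

theorem append_zero (x : R) : append k R 0 (barAlg k x) = bcons _ 0 x (barAlg k 1) := rfl

theorem append_succ (n : ℕ) (x : R) (b : bar (unit k R) n) :
    append k R (n + 1) (bcons _ n x b) = bcons _ (n + 1) x (append k R n b) :=
  barLift_bcons _ x b

theorem append_smul (n : ℕ) (x : R) (b : bar (unit k R) n) :
    append k R n (x • b) = x • append k R n b := by
  cases n with
  | zero => rfl
  | succ n =>
    induction b using bar_induction with
    | cons y b => rw [smul_bcons, append_succ, append_succ, smul_bcons]
    | add s t hs ht => rw [smul_add, map_add, map_add, smul_add, hs, ht]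

theorem barD_append_zero (b : bar (unit k R) 0) : barD _ 0 (append k R 0 b) = b :=
  (barD_zero (M := unit k R) (toAlg b) (1 : R)).trans (mul_one (toAlg b))

/-- All faces of `b ⊗ 1` but the last leave the final `1` alone. The last one multiplies it into its
neighbour and returns `b`, with the sign of its position. -/
theorem barD_append_succ (n : ℕ) (b : bar (unit k R) (n + 1)) :
    barD _ (n + 1) (append k R (n + 1) b) =
      append k R n (barD _ n b) + (-1 : k) ^ (n + 1) • b := by
  induction n with
  | zero =>
    induction b using bar_induction with
    | cons x b =>
      rw [append_succ, barD_succ, barD_append_zero, barD_zero, append_smul, pow_succ, pow_zero,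
        one_mul, neg_smul, one_smul, sub_eq_add_neg]
    | add s t hs ht => simp only [map_add, smul_add, hs, ht]; abel
  | succ n ih =>
    induction b using bar_induction with
    | cons x b =>
      rw [append_succ, barD_succ, ih, barD_succ, map_sub, append_smul, map_add, append_succ,
        map_smul, pow_succ (-1 : k) (n + 1), mul_neg_one, neg_smul, sub_add_eq_sub_sub,
        sub_eq_add_neg]
    | add s t hs ht => simp only [map_add, smul_add, hs, ht]; abel

namespace BarMaps

variable {Q : Type u} [AddCommGroup Q] [Module k Q]

/-- The family `b ↦ (-1)ⁿ G (b x ⊗ 1)`. -/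
noncomputable def cap (x : R) : BarMaps (unit k R) Q →ₗ[k] BarMaps (unit k R) Q where
  toFun G n := (-1 : k) ^ n • (G (n + 1)).comp
    ((append k R n).comp (Algebra.lsmul k k (bar (unit k R) n) (op x)))
  map_add' G H := funext fun n => by
    rw [Pi.add_apply, LinearMap.add_comp, smul_add]
    rfl
  map_smul' c G := funext fun n => by
    rw [Pi.smul_apply, LinearMap.smul_comp, smul_comm]
    rfl

theorem cap_apply (x : R) (G : BarMaps (unit k R) Q) (n : ℕ) (b : bar (unit k R) n) :
    cap x G n b = (-1 : k) ^ n • G (n + 1) (append k R n (op x • b)) := rfl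

theorem cap_add (x y : R) (G : BarMaps (unit k R) Q) : cap (x + y) G = cap x G + cap y G :=
  ext fun n b => by
    rw [Pi.add_apply, LinearMap.add_apply, cap_apply, cap_apply, cap_apply, MulOpposite.op_add, add_smul,
      map_add,
      map_add, smul_add]

theorem cap_smul (c : k) (x : R) (G : BarMaps (unit k R) Q) : cap (c • x) G = c • cap x G :=
  ext fun n b => by
    rw [Pi.smul_apply, LinearMap.smul_apply, cap_apply, cap_apply, MulOpposite.op_smul, smul_assoc,
      map_smul,
      map_smul, smul_comm]

/-- The counterpart of `slot_diff` at the other end: `cap x` is a null-homotopy of right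
multiplication by `x`. The sign in `cap` is chosen to cancel that of the last face. -/
theorem cap_diff (x : R) (G : BarMaps (unit k R) Q) :
    cap x (diff G) = right x G - diff (cap x G) :=
  ext fun n b => by
    cases n with
    | zero =>
      rw [cap_apply, diff_succ, barD_append_zero, pow_zero, one_smul]
      exact (sub_zero (G 0 (op x • b))).symm
    | succ n =>
      change (-1 : k) ^ (n + 1) • G (n + 1) (barD _ (n + 1) (append k R (n + 1) (op x • b))) =
        G (n + 1) (op x • b) - (-1 : k) ^ n • G (n + 1) (append k R n (op x • barD _ n b))
      rw [barD_append_succ, barD_op_smul, map_add, map_smul (G (n + 1))]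
      rcases neg_one_pow_eq_or k n with h | h <;> rw [pow_succ, h] <;> module

theorem right_cap (x y : R) (G : BarMaps (unit k R) Q) : right x (cap y G) = cap (x * y) G :=
  ext fun n b => by
    rw [right_apply, cap_apply, cap_apply, op_mul, mul_smul]

theorem left_cap (x y : R) (G : BarMaps (unit k R) Q) : left x (cap y G) = cap y (left x G) :=
  ext fun n b => by
    rw [left_apply, cap_apply, cap_apply, left_apply, ← smul_comm x (op y) b, append_smul]

/-- The two operators act at opposite ends of the tensor. They anticommute only because the sign of
`cap` depends on the degree, which `slot` changes by one. -/
theorem slot_cap (x y : R) (G : BarMaps (unit k R) Q) : slot x (cap y G) = -cap y (slot x G) :=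
  ext fun n b => by
    change _ = -(cap y (slot x G) n b)
    rw [slot_apply, cap_apply, cap_apply, slot_apply, op_smul_bcons, append_succ, pow_succ,
      mul_neg_one,
      neg_smul]

end BarMaps

end Append

end Bimodule

/-! ### Functoriality of the bar complex, and the passage from the bar complex of `A` to that of
`Y`. -/

section

namespace Bimodule

variable {k R : Type u} [CommRing k] [Ring R] [Algebra k R] {M N : Bimodule k R}

theorem algebraMap_smul_eq (M : Bimodule k R) (c : k) (m : M) : algebraMap k R c • m = c • m :=
  algebraMap_smul R c m

/-- A map of bimodules is linear over the base ring. -/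
noncomputable def baseLinear (f : M →ₗ[Enveloping k R] N) : M →ₗ[k] N where
  toFun := f
  map_add' := map_add f
  map_smul' c m := by
    rw [RingHom.id_apply, ← algebraMap_smul_eq, ← algebraMap_smul_eq, smul_eq_env, map_smul,
      ← smul_eq_env]

theorem baseLinear_smul (f : M →ₗ[Enveloping k R] N) (a : R) (m : M) :
    baseLinear f (a • m) = a • baseLinear f m := by
  rw [smul_eq_env, smul_eq_env]
  exact map_smul f _ m

theorem baseLinear_op_smul (f : M →ₗ[Enveloping k R] N) (a : Rᵐᵒᵖ) (m : M) :
    baseLinear f (a • m) = a • baseLinear f m := by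
  rw [op_smul_eq_env, op_smul_eq_env]
  exact map_smul f _ m

/-- The map induced on the bar complex. -/
noncomputable def barMap (f : M →ₗ[Enveloping k R] N) : ∀ n, bar M n →ₗ[k] bar N n
  | 0 => baseLinear f
  | n + 1 => barLift ((bcons N n).compl₂ (barMap f n))

theorem barMap_succ (f : M →ₗ[Enveloping k R] N) (n : ℕ) (x : R) (b : bar M n) :
    barMap f (n + 1) (bcons M n x b) = bcons N n x (barMap f n b) := barLift_bcons _ x b

theorem barMap_smul (f : M →ₗ[Enveloping k R] N) (n : ℕ) (x : R) (b : bar M n) :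
    barMap f n (x • b) = x • barMap f n b := by
  cases n with
  | zero => exact baseLinear_smul f x b
  | succ n =>
    induction b using bar_induction with
    | cons y b => rw [smul_bcons, barMap_succ, barMap_succ, smul_bcons]
    | add s t hs ht => rw [smul_add, map_add, map_add, smul_add, hs, ht]

theorem barMap_op_smul (f : M →ₗ[Enveloping k R] N) (n : ℕ) (x : Rᵐᵒᵖ) (b : bar M n) :
    barMap f n (x • b) = x • barMap f n b := by
  induction n with
  | zero => exact baseLinear_op_smul f x b
  | succ n ih =>
    induction b using bar_induction with
    | cons y b => rw [op_smul_bcons, barMap_succ, barMap_succ, ih, op_smul_bcons]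
    | add s t hs ht => rw [smul_add, map_add, map_add, smul_add, hs, ht]

theorem barD_barMap (f : M →ₗ[Enveloping k R] N) (n : ℕ) (b : bar M (n + 1)) :
    barD N n (barMap f (n + 1) b) = barMap f n (barD M n b) := by
  induction n with
  | zero =>
    induction b using bar_induction with
    | cons y b => rw [barMap_succ, barD_zero, barD_zero, barMap_smul]
    | add s t hs ht => simp only [map_add, hs, ht]
  | succ n ih =>
    induction b using bar_induction with
    | cons y b => rw [barMap_succ, barD_succ, barD_succ, map_sub, barMap_smul, ih, barMap_succ]
    | add s t hs ht => simp only [map_add, hs, ht]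

end Bimodule

namespace Frame

open Bimodule

variable {k A C : Type u} [CommRing k] [Ring A] [Algebra k A] [Ring C] [Algebra k C]
  (F : Frame k A C)

/-- The map `A → Y`, `a ↦ a T⁰`. -/
noncomputable def unitY : unit k A →ₗ[k] F.Y where
  toFun a := F.mono 0 (F.incl (toAlg a))
  map_add' a b := by
    rw [← mono_add, ← map_add]
    rfl
  map_smul' c a := by
    rw [RingHom.id_apply, ← algebraMap_smul_eq F.Y, smul_mono]
    have h : toAlg (c • a) = algebraMap k A c * toAlg a := Algebra.smul_def c (toAlg a)
    rw [h, map_mul, AlgHom.commutes]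

/-- The map from the bar complex of `A` to that of `Y`. -/
noncomputable def barIncl : ∀ n, bar (unit k A) n →ₗ[k] bar F.Y n
  | 0 => F.unitY
  | n + 1 => barLift (((bcons F.Y n).comp F.incl.toLinearMap).compl₂ (barIncl n))

variable {F}

theorem barIncl_succ (n : ℕ) (x : A) (b : bar (unit k A) n) :
    F.barIncl (n + 1) (bcons _ n x b) = bcons _ n (F.incl x) (F.barIncl n b) := barLift_bcons _ x b

theorem barIncl_smul (n : ℕ) (x : A) (b : bar (unit k A) n) :
    F.barIncl n (x • b) = F.incl x • F.barIncl n b := by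
  cases n with
  | zero =>
    refine (congrArg (F.mono 0) (map_mul F.incl x (toAlg b))).trans ?_
    exact (smul_mono _ _ _).symm
  | succ n =>
    induction b using bar_induction with
    | cons y b => rw [smul_bcons, barIncl_succ, barIncl_succ, smul_bcons, map_mul]
    | add s t hs ht => rw [smul_add, map_add, map_add, smul_add, hs, ht]

theorem barIncl_op_smul (n : ℕ) (x : A) (b : bar (unit k A) n) :
    F.barIncl n (op x • b) = op (F.incl x) • F.barIncl n b := by
  induction n with
  | zero =>
    refine (congrArg (F.mono 0) (map_mul F.incl (toAlg b) x)).trans ?_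
    exact (op_smul_mono (isHom_incl x) 0 (F.incl (toAlg b))).symm
  | succ n ih =>
    induction b using bar_induction with
    | cons y b => rw [op_smul_bcons, barIncl_succ, barIncl_succ, ih, op_smul_bcons]
    | add s t hs ht => rw [smul_add, map_add, map_add, smul_add, hs, ht]

theorem barD_barIncl (n : ℕ) (b : bar (unit k A) (n + 1)) :
    barD _ n (F.barIncl (n + 1) b) = F.barIncl n (barD _ n b) := by
  induction n with
  | zero =>
    induction b using bar_induction with
    | cons y b => rw [barIncl_succ, barD_zero, barD_zero, barIncl_smul]
    | add s t hs ht => simp only [map_add, hs, ht]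
  | succ n ih =>
    induction b using bar_induction with
    | cons y b => rw [barIncl_succ, barD_succ, barD_succ, map_sub, barIncl_smul, ih, barIncl_succ]
    | add s t hs ht => simp only [map_add, hs, ht]

variable (F) in
/-- The map `b ↦ u T b` from the bar complex of `A` to that of `Y`. -/
noncomputable def twist (u : C) (n : ℕ) : bar (unit k A) n →ₗ[k] bar F.Y n :=
  (Algebra.lsmul k k (bar F.Y n) u).comp ((barMap (F.shift 1) n).comp (F.barIncl n))

theorem twist_apply (u : C) (n : ℕ) (b : bar (unit k A) n) :
    F.twist u n b = u • barMap (F.shift 1) n (F.barIncl n b) := rfl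

theorem barD_twist (u : C) (n : ℕ) (b : bar (unit k A) (n + 1)) :
    barD _ n (F.twist u (n + 1) b) = F.twist u n (barD _ n b) := by
  rw [twist_apply, twist_apply, barD_smul, barD_barMap, barD_barIncl]

theorem twist_op_smul (u : C) (n : ℕ) (a : A) (b : bar (unit k A) n) :
    F.twist u n (op a • b) = op (F.incl a) • F.twist u n b := by
  rw [twist_apply, twist_apply, barIncl_op_smul, barMap_op_smul, smul_comm]

/-- This is the relation `u T = T⁰ u` in `Y`, by which `T` is traded for moving `u` to the far
right. -/
theorem twist_zero {u : C} (hu : F.IsHom 1 u) (a : A) :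
    F.twist u 0 (barAlg k a) = barBase (op (u * F.incl a) • F.mono 0 1) := by
  have h := (hu.mul (isHom_incl a)).cast (add_zero 1)
  rw [op_smul_mono h, one_mul]
  change u • F.shift 1 (F.mono 0 (F.incl a)) = F.mono (0 + 1) (u * F.incl a)
  rw [shift_mono, smul_mono]

variable {Q : Type u} [AddCommGroup Q] [Module k Q]

variable (F) in
/-- Restriction along `b ↦ u T b`. -/
noncomputable def pull (u : C) : BarMaps F.Y Q →ₗ[k] BarMaps (unit k A) Q where
  toFun G n := (G n).comp (F.twist u n)
  map_add' _ _ := rfl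
  map_smul' _ _ := rfl

theorem pull_apply (u : C) (G : BarMaps F.Y Q) (n : ℕ) (b : bar (unit k A) n) :
    F.pull u G n b = G n (F.twist u n b) := rfl

open BarMaps

theorem pull_diff (u : C) (G : BarMaps F.Y Q) : F.pull u (diff G) = diff (F.pull u G) :=
  BarMaps.ext fun n b => by
    cases n with
    | zero => rfl
    | succ n => exact congrArg (G n) (barD_twist u n b)

theorem pull_right (u : C) (a : A) (G : BarMaps F.Y Q) :
    F.pull u (right (F.incl a) G) = right a (F.pull u G) :=
  BarMaps.ext fun n b => congrArg (G n) (twist_op_smul u n a b).symm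

theorem pull_add (u v : C) (G : BarMaps F.Y Q) : F.pull (u + v) G = F.pull u G + F.pull v G :=
  BarMaps.ext fun n b => by
    change G n (F.twist (u + v) n b) = G n (F.twist u n b) + G n (F.twist v n b)
    rw [twist_apply, add_smul, map_add]
    rfl

theorem pull_mul_incl (u : C) (a : A) (G : BarMaps F.Y Q) :
    F.pull (u * F.incl a) G = left a (F.pull u G) :=
  BarMaps.ext fun n b => by
    rw [left_apply, pull_apply, pull_apply, twist_apply, twist_apply, barIncl_smul, barMap_smul,
      mul_smul]

theorem pull_incl_mul (u : C) (a : A) (G : BarMaps F.Y Q) :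
    F.pull (F.incl a * u) G = F.pull u (left (F.incl a) G) :=
  BarMaps.ext fun n b => by
    rw [pull_apply, pull_apply, left_apply, twist_apply, twist_apply, mul_smul]

variable (F Q) in
/-- The family of operators sending `x₁ ⊗ ⋯ ⊗ xₘ ⊗ y` to `G ↦ (b ↦ G (x₁ ⊗ ⋯ ⊗ xₘ ⊗ y b))`. -/
noncomputable def ins : BarMaps (unit k A) (Module.End k (BarMaps F.Y Q))
  | 0 => 
    { toFun := fun y => left (F.incl (toAlg y))
      map_add' := fun x y => LinearMap.ext fun G =>
        (congrArg (fun z => left z G) (map_add F.incl (toAlg x) (toAlg y))).trans (left_add _ _ G)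
      map_smul' := fun c x => LinearMap.ext fun G =>
        (congrArg (fun z => left z G) (map_smul F.incl c (toAlg x))).trans (left_smul _ _ G) }
  | m + 1 => barLift (LinearMap.mk₂ k (fun x b => (ins m b).comp (slot (F.incl x)))
      (fun x y b => LinearMap.ext fun G => by simp [slot_add])
      (fun c x b => LinearMap.ext fun G => by simp [slot_smul])
      (fun x b b' => LinearMap.ext fun G => by simp)
      (fun c x b => LinearMap.ext fun G => by simp))

theorem ins_zero (y : A) (G : BarMaps F.Y Q) : F.ins Q 0 (barAlg k y) G = left (F.incl y) G := rfl

theorem ins_succ (m : ℕ) (x : A) (b : bar (unit k A) m) (G : BarMaps F.Y Q) :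
    F.ins Q (m + 1) (bcons _ m x b) G = F.ins Q m b (slot (F.incl x) G) :=
  congrArg (fun f : Module.End k (BarMaps F.Y Q) => f G) (barLift_bcons _ x b)

end Frame

end

/-! ### The sliding homotopy between `u T b` and `b u`. -/

section

namespace Frame

open Bimodule BarMaps

variable {k A C : Type u} [CommRing k] [Ring A] [Algebra k A] [Ring C] [Algebra k C]
  {F : Frame k A C} {Q : Type u} [AddCommGroup Q] [Module k Q]

theorem ins_left (m : ℕ) (b : bar (unit k A) m) (x : A) (G : BarMaps F.Y Q) :
    F.ins Q m b (left (F.incl x) G) = F.ins Q m (x • b) G := by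
  cases m with
  | zero =>
    refine (left_left _ _ G).trans ?_
    exact congrArg (fun z => left z G) (map_mul F.incl x (toAlg b)).symm
  | succ m =>
    induction b using bar_induction with
    | cons y b => rw [smul_bcons, ins_succ, ins_succ, slot_left, map_mul]
    | add s t hs ht =>
      rw [smul_add, map_add, map_add, LinearMap.add_apply, LinearMap.add_apply, hs, ht]

theorem left_ins (m : ℕ) (b : bar (unit k A) m) (a : A) (G : BarMaps F.Y Q) :
    left (F.incl a) (F.ins Q m b G) = F.ins Q m (op a • b) G := by
  induction m generalizing G with
  | zero =>
    refine (left_left _ _ G).trans ?_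
    exact congrArg (fun z => left z G) (map_mul F.incl (toAlg b) a).symm
  | succ m ih =>
    induction b using bar_induction with
    | cons y b => rw [op_smul_bcons, ins_succ, ins_succ, ih]
    | add s t hs ht =>
      rw [smul_add, map_add, map_add, LinearMap.add_apply, LinearMap.add_apply, map_add, hs, ht]

theorem ins_right (m : ℕ) (b : bar (unit k A) m) (c : C) (G : BarMaps F.Y Q) :
    F.ins Q m b (right c G) = right c (F.ins Q m b G) := by
  induction m generalizing G with
  | zero => exact left_right _ _ G
  | succ m ih =>
    induction b using bar_induction with
    | cons y b => rw [ins_succ, ins_succ, slot_right, ih]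
    | add s t hs ht =>
      rw [map_add, LinearMap.add_apply, LinearMap.add_apply, map_add, hs, ht]

theorem diff_ins_succ (m : ℕ) (x : A) (b : bar (unit k A) m) (G : BarMaps F.Y Q) :
    diff (F.ins Q) (m + 1) (bcons _ m x b) G =
      F.ins Q m (x • b) G - diff (F.ins Q) m b (slot (F.incl x) G) := by
  rw [← slot_apply, slot_diff]
  have h : slot x (F.ins Q) = fun m => (LinearMap.lcomp k _ (slot (F.incl x))).comp (F.ins Q m) :=
    BarMaps.ext fun m b => LinearMap.ext fun G => ins_succ m x b G
  rw [h, diff_comp]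
  rfl

/-- Leibniz rule: a face of `x₁ ⊗ ⋯ ⊗ xₘ ⊗ y b'` belongs either to `x₁ ⊗ ⋯ ⊗ xₘ ⊗ y` or to `b'`, the
latter after passing `m` factors. -/
theorem ins_diff (m : ℕ) (b : bar (unit k A) m) (G : BarMaps F.Y Q) :
    F.ins Q m b (diff G) = diff (F.ins Q) m b G + (-1 : k) ^ m • diff (F.ins Q m b G) := by
  induction m generalizing G with
  | zero =>
    refine (left_diff _ G).trans ?_
    rw [diff_zero, pow_zero, one_smul]
    exact (zero_add _).symm
  | succ m ih =>
    induction b using bar_induction with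
    | cons x b =>
      rw [ins_succ, slot_diff, map_sub, ih, ins_left, diff_ins_succ, ins_succ, pow_succ]
      module
    | add s t hs ht =>
      simp only [map_add, LinearMap.add_apply, hs, ht, smul_add]
      abel

theorem ins_apply_one (m : ℕ) (b : bar (unit k A) m) (c : C) (G : BarMaps F.Y Q) :
    F.ins Q m b G 0 (barBase (op c • F.mono 0 1)) = G m (op c • F.barIncl m b) := by
  induction m generalizing G with
  | zero =>
    refine congrArg (G 0) ?_
    change F.incl (toAlg b) • op c • F.mono 0 1 = op c • F.mono 0 (F.incl (toAlg b))
    rw [smul_comm, smul_mono, mul_one]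
  | succ m ih =>
    induction b using bar_induction with
    | cons x b => rw [ins_succ, ih, barIncl_succ, op_smul_bcons, slot_apply]
    | add s t hs ht =>
      rw [map_add, LinearMap.add_apply, Pi.add_apply, LinearMap.add_apply, hs, ht, map_add,
        smul_add,
        map_add]

variable (F Q) in
/-- The homotopy that moves `u T` through the bar complex of `A`. -/
noncomputable def slide (u : C) : BarMaps (unit k A) (BarMaps F.Y Q →ₗ[k] BarMaps (unit k A) Q)
  | 0 => (LinearMap.lcomp k _ (slot 1)).comp ((F.pull u).compRight k |>.comp (F.ins Q 0))
  | m + 1 => barLift (LinearMap.mk₂ k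
      -- Unfolding the recursion gives a signed sum over `i`: the entries `x₁, …, xᵢ` have been
      -- moved to the far right by `cap`, and the remaining ones stand between a leading `1` and `u
      -- T`.
      (fun x b => (F.pull u).comp ((F.ins Q (m + 1) (bcons _ m x b)).comp (slot 1)) +
        (-1 : k) ^ m • (cap x).comp (slide u m b))
      (fun x y b => LinearMap.ext fun G => by
        simp only [map_add, LinearMap.add_apply, LinearMap.add_comp, LinearMap.comp_apply,
          LinearMap.smul_apply, cap_add, smul_add]
        abel)
      (fun c x b => LinearMap.ext fun G => by
        simp only [map_smul, LinearMap.add_apply, LinearMap.comp_apply,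
          LinearMap.smul_apply, cap_smul, smul_add, smul_comm c ((-1 : k) ^ m)])
      (fun x b b' => LinearMap.ext fun G => by
        simp only [map_add, LinearMap.add_apply, LinearMap.add_comp, LinearMap.comp_apply,
          LinearMap.smul_apply, smul_add]
        abel)
      (fun c x b => LinearMap.ext fun G => by
        simp only [map_smul, LinearMap.add_apply, LinearMap.comp_apply,
          LinearMap.smul_apply, smul_add, smul_comm c ((-1 : k) ^ m)]))

theorem slide_zero (u : C) (y : bar (unit k A) 0) (G : BarMaps F.Y Q) :
    F.slide Q u 0 y G = F.pull u (F.ins Q 0 y (slot 1 G)) := rfl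

theorem slide_succ (u : C) (m : ℕ) (x : A) (b : bar (unit k A) m) (G : BarMaps F.Y Q) :
    F.slide Q u (m + 1) (bcons _ m x b) G = F.pull u (F.ins Q (m + 1) (bcons _ m x b) (slot 1 G)) +
      (-1 : k) ^ m • cap x (F.slide Q u m b G) :=
  congrArg (fun f : BarMaps F.Y Q →ₗ[k] BarMaps (unit k A) Q => f G) (barLift_bcons _ x b)

variable (k A Q) in
/-- The operators `G ↦ (b' ↦ ± G (b' b ⊗ 1 ⊗ ⋯ ⊗ 1))` obtained by iterating `cap`. -/
noncomputable def caps : BarMaps (unit k A) (Module.End k (BarMaps (unit k A) Q))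
  | 0 =>
    { toFun := fun y => right (toAlg y)
      map_add' := fun x y => LinearMap.ext fun G => right_add (toAlg x) (toAlg y) G
      map_smul' := fun c x => LinearMap.ext fun G => right_smul c (toAlg x) G }
  | m + 1 => barLift (LinearMap.mk₂ k (fun x b => (-1 : k) ^ m • (cap x).comp (caps m b))
      (fun x y b => LinearMap.ext fun G => by simp [cap_add])
      (fun c x b => LinearMap.ext fun G => by simp [cap_smul, smul_comm c ((-1 : k) ^ m)])
      (fun x b b' => LinearMap.ext fun G => by simp)
      (fun c x b => LinearMap.ext fun G => by simp [smul_comm c ((-1 : k) ^ m)]))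

theorem caps_zero (y : A) (G : BarMaps (unit k A) Q) :
    caps k A Q 0 (barAlg k y) G = right y G := rfl

theorem caps_succ (m : ℕ) (x : A) (b : bar (unit k A) m) (G : BarMaps (unit k A) Q) :
    caps k A Q (m + 1) (bcons _ m x b) G = (-1 : k) ^ m • cap x (caps k A Q m b G) :=
  congrArg (fun f : Module.End k (BarMaps (unit k A) Q) => f G) (barLift_bcons _ x b)

theorem slot_caps (m : ℕ) (x : A) (b : bar (unit k A) m) (G : BarMaps (unit k A) Q) :
    slot x (caps k A Q m b G) = (-1 : k) ^ m • caps k A Q m b (slot x G) := by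
  induction m with
  | zero =>
    rw [pow_zero, one_smul]
    rfl
  | succ m ih =>
    induction b using bar_induction with
    | cons y b => 
      rw [caps_succ, caps_succ, map_smul, slot_cap, ih, map_smul, pow_succ]
      module
    | add s t hs ht => simp only [map_add, LinearMap.add_apply, hs, ht, smul_add]

/-- Evaluation of the iterated operator at `1`. -/
theorem caps_apply_one (m : ℕ) (b : bar (unit k A) m) (G : BarMaps (unit k A) Q) :
    caps k A Q m b G 0 (barAlg k 1) = G m b := by
  induction m generalizing G with
  | zero => exact congrArg (G 0) (one_mul (toAlg b))
  | succ m ih =>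
    induction b using bar_induction with
    | cons y b =>
      rw [caps_succ]
      have h : cap y (caps k A Q m b G) 0 (barAlg k 1) =
          slot y (caps k A Q m b G) 0 (barAlg k 1) := by
        rw [cap_apply, pow_zero, one_smul, slot_apply]
        refine congrArg (caps k A Q m b G 1) ?_
        exact congrArg (fun z : A => bcons (unit k A) 0 z (1 : A)) (one_mul y)
      change (-1 : k) ^ m • cap y (caps k A Q m b G) 0 (barAlg k 1) = _
      rw [h, slot_caps]
      change (-1 : k) ^ m • (-1 : k) ^ m • caps k A Q m b (slot y G) 0 (barAlg k 1) = _
      rw [ih, slot_apply, smul_smul, ← mul_pow, neg_mul_neg, one_mul, one_pow, one_smul]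
    | add s t hs ht =>
      rw [map_add, LinearMap.add_apply, Pi.add_apply, LinearMap.add_apply, hs, ht, map_add]

/-- On the short argument `x ⊗ 1`, moving all of `b` to the right rebuilds `x ⊗ b`. This recovers
the values of `G` from the homotopy formula. -/
theorem caps_apply_append (m : ℕ) (b : bar (unit k A) m) (x : A) (G : BarMaps (unit k A) Q) :
    caps k A Q m b G 1 (append k A 0 (barAlg k x)) = (-1 : k) ^ m • G (m + 1) (bcons _ m x b) := by
  change slot x (caps k A Q m b G) 0 (barAlg k 1) = _
  rw [slot_caps]
  change (-1 : k) ^ m • caps k A Q m b (slot x G) 0 (barAlg k 1) = _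
  rw [caps_apply_one, slot_apply]

/-- The defining recursion of `slide`, applied to `x ⊗ ∂ b`. The `cap` term changes sign since `∂ b`
has one entry fewer than `b`. -/
theorem diff_slot_slide (u : C) (m : ℕ) (x : A) (b : bar (unit k A) m) (G : BarMaps F.Y Q) :
    diff (slot x (F.slide Q u)) m b G =
      F.pull u (diff (F.ins Q) m b (slot (F.incl x) (slot 1 G))) -
        (-1 : k) ^ m • cap x (diff (F.slide Q u) m b G) := by
  cases m with
  | zero =>
    rw [diff_zero, diff_zero, diff_zero]
    simp
  | succ m =>
    rw [diff_succ, diff_succ, diff_succ, slot_apply, slide_succ, ins_succ, pow_succ]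
    module

/-- The trace condition enters here: `slot x G = slot 1 (left x G) = slot 1 (right x G)`, so that an
`x` in the leading slot turns into right multiplication by `x`. -/
theorem slide_left {u : C} {G : BarMaps F.Y Q} (hG : ∀ a, left (F.incl a) G = right (F.incl a) G)
    (m : ℕ) (x : A) (b : bar (unit k A) m) :
    F.slide Q u m (x • b) G = F.pull u (F.ins Q m (x • b) (slot 1 G)) +
      right x (F.slide Q u m b G) - F.pull u (F.ins Q m b (slot (F.incl x) G)) := by
  have h : ∀ b, right x (F.pull u (F.ins Q m b (slot 1 G))) =
      F.pull u (F.ins Q m b (slot (F.incl x) G)) := fun b => by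
    rw [← pull_right, ← ins_right, ← slot_right, ← hG, slot_left, mul_one]
  cases m with
  | zero => rw [slide_zero, slide_zero, h, add_sub_cancel_right]
  | succ m =>
    induction b using bar_induction with
    | cons y b =>
      rw [smul_bcons, slide_succ, slide_succ, map_add, h, map_smul, right_cap]
      abel
    | add s t hs ht =>
      simp only [smul_add, map_add, LinearMap.add_apply, hs, ht]
      abel

/-- For a cocycle `G` the left side vanishes, and `caps b (pull u G)` becomes a coboundary in the
index `b` plus one in the argument. The induction combines the three homotopy formulas for `slot`,
`ins` and `cap`. -/
theorem slide_diff {u : C} {G : BarMaps F.Y Q} (hG : ∀ a, left (F.incl a) G = right (F.incl a) G)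
    (m : ℕ) (b : bar (unit k A) m) :
    F.slide Q u m b (diff G) = caps k A Q m b (F.pull u G) - diff (F.slide Q u) m b G -
      (-1 : k) ^ m • diff (F.slide Q u m b G) := by
  induction m with
  | zero =>
    obtain ⟨y, rfl⟩ := barAlg_surjective b
    rw [slide_zero, slide_zero, slot_diff, left_one, map_sub, map_sub, ins_zero, ins_zero, hG,
      pull_right, left_diff, pull_diff, caps_zero, diff_zero, pow_zero, one_smul,
      LinearMap.zero_apply, LinearMap.zero_apply, sub_zero, ins_zero]
  | succ m ih =>
    induction b using bar_induction with
    | cons x b =>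
      have h1 : diff (F.slide Q u) (m + 1) (bcons _ m x b) G =
          F.slide Q u m (x • b) G - diff (slot x (F.slide Q u)) m b G := by
        rw [← slot_apply, slot_diff]
        rfl
      rw [slide_succ, slide_succ, slot_diff, left_one, map_sub, ins_diff, ih, h1, diff_slot_slide,
        slide_left hG, caps_succ, diff_ins_succ, ins_succ, ins_succ]
      simp only [map_add, map_sub, map_smul, cap_diff, pull_diff, smul_sub, smul_add]
      rcases neg_one_pow_eq_or k m with h | h <;> rw [pow_succ, h] <;> module
    | add s t hs ht =>
      simp only [map_add, LinearMap.add_apply, hs, ht, smul_add]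
      abel

variable (F) in
/-- The family `x ⊗ b ↦ (slide b G) (x ⊗ 1)`. -/
noncomputable def slideMap (u : C) (G : BarMaps F.Y Q) : BarMaps (unit k A) Q
  | 0 => 0
  | m + 1 => barLift (LinearMap.mk₂ k (fun x b => F.slide Q u m b G 1 (append k A 0 (barAlg k x)))
      (fun x y b => by
        rw [append_zero, append_zero, append_zero, map_add, LinearMap.add_apply, map_add])
      (fun c x b => by
        rw [append_zero, append_zero, map_smul, LinearMap.smul_apply, map_smul])
      (fun x b b' => by rw [map_add, LinearMap.add_apply]; rfl)
      (fun c x b => by rw [map_smul, LinearMap.smul_apply]; rfl))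

theorem slideMap_succ (u : C) (G : BarMaps F.Y Q) (m : ℕ) (x : A) (b : bar (unit k A) m) :
    F.slideMap u G (m + 1) (bcons _ m x b) = F.slide Q u m b G 1 (append k A 0 (barAlg k x)) :=
  barLift_bcons _ x b

/-- In degree zero `u T x = T⁰ u x`, and the trace condition carries `x` round to the leading slot.
This is how the value on `b u` arises. -/
theorem pull_ins_apply {u : C} (hu : F.IsHom 1 u) {G : BarMaps F.Y Q}
    (hG : ∀ a, left (F.incl a) G = right (F.incl a) G) (m : ℕ) (x : A) (b : bar (unit k A) m) :
    F.pull u (F.ins Q m b (slot 1 G)) 0 (barAlg k x) =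
      G (m + 1) (op u • F.barIncl (m + 1) (bcons _ m x b)) := by
  rw [pull_apply, twist_zero hu, ins_apply_one, barIncl_succ, op_mul, mul_smul, ← right_apply,
    ← slot_right, ← hG, slot_left, mul_one, slot_apply, op_smul_bcons]

/-- The recursive term of `slide` applies `cap y` in degree zero, that is, evaluates at `x y ⊗ 1`,
and this is by definition a value of `slideMap`. -/
theorem slide_apply_zero (u : C) (G : BarMaps F.Y Q) (m : ℕ) (b : bar (unit k A) (m + 1)) (x : A) :
    F.slide Q u (m + 1) b G 0 (barAlg k x) =
      F.pull u (F.ins Q (m + 1) b (slot 1 G)) 0 (barAlg k x) +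
        (-1 : k) ^ m • F.slideMap u G (m + 1) (x • b) := by
  induction b using bar_induction with
  | cons y b =>
    rw [slide_succ, smul_bcons, slideMap_succ, ← op_smul_barAlg]
    change F.pull u _ 0 (barAlg k x) +
      (-1 : k) ^ m • cap y (F.slide Q u m b G) 0 (barAlg k x) = _
    rw [cap_apply, pow_zero, one_smul]
  | add s t hs ht =>
    rw [smul_add]
    simp only [map_add, LinearMap.add_apply, Pi.add_apply, hs, ht, smul_add]
    abel

/-- A trace that is a cocycle takes the same values on `u T b` and `b u` up to a coboundary. -/
theorem diff_slideMap {u : C} (hu : F.IsHom 1 u) {G : BarMaps F.Y Q}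
    (hG : ∀ a, left (F.incl a) G = right (F.incl a) G) (hd : diff G = 0) (m : ℕ)
    (b : bar (unit k A) (m + 1)) :
    F.slideMap u G m (barD _ m b) =
      (-1 : k) ^ m • (G (m + 1) (op u • F.barIncl (m + 1) b) -
        G (m + 1) (F.twist u (m + 1) b)) := by
  induction b using bar_induction with
  | cons x b =>
    -- Evaluating the homotopy formula at `x ⊗ 1`, the `caps` term gives the value on `u T (x ⊗ b)`.
    -- Since `∂ (x ⊗ 1) = x`, the last term gives the value on `(x ⊗ b) u`, and for `m > 0` a
    -- `slideMap` term besides.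
    have h := slide_diff (u := u) hG m b
    rw [hd, map_zero] at h
    have h' := congrArg (fun H : BarMaps (unit k A) Q => H 1 (append k A 0 (barAlg k x))) h
    have h0 : (0 : Q) = caps k A Q m b (F.pull u G) 1 (append k A 0 (barAlg k x)) -
        diff (F.slide Q u) m b G 1 (append k A 0 (barAlg k x)) -
        (-1 : k) ^ m • F.slide Q u m b G 0 (barD _ 0 (append k A 0 (barAlg k x))) := h'
    rw [caps_apply_append, barD_append_zero, pull_apply] at h0
    rw [← pull_ins_apply hu hG]
    cases m with
    | zero =>
      rw [diff_zero, LinearMap.zero_apply, slide_zero] at h0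
      change (0 : Q) = _
      rw [pow_zero, one_smul, one_smul] at h0
      rw [pow_zero, one_smul]
      have h2 : (0 : Q) = G 1 (F.twist u 1 (bcons _ 0 x b)) - 0 -
        F.pull u (F.ins Q 0 b (slot 1 G)) 0 (barAlg k x) := h0
      rw [sub_zero] at h2
      rw [← neg_sub, ← h2, neg_zero]
    | succ m =>
      rw [diff_succ, slide_apply_zero, ← slideMap_succ] at h0
      rw [barD_succ, map_sub]
      rw [smul_add, pow_succ] at h0
      rw [pow_succ, smul_sub]
      rcases neg_one_pow_eq_or k m with h3 | h3 <;> rw [h3] at h0 ⊢ <;>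
        simp only [one_mul, neg_smul, one_smul, neg_neg, neg_mul] at h0 ⊢ <;>
        rw [← sub_eq_zero, ← h0.symm] <;> abel
  | add s t hs ht =>
    simp only [map_add, smul_add, hs, ht]
    module

theorem slide_add_left (u v : C) (m : ℕ) (b : bar (unit k A) m) (G : BarMaps F.Y Q) :
    F.slide Q (u + v) m b G = F.slide Q u m b G + F.slide Q v m b G := by
  induction m with
  | zero => rw [slide_zero, slide_zero, slide_zero, pull_add]
  | succ m ih =>
    induction b using bar_induction with
    | cons x b =>
      rw [slide_succ, slide_succ, slide_succ, pull_add, ih, map_add, smul_add]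
      abel
    | add s t hs ht =>
      simp only [map_add, LinearMap.add_apply, hs, ht]
      abel

theorem slide_mul_incl (u : C) (a : A) (m : ℕ) (b : bar (unit k A) m) (G : BarMaps F.Y Q) :
    F.slide Q (u * F.incl a) m b G = left a (F.slide Q u m b G) := by
  induction m with
  | zero => rw [slide_zero, slide_zero, pull_mul_incl]
  | succ m ih =>
    induction b using bar_induction with
    | cons x b =>
      rw [slide_succ, slide_succ, pull_mul_incl, ih, map_add, map_smul, left_cap]
    | add s t hs ht =>
      simp only [map_add, LinearMap.add_apply, hs, ht]

theorem slide_incl_mul (u : C) (a : A) (m : ℕ) (b : bar (unit k A) m) (G : BarMaps F.Y Q) :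
    F.slide Q (F.incl a * u) m b G = F.slide Q u m (op a • b) G := by
  induction m with
  | zero => rw [slide_zero, slide_zero, pull_incl_mul, left_ins]
  | succ m ih =>
    induction b using bar_induction with
    | cons x b =>
      rw [op_smul_bcons, slide_succ, slide_succ, pull_incl_mul, ih, left_ins, op_smul_bcons]
    | add s t hs ht =>
      simp only [smul_add, map_add, LinearMap.add_apply, hs, ht]

theorem slideMap_add_left (u v : C) (G : BarMaps F.Y Q) (m : ℕ) (b : bar (unit k A) m) :
    F.slideMap (u + v) G m b = F.slideMap u G m b + F.slideMap v G m b := by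
  cases m with
  | zero => exact (add_zero (0 : Q)).symm
  | succ m =>
    induction b using bar_induction with
    | cons x b =>
      rw [slideMap_succ, slideMap_succ, slideMap_succ, slide_add_left]
      rfl
    | add s t hs ht =>
      simp only [map_add, hs, ht]
      abel

/-- With `slideMap_incl_mul`, this says that the error term is balanced over `A^e`, as required for
evaluating it on the fundamental cycle. -/
theorem slideMap_mul_incl (u : C) (a : A) (G : BarMaps F.Y Q) (m : ℕ) (b : bar (unit k A) m) :
    F.slideMap (u * F.incl a) G m b = F.slideMap u G m (a • b) := by
  cases m with
  | zero => rfl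
  | succ m =>
    induction b using bar_induction with
    | cons x b =>
      rw [slideMap_succ, smul_bcons, slideMap_succ, slide_mul_incl, left_apply, ← append_smul,
        smul_barAlg]
    | add s t hs ht => simp only [smul_add, map_add, hs, ht]

theorem slideMap_incl_mul (u : C) (a : A) (G : BarMaps F.Y Q) (m : ℕ) (b : bar (unit k A) m) :
    F.slideMap (F.incl a * u) G m b = F.slideMap u G m (op a • b) := by
  cases m with
  | zero => rfl
  | succ m =>
    induction b using bar_induction with
    | cons x b => rw [slideMap_succ, op_smul_bcons, slideMap_succ, slide_incl_mul]
    | add s t hs ht => simp only [smul_add, map_add, hs, ht]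

open Classical in
/-- The family with a single nonzero member. -/
noncomputable def single (n : ℕ) (φ : bar F.Y n →ₗ[k] Q) : BarMaps F.Y Q := fun i =>
  if h : i = n then h ▸ φ else 0

theorem single_same (n : ℕ) (φ : bar F.Y n →ₗ[k] Q) : single n φ n = φ := dif_pos rfl

theorem single_ne (n : ℕ) (φ : bar F.Y n →ₗ[k] Q) {i : ℕ} (h : i ≠ n) :
    single n φ i = 0 := dif_neg h

/-- A trace `φ` on the bar complex of `Y` that is a cocycle takes the same values on `u T b` and
`b u`, up to a coboundary that depends on `u` and `b` in a balanced way. -/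
theorem exists_slide (m : ℕ) (φ : bar F.Y (m + 1) →ₗ[k] Q)
    (hφ : ∀ (a : A) b, φ (F.incl a • b) = φ (op (F.incl a) • b))
    (hd : ∀ b, φ (barD _ (m + 1) b) = 0) :
    ∃ β : C → bar (unit k A) m →ₗ[k] Q, (∀ u v b, β (u + v) b = β u b + β v b) ∧
      (∀ u a b, β (u * F.incl a) b = β u (a • b)) ∧
      (∀ u a b, β (F.incl a * u) b = β u (op a • b)) ∧ (m = 0 → β = 0) ∧
      ∀ u, F.IsHom 1 u → ∀ b, φ (F.twist u (m + 1) b) =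
        φ (op u • F.barIncl (m + 1) b) + β u (barD _ m b) := by
  have hG : ∀ a, left (F.incl a) (single (m + 1) φ) = right (F.incl a) (single (m + 1) φ) :=
    fun a => BarMaps.ext fun n b => by
      rw [left_apply, right_apply]
      by_cases h : n = m + 1
      · subst h
        rw [single_same, hφ]
      · rw [single_ne _ _ h]
        rfl
  have hD : diff (single (m + 1) φ) = 0 := BarMaps.ext fun n b => by
    cases n with
    | zero => rfl
    | succ n =>
      rw [diff_succ]
      by_cases h : n = m + 1
      · subst h
        rw [single_same, hd]
        rfl
      · rw [single_ne _ _ h]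
        rfl
  -- The factor removes the sign in `diff_slideMap` and orients the difference. For `m = 0` the
  -- family vanishes because `slideMap` was set to zero there.
  refine ⟨fun u => -((-1 : k) ^ m) • F.slideMap u (single (m + 1) φ) m, fun u v b => ?_,
    fun u a b => ?_, fun u a b => ?_, ?_, fun u hu b => ?_⟩
  · rw [LinearMap.smul_apply, slideMap_add_left, smul_add]
    rfl
  · rw [LinearMap.smul_apply, slideMap_mul_incl]
    rfl
  · rw [LinearMap.smul_apply, slideMap_incl_mul]
    rfl
  · rintro rfl
    funext u
    exact smul_zero _
  · rw [LinearMap.smul_apply, diff_slideMap hu hG hD, single_same]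
    rcases neg_one_pow_eq_or k m with h | h <;> rw [h] <;> module

end Frame

end

/-! ### Cocycles on finite resolutions by finitely generated projectives. -/

namespace ProjRes

variable {R : Type u} [Ring R] {M : ModuleCat.{u} R} (P : ProjRes M)

variable {P}

theorem IsCoboundary.comp {N N' : ModuleCat.{u} R} {n : ℕ} {f : P.X n →ₗ[R] N}
    (hf : P.IsCoboundary f) (g : N →ₗ[R] N') : P.IsCoboundary (g ∘ₗ f) := by
  cases n with
  | zero =>
    obtain rfl : f = 0 := hf
    exact LinearMap.comp_zero g
  | succ n =>
    obtain ⟨h, rfl⟩ := hf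
    exact ⟨g ∘ₗ h, LinearMap.comp_assoc _ _ _⟩

theorem IsCoboundary.zero {N : ModuleCat.{u} R} (n : ℕ) :
    P.IsCoboundary (0 : P.X n →ₗ[R] N) := by
  cases n with
  | zero => rfl
  | succ n => exact ⟨0, LinearMap.zero_comp _⟩

theorem IsCoboundary.add {N : ModuleCat.{u} R} {n : ℕ} {f g : P.X n →ₗ[R] N}
    (hf : P.IsCoboundary f) (hg : P.IsCoboundary g) : P.IsCoboundary (f + g) := by
  cases n with
  | zero =>
    obtain rfl : f = 0 := hf
    obtain rfl : g = 0 := hg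
    exact add_zero (0 : P.X 0 →ₗ[R] N)
  | succ n =>
    obtain ⟨h, rfl⟩ := hf
    obtain ⟨h', rfl⟩ := hg
    exact ⟨h + h', LinearMap.add_comp _ _ _⟩

theorem IsCoboundary.sum {N : ModuleCat.{u} R} {n : ℕ} {ι : Type*} (s : Finset ι)
    (f : ι → P.X n →ₗ[R] N) (hf : ∀ i ∈ s, P.IsCoboundary (f i)) :
    P.IsCoboundary (∑ i ∈ s, f i) :=
  Finset.sum_induction _ P.IsCoboundary (fun _ _ => IsCoboundary.add) (IsCoboundary.zero n) hf

theorem exists_finset_support {X J : Type*} [AddCommGroup X] [Module R X] [Module.Finite R X]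
    (c : X →ₗ[R] (J →₀ R)) : ∃ s : Finset J, ∀ x, (c x).support ⊆ s := by
  classical
  obtain ⟨S, hS⟩ := Module.Finite.fg_top (R := R) (M := X)
  refine ⟨S.biUnion fun x => (c x).support, fun x => ?_⟩
  have hx : x ∈ Submodule.span R (S : Set X) := hS ▸ Submodule.mem_top
  induction hx using Submodule.span_induction with
  | mem x hx => exact Finset.subset_biUnion_of_mem (fun x => (c x).support) hx
  | zero => rw [map_zero]; exact Finset.empty_subset _
  | add x y _ _ hx hy =>
    rw [map_add]
    exact Finsupp.support_add.trans (Finset.union_subset hx hy)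
  | smul r x _ hx =>
    rw [map_smul]
    exact Finsupp.support_smul.trans hx

/-- As the term is finitely generated, only finitely many coordinates of the cocycle are nonzero, so
it is a finite sum of cocycles with values in the ring. -/
theorem isCoboundary_finsupp {n : ℕ} [Module.Finite R (P.X n)]
    (h : ∀ f : P.X n →ₗ[R] R, f ∘ₗ P.d n = 0 → P.IsCoboundary (N := ModuleCat.of R R) f)
    {J : Type u} (c : P.X n →ₗ[R] (J →₀ R)) (hc : c ∘ₗ P.d n = 0) :
    P.IsCoboundary (N := ModuleCat.of R (J →₀ R)) c := by
  classical
  obtain ⟨s, hs⟩ := exists_finset_support c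
  have h1 : c = ∑ j ∈ s, Finsupp.lsingle j ∘ₗ (Finsupp.lapply j ∘ₗ c) := by
    ext x i
    rw [LinearMap.sum_apply, Finsupp.finsetSum_apply]
    simp only [LinearMap.comp_apply, Finsupp.lsingle_apply, Finsupp.lapply_apply,
      Finsupp.single_apply]
    rw [Finset.sum_ite_eq']
    split_ifs with hi
    · rfl
    · exact Finsupp.notMem_support_iff.1 fun hi' => hi (hs x hi')
  have h2 : ∀ j, P.IsCoboundary (N := ModuleCat.of R (J →₀ R))
      (Finsupp.lsingle j ∘ₗ (Finsupp.lapply j ∘ₗ c)) := fun j =>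
    (h (Finsupp.lapply j ∘ₗ c) (by rw [LinearMap.comp_assoc, hc, LinearMap.comp_zero])).comp
      (N' := ModuleCat.of R (J →₀ R)) (Finsupp.lsingle j)
  rw [h1]
  exact IsCoboundary.sum (N := ModuleCat.of R (J →₀ R)) s _ fun j _ => h2 j

/-- If all cocycles with values in the ring are coboundaries above degree `d`, then so are all
cocycles above degree `d`. -/
theorem isCoboundary_of_lt [∀ n, Module.Finite R (P.X n)] {d m : ℕ}
    (hm : ∀ n, m < n → Subsingleton (P.X n))
    (h : ∀ n, d < n → ∀ f : P.X n →ₗ[R] R, f ∘ₗ P.d n = 0 →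
      P.IsCoboundary (N := ModuleCat.of R R) f)
    {n : ℕ} (hn : d < n) {N : Type u} [AddCommGroup N] [Module R N] (f : P.X n →ₗ[R] N)
    (hf : f ∘ₗ P.d n = 0) : P.IsCoboundary (N := ModuleCat.of R N) f := by
  -- Descending induction on the degree, starting beyond the length of the resolution.
  obtain ⟨j, hj⟩ : ∃ j, m < n + j := ⟨m + 1, by lia⟩
  induction j generalizing n N with
  | zero =>
    have := hm n hj
    obtain rfl : f = 0 := LinearMap.ext fun x => by rw [Subsingleton.elim x 0, map_zero, map_zero]
    exact IsCoboundary.zero (N := ModuleCat.of R N) n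
  | succ j ih =>
    have := P.projective n
    let π : (N →₀ R) →ₗ[R] N := Finsupp.linearCombination R id
    have hπ : Function.Surjective π := Finsupp.linearCombination_surjective R Function.surjective_id
    obtain ⟨f', hf'⟩ := Module.projective_lifting_property π f hπ
    -- Dimension shift along a free cover with kernel `K`: the boundary of the lift `f'` is a
    -- cocycle in `K` one degree higher, hence equal to the boundary of some `g` with values in `K`.
    -- Then `f' - g` is a cocycle with free coefficients and still maps to `f`.
    let K := LinearMap.ker π
    have hK : ∀ x, f' (P.d n x) ∈ K := fun x => by
      change π (f' (P.d n x)) = 0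
      rw [← LinearMap.comp_apply, hf']
      exact LinearMap.congr_fun hf x
    obtain ⟨g, hg⟩ := ih (n := n + 1) (by lia) (N := K)
      (LinearMap.codRestrict K (f' ∘ₗ P.d n) hK) (LinearMap.ext fun x => Subtype.ext (by
        change f' (P.d n (P.d (n + 1) x)) = 0
        rw [P.d_d, map_zero])) (by lia)
    have h1 := isCoboundary_finsupp (h n hn) (f' - K.subtype ∘ₗ g) (by
      rw [LinearMap.sub_comp, LinearMap.comp_assoc, hg]
      exact sub_self (f' ∘ₗ P.d n))
    have h2 := h1.comp (N' := ModuleCat.of R N) π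
    have h3 : π ∘ₗ (f' - K.subtype ∘ₗ g) = f := by
      rw [LinearMap.comp_sub, hf', sub_eq_self]
      ext x
      exact (g x).2
    rwa [h3] at h2

/-- Finitely generated projective modules have finite dual bases. -/
theorem exists_dual_basis (R X : Type*) [Ring R] [AddCommGroup X] [Module R X] [Module.Finite R X]
    [Module.Projective R X] : ∃ (r : ℕ) (p : Fin r → X) (ξ : Fin r → X →ₗ[R] R),
      ∀ x, x = ∑ i, ξ i x • p i := by
  obtain ⟨r, q, s, -, -, hs⟩ := Module.Finite.exists_comp_eq_id_of_projective R X
  refine ⟨r, fun i => q (Pi.single i 1), fun i => LinearMap.proj i ∘ₗ s, fun x => ?_⟩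
  conv_lhs => rw [← LinearMap.id_apply (R := R) x, ← hs, LinearMap.comp_apply,
    pi_eq_sum_univ' (s x), map_sum]
  refine Finset.sum_congr rfl fun i _ => ?_
  rw [map_smul]
  rfl

/-- Cocycles in the top degree `d` have finite dual bases. -/
theorem exists_dual_cocycles [∀ n, Module.Finite R (P.X n)] {d m : ℕ}
    (hm : ∀ n, m < n → Subsingleton (P.X n))
    (h : ∀ n, d < n → ∀ f : P.X n →ₗ[R] R, f ∘ₗ P.d n = 0 →
      P.IsCoboundary (N := ModuleCat.of R R) f) :
    ∃ (r : ℕ) (p : Fin r → P.X d) (φ : Fin r → P.X d →ₗ[R] R), (∀ i, φ i ∘ₗ P.d d = 0) ∧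
      ∀ {N : Type u} [AddCommGroup N] [Module R N] (f : P.X d →ₗ[R] N), f ∘ₗ P.d d = 0 →
        ∀ x, f x = ∑ i, φ i x • f (p i) := by
  have := P.projective d
  let B := LinearMap.range (P.d d)
  -- The tautological cocycle with values in the boundaries `B` is a coboundary, so `g` retracts
  -- `P_d` onto `B`. Composing a dual basis of `P_d` with `1 - g` gives cocycles, and `1 - g` does
  -- not change the values of a cocycle.
  obtain ⟨g, hg⟩ := isCoboundary_of_lt hm h (n := d + 1) (by lia) (N := B) (P.d d).rangeRestrict
    (LinearMap.ext fun x => Subtype.ext (P.d_d d x))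
  have hg' : ∀ x, (g (P.d d x) : P.X d) = P.d d x := fun x =>
    congrArg Subtype.val (LinearMap.congr_fun hg x)
  obtain ⟨r, p, ξ, hξ⟩ := exists_dual_basis R (P.X d)
  refine ⟨r, p, fun i => ξ i ∘ₗ (LinearMap.id - B.subtype ∘ₗ g), fun i => ?_,
    fun {N} _ _ f hf x => ?_⟩
  · ext x
    change ξ i (P.d d x - (g (P.d d x) : P.X d)) = 0
    rw [hg', sub_self, map_zero]
  · have h1 : f x = f (x - (g x : P.X d)) := by
      obtain ⟨y, hy⟩ := (g x).2
      rw [map_sub, ← hy, ← LinearMap.comp_apply f, hf, LinearMap.zero_apply, sub_zero]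
    rw [h1, hξ (x - (g x : P.X d)), map_sum]
    refine Finset.sum_congr rfl fun i _ => ?_
    rw [map_smul]
    rfl

end ProjRes

/-! ### The inner structure on `Ext`, and extension of cocycles from `A` to `C`. -/

section

section Swap

variable {k A : Type u} [CommRing k] [Ring A] [Algebra k A]

/-- The anti-automorphism `a ⊗ b ↦ b ⊗ a` as an additive map. -/
noncomputable def Enveloping.swap : Enveloping k A →+ Enveloping k A where
  toFun s := unop (envelopingSwap k A s)
  map_zero' := by rw [map_zero, unop_zero]
  map_add' s t := by rw [map_add, unop_add]

namespace Enveloping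

theorem swap_tmul (a : A) (b : Aᵐᵒᵖ) :
    swap (a ⊗ₜ[k] b : Enveloping k A) = (b.unop ⊗ₜ[k] op a : Enveloping k A) := rfl

theorem swap_mul (s t : Enveloping k A) : swap (s * t) = swap t * swap s := by
  change unop (envelopingSwap k A (s * t)) = _
  rw [map_mul, unop_mul]
  rfl

theorem swap_swap (s : Enveloping k A) : swap (swap s) = s := by
  induction s using Enveloping.induction with
  | tmul a b => rfl
  | add s t hs ht => rw [map_add, map_add, hs, ht]

end Enveloping

end Swap

section ExtModule

open CategoryTheory Abelian

variable {k A : Type u} [CommRing k] [Ring A] [Algebra k A]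

/-- The inner structure of `A ⊗ A` acts on `Ext^i(M, A ⊗ A)`. -/
noncomputable instance extOuterModule (M : ModuleCat.{u} (Enveloping k A)) (i : ℕ) :
    Module (Enveloping k A) (Ext.{u} M (outerModule k A) i) where
  smul t e := e.comp (Ext.mk₀ (innerAction t)) (add_zero i)
  one_smul e := by
    change e.comp (Ext.mk₀ (innerAction 1)) (add_zero i) = e
    rw [innerAction_one, Ext.comp_mk₀_id]
  mul_smul s t e := by
    change e.comp (Ext.mk₀ (innerAction (s * t))) (add_zero i) =
      (e.comp (Ext.mk₀ (innerAction t)) (add_zero i)).comp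
        (Ext.mk₀ (innerAction s)) (add_zero i)
    rw [innerAction_mul, Ext.comp_assoc_of_third_deg_zero, Ext.mk₀_comp_mk₀]
  smul_zero t := by
    change Ext.comp 0 (Ext.mk₀ (innerAction t)) (add_zero i) = 0
    rw [Ext.zero_comp]
  smul_add t e e' := Ext.add_comp _ _ _ _
  add_smul s t e := by
    change e.comp (Ext.mk₀ (innerAction (s + t))) (add_zero i) =
      e.comp (Ext.mk₀ (innerAction s)) (add_zero i) +
        e.comp (Ext.mk₀ (innerAction t)) (add_zero i)
    rw [innerAction_add, Ext.mk₀_add, Ext.comp_add]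
  zero_smul e := by
    change e.comp (Ext.mk₀ (innerAction 0)) (add_zero i) = 0
    have h : innerAction (0 : Enveloping k A) = 0 := by
      have h := innerAction_add k A 0 0
      rw [add_zero] at h
      exact left_eq_add.mp h
    rw [h, Ext.mk₀_zero, Ext.comp_zero]

theorem ext_smul_def {M : ModuleCat.{u} (Enveloping k A)} {i : ℕ} (t : Enveloping k A)
    (e : Ext.{u} M (outerModule k A) i) :
    t • e = e.comp (Ext.mk₀ (innerAction t)) (add_zero i) := rfl

namespace ProjRes

variable {M : ModuleCat.{u} (Enveloping k A)} (P : ProjRes M) {n : ℕ}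

/-- Multiplication of a map with values in `A ⊗ A` from the right. -/
noncomputable def rmul (f : P.X n →ₗ[Enveloping k A] Enveloping k A) (t : Enveloping k A) :
    P.X n →ₗ[Enveloping k A] Enveloping k A :=
  LinearMap.toSpanSingleton (Enveloping k A) (Enveloping k A) t ∘ₗ f

variable {P}

theorem rmul_apply (f : P.X n →ₗ[Enveloping k A] Enveloping k A) (t : Enveloping k A) (x : P.X n) :
    P.rmul f t x = f x * t := rfl

theorem rmul_comp_d {f : P.X n →ₗ[Enveloping k A] Enveloping k A} (hf : f ∘ₗ P.d n = 0)
    (t : Enveloping k A) : P.rmul f t ∘ₗ P.d n = 0 := by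
  unfold rmul
  rw [LinearMap.comp_assoc, hf, LinearMap.comp_zero]

variable (P) in
/-- The class of a cocycle with values in `A ⊗ A`. -/
noncomputable def outerCls (f : P.X n →ₗ[Enveloping k A] Enveloping k A) (hf : f ∘ₗ P.d n = 0) :
    Ext.{u} M (outerModule k A) n := P.cls (N := outerModule k A) f hf

variable (P) in
/-- Coboundaries with values in `A ⊗ A`. -/
def IsOuterCoboundary (f : P.X n →ₗ[Enveloping k A] Enveloping k A) : Prop :=
  P.IsCoboundary (N := ModuleCat.of (Enveloping k A) (Enveloping k A)) f

theorem outerCls_surjective (e : Ext.{u} M (outerModule k A) n) :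
    ∃ (f : P.X n →ₗ[Enveloping k A] Enveloping k A) (hf : f ∘ₗ P.d n = 0), P.outerCls f hf = e :=
  P.cls_surjective e

theorem outerCls_eq_zero_iff {f : P.X n →ₗ[Enveloping k A] Enveloping k A} (hf : f ∘ₗ P.d n = 0) :
    P.outerCls f hf = 0 ↔ P.IsOuterCoboundary f := P.cls_eq_zero_iff (N := outerModule k A) f hf

theorem outerCls_add {f g : P.X n →ₗ[Enveloping k A] Enveloping k A} (hf : f ∘ₗ P.d n = 0)
    (hg : g ∘ₗ P.d n = 0) : P.outerCls f hf + P.outerCls g hg =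
      P.outerCls (f + g) (by rw [LinearMap.add_comp, hf, hg, add_zero]) :=
  P.cls_add (N := outerModule k A) f g hf hg

theorem outerCls_sub {f g : P.X n →ₗ[Enveloping k A] Enveloping k A} (hf : f ∘ₗ P.d n = 0)
    (hg : g ∘ₗ P.d n = 0) : P.outerCls f hf - P.outerCls g hg =
      P.outerCls (f - g) (by
        rw [LinearMap.sub_comp, hf, hg]
        exact sub_self (0 : P.X (n + 1) →ₗ[Enveloping k A] Enveloping k A)) :=
  P.cls_sub (N := outerModule k A) f g hf hg

theorem outerCls_eq_iff {f g : P.X n →ₗ[Enveloping k A] Enveloping k A} (hf : f ∘ₗ P.d n = 0)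
    (hg : g ∘ₗ P.d n = 0) : P.outerCls f hf = P.outerCls g hg ↔ P.IsOuterCoboundary (f - g) := by
  rw [← sub_eq_zero, outerCls_sub, outerCls_eq_zero_iff]

theorem smul_outerCls {f : P.X n →ₗ[Enveloping k A] Enveloping k A} (hf : f ∘ₗ P.d n = 0)
    (t : Enveloping k A) :
    t • P.outerCls f hf = P.outerCls (P.rmul f (Enveloping.swap t)) (rmul_comp_d hf _) :=
  P.cls_comp (N := outerModule k A) f hf (innerAction t)

theorem sum_comp_d {ι : Type*} (s : Finset ι) {f : ι → P.X n →ₗ[Enveloping k A] Enveloping k A}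
    (hf : ∀ i, f i ∘ₗ P.d n = 0) : (∑ i ∈ s, f i) ∘ₗ P.d n = 0 := by
  ext x
  rw [LinearMap.comp_apply, LinearMap.sum_apply, LinearMap.zero_apply]
  exact Finset.sum_eq_zero fun i _ => LinearMap.congr_fun (hf i) x

theorem outerCls_congr {f g : P.X n →ₗ[Enveloping k A] Enveloping k A} (h : f = g)
    (hf : f ∘ₗ P.d n = 0) (hg : g ∘ₗ P.d n = 0) : P.outerCls f hf = P.outerCls g hg := by
  subst h
  rfl

theorem outerCls_sum {ι : Type*} (s : Finset ι)
    {f : ι → P.X n →ₗ[Enveloping k A] Enveloping k A} (hf : ∀ i, f i ∘ₗ P.d n = 0) :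
    P.outerCls (∑ i ∈ s, f i) (sum_comp_d s hf) = ∑ i ∈ s, P.outerCls (f i) (hf i) := by
  classical
  induction s using Finset.induction_on with
  | empty => exact (outerCls_eq_zero_iff _).2 (IsCoboundary.zero n)
  | insert i s hi ih =>
    refine Eq.trans ?_ (Finset.sum_insert hi).symm
    rw [← ih, outerCls_add]
    exact outerCls_congr (Finset.sum_insert hi) _ _

end ProjRes

end ExtModule

namespace Frame

variable {k A C : Type u} [CommRing k] [Ring A] [Algebra k A] [Ring C] [Algebra k C]
  (F : Frame k A C)

open Enveloping

variable {F}

theorem env_swap (s : Enveloping k A) : F.env (swap s) = swap (F.env s) := by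
  induction s using Enveloping.induction with
  | tmul a b => rw [swap_tmul, env_tmul, env_tmul, swap_tmul]; rfl
  | add s t hs ht => rw [map_add, map_add, map_add, map_add, hs, ht]

variable (F) in
/-- The map `u ↦ u Tⁿ`. -/
noncomputable def monoRes (n : ℤ) : F.res →ₛₗ[F.env] F.Y where
  toFun u := F.mono n (F.toRes.symm u)
  map_add' u v := by rw [map_add, mono_add]
  map_smul' s u := by
    obtain ⟨c, rfl⟩ := F.toRes.surjective u
    induction s using Enveloping.induction with
    | tmul a b =>
      rw [env_tmul, Bimodule.env_smul, Bimodule.env_smul, LinearEquiv.symm_apply_apply,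
        op_smul_mono (isHom_incl _), smul_mono, add_zero]
      rfl
    | add s t hs ht => rw [add_smul, map_add, map_add F.env, mono_add, hs, ht, add_smul]

theorem monoRes_toRes (n : ℤ) (c : C) : F.monoRes n (F.toRes c) = F.mono n c := rfl

variable (P : ProjRes (diagonalModule k A)) {n : ℕ}

variable (F) in
/-- The extension of a map to the induced resolution. -/
noncomputable def extend (f : P.X n →ₗ[Enveloping k A] Enveloping k A) :
    (F.indRes P).X n →ₗ[Enveloping k C] Enveloping k C :=
  Ind.lift
    { toFun := fun x => F.env (f x)
      map_add' := fun x y => by rw [map_add, map_add]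
      map_smul' := fun s x => by rw [map_smul, smul_eq_mul, map_mul, smul_eq_mul] }

variable (F) in
/-- The map from a resolution to the induced resolution. -/
noncomputable def indι (n : ℕ) : P.X n →ₛₗ[F.env] (F.indRes P).X n := Ind.ι F.env (P.X n)

variable {P}

theorem extend_indι (f : P.X n →ₗ[Enveloping k A] Enveloping k A) (x : P.X n) :
    F.extend P f (F.indι P n x) = F.env (f x) := Ind.lift_ι _ x

theorem indRes_d (x : P.X (n + 1)) :
    (F.indRes P).d n (F.indι P (n + 1) x) = F.indι P n (P.d n x) := Ind.map_ι (P.d n) x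

theorem indRes_hom_ext {H : Type u} [AddCommGroup H] [Module (Enveloping k C) H]
    {f g : (F.indRes P).X n →ₗ[Enveloping k C] H}
    (h : ∀ x, f (F.indι P n x) = g (F.indι P n x)) : f = g := Ind.hom_ext h

theorem extend_comp_d {f : P.X n →ₗ[Enveloping k A] Enveloping k A} (hf : f ∘ₗ P.d n = 0) :
    F.extend P f ∘ₗ (F.indRes P).d n = 0 := indRes_hom_ext fun x => by
  rw [LinearMap.comp_apply, indRes_d, extend_indι, ← LinearMap.comp_apply, hf]
  exact map_zero F.env

theorem extend_isOuterCoboundary {f : P.X n →ₗ[Enveloping k A] Enveloping k A}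
    (hf : P.IsOuterCoboundary f) : (F.indRes P).IsOuterCoboundary (F.extend P f) := by
  cases n with
  | zero =>
    obtain rfl : f = 0 := hf
    exact indRes_hom_ext fun x => by
      rw [extend_indι]
      exact map_zero F.env
  | succ n =>
    obtain ⟨g, rfl⟩ := hf
    refine ⟨F.extend P g, indRes_hom_ext fun x => ?_⟩
    rw [LinearMap.comp_apply, indRes_d, extend_indι]
    exact (extend_indι _ _).symm

theorem extend_sub (f g : P.X n →ₗ[Enveloping k A] Enveloping k A) :
    F.extend P (f - g) = F.extend P f - F.extend P g := indRes_hom_ext fun x => by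
  rw [LinearMap.sub_apply, extend_indι, extend_indι, extend_indι, LinearMap.sub_apply, map_sub]

theorem extend_sum {ι : Type*} (s : Finset ι) (f : ι → P.X n →ₗ[Enveloping k A] Enveloping k A) :
    F.extend P (∑ i ∈ s, f i) = ∑ i ∈ s, F.extend P (f i) := indRes_hom_ext fun x => by
  rw [LinearMap.sum_apply, extend_indι, LinearMap.sum_apply, map_sum]
  exact Finset.sum_congr rfl fun i _ => (extend_indι _ _).symm

theorem extend_rmul (f : P.X n →ₗ[Enveloping k A] Enveloping k A) (t : Enveloping k A) :
    F.extend P (P.rmul f t) = (F.indRes P).rmul (F.extend P f) (F.env t) :=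
  indRes_hom_ext fun x => by
    rw [ProjRes.rmul_apply, extend_indι, extend_indι, ProjRes.rmul_apply, map_mul]

variable (F) in
/-- The linear map on the induced resolution given by a semilinear map. -/
noncomputable def indLift {H : Type u} [AddCommGroup H] [Module (Enveloping k C) H]
    (f : P.X n →ₛₗ[F.env] H) : (F.indRes P).X n →ₗ[Enveloping k C] H := Ind.lift f

theorem indLift_indι {H : Type u} [AddCommGroup H] [Module (Enveloping k C) H]
    (f : P.X n →ₛₗ[F.env] H) (x : P.X n) : F.indLift f (F.indι P n x) = f x := Ind.lift_ι f x

variable (F) in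
/-- The coordinates of the enveloping algebra of `C` as a left module over that of `A`. -/
noncomputable def envLeftCoord (s : Enveloping k C) : F.rightSection.J →₀ Enveloping k A :=
  (F.rightSection.coord (swap s)).mapRange swap (map_zero swap)

/-- Applying `swap` to `rightSection` exhibits `C^e` as a retract of a free left `A^e`-module. A
cocycle on the induced resolution thus becomes a cocycle on `P` with free coefficients, whose
primitive can be reassembled. -/
theorem isOuterCoboundary_indRes [Module.Finite (Enveloping k A) (P.X n)]
    (h : ∀ f : P.X n →ₗ[Enveloping k A] Enveloping k A, f ∘ₗ P.d n = 0 → P.IsOuterCoboundary f)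
    (f : (F.indRes P).X n →ₗ[Enveloping k C] Enveloping k C) (hf : f ∘ₗ (F.indRes P).d n = 0) :
    (F.indRes P).IsOuterCoboundary f := by
  let c : P.X n →ₗ[Enveloping k A] (F.rightSection.J →₀ Enveloping k A) :=
    { toFun := fun x => F.envLeftCoord (f (F.indι P n x))
      map_add' := fun x y => by
        ext j
        change swap (F.rightSection.coord (swap (f (F.indι P n (x + y)))) j) = swap _ + swap _
        rw [map_add, map_add, map_add, map_add, Finsupp.add_apply, map_add]
      map_smul' := fun s x => by
        ext j
        change swap (F.rightSection.coord (swap (f (F.indι P n (s • x)))) j) =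
          s * swap (F.rightSection.coord (swap (f (F.indι P n x))) j)
        rw [map_smulₛₗ, map_smul, smul_eq_mul, swap_mul, ← env_swap, F.rightSection.coord_mul,
          swap_mul, swap_swap] }
  have hc : ∀ x j, c x j = swap (F.rightSection.coord (swap (f (F.indι P n x))) j) :=
    fun _ _ => rfl
  -- The retraction recovering an element of `C^e` from its coordinates. It is semilinear, so a
  -- primitive of `c` may be composed with it.
  let asm : (F.rightSection.J →₀ Enveloping k A) →ₛₗ[F.env] Enveloping k C :=
    { toFun := fun q => q.sum fun j r => F.env r * swap (F.rightSection.gen j)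
      map_add' := fun q q' => Finsupp.sum_add_index' (fun _ => by rw [map_zero, zero_mul])
        fun _ _ _ => by rw [map_add, add_mul]
      map_smul' := fun s q => by
        rw [Finsupp.sum_smul_index (fun _ => by rw [map_zero, zero_mul]), smul_eq_mul,
          Finsupp.mul_sum]
        exact Finsupp.sum_congr fun j _ => by rw [map_mul, mul_assoc] }
  have hasm : ∀ x, asm (c x) = f (F.indι P n x) := fun x => by
    have h1 := congrArg swap (F.rightSection.sum_coord (swap (f (F.indι P n x))))
    rw [swap_swap] at h1
    rw [← h1, map_finsuppSum]
    refine (Finsupp.sum_mapRange_index (hf := map_zero swap)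
      (h := fun j r => F.env r * swap (F.rightSection.gen j))
      (fun _ => by rw [map_zero, zero_mul])).trans ?_
    exact Finsupp.sum_congr fun j _ => by rw [swap_mul, env_swap]
  have h1 := ProjRes.isCoboundary_finsupp h c (by
    ext x j
    rw [LinearMap.comp_apply, hc, ← indRes_d, ← LinearMap.comp_apply f, hf, LinearMap.zero_apply,
      map_zero, map_zero]
    exact map_zero swap)
  cases n with
  | zero =>
    have h2 : c = 0 := h1
    exact indRes_hom_ext fun x => by
      rw [← hasm, h2]
      exact map_zero asm
  | succ n =>
    obtain ⟨g, hg⟩ := h1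
    have h2 : ∀ x, g (P.d n x) = c x := fun x => LinearMap.congr_fun hg x
    let g' : P.X n →ₛₗ[F.env] Enveloping k C := asm.comp g
    have h3 : F.indLift g' ∘ₗ (F.indRes P).d n = f := indRes_hom_ext fun x => by
      rw [← hasm, ← h2, LinearMap.comp_apply, indRes_d, indLift_indι]
      rfl
    exact ⟨F.indLift g', h3⟩

end Frame

end

/-! ### Evaluation of cocycles on the fundamental cycle. -/

namespace Frame

open Enveloping

variable {k A C : Type u} [CommRing k] [Ring A] [Algebra k A] [Ring C] [Algebra k C]

/-- A dual basis for the cocycles of degree `d` of a resolution of `A`, together with the values `u`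
of an identification of their classes with the elements of degree one of `C`. -/
structure Duality (F : Frame k A C) (P : ProjRes (diagonalModule k A)) (d : ℕ) where
  r : ℕ
  p : Fin r → P.X d
  φ : Fin r → P.X d →ₗ[Enveloping k A] Enveloping k A
  u : Fin r → F.res
  cocycle : ∀ i, φ i ∘ₗ P.d d = 0
  isHom : ∀ i, F.IsHom 1 (F.toRes.symm (u i))
  expand : ∀ {N : Type u} [AddCommGroup N] [Module (Enveloping k A) N]
    (f : P.X d →ₗ[Enveloping k A] N), f ∘ₗ P.d d = 0 → ∀ x, f x = ∑ i, φ i x • f (p i)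
  sum_eq_zero_iff : ∀ f : P.X d →ₗ[Enveloping k A] Enveloping k A, f ∘ₗ P.d d = 0 →
    (∑ i, swap (f (p i)) • u i = 0 ↔ P.IsOuterCoboundary f)
  exists_sum_eq : ∀ c, F.IsHom 1 c → ∃ f : P.X d →ₗ[Enveloping k A] Enveloping k A,
    f ∘ₗ P.d d = 0 ∧ ∑ i, swap (f (p i)) • u i = F.toRes c

variable {F : Frame k A C} {P : ProjRes (diagonalModule k A)}

theorem isHom_env_smul {n : ℤ} {u : F.res} (hu : F.IsHom n (F.toRes.symm u)) (s : Enveloping k A) :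
    F.IsHom n (F.toRes.symm (s • u)) := by
  induction s using Enveloping.induction with
  | tmul a b =>
    have h : F.toRes.symm ((a ⊗ₜ[k] b : Enveloping k A) • u) =
      F.incl a * (F.toRes.symm u * F.incl b.unop) := rfl
    rw [h]
    exact ((isHom_incl a).mul (hu.mul (isHom_incl b.unop))).cast (by lia)
  | add s t hs ht =>
    rw [add_smul, map_add]
    exact hs.add ht

theorem isHom_sum {n : ℤ} {ι : Type*} (s : Finset ι) {c : ι → C} (hc : ∀ i, F.IsHom n (c i)) :
    F.IsHom n (∑ i ∈ s, c i) :=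
  Finset.sum_induction _ (F.IsHom n) (fun _ _ => IsHom.add) (isHom_zero n) fun i _ => hc i

namespace Duality

variable {d : ℕ} (D : Duality F P d)

/-- The element of degree one given by a cocycle. -/
noncomputable def total (f : P.X d →ₗ[Enveloping k A] Enveloping k A) : F.res :=
  ∑ i, swap (f (D.p i)) • D.u i

theorem isHom_total (f : P.X d →ₗ[Enveloping k A] Enveloping k A) :
    F.IsHom 1 (F.toRes.symm (D.total f)) := by
  unfold total
  rw [map_sum]
  exact isHom_sum _ fun i => isHom_env_smul (D.isHom i) _

theorem total_sub (f g : P.X d →ₗ[Enveloping k A] Enveloping k A) :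
    D.total (f - g) = D.total f - D.total g := by
  unfold total
  rw [← Finset.sum_sub_distrib]
  refine Finset.sum_congr rfl fun i _ => ?_
  rw [LinearMap.sub_apply, map_sub, sub_smul]

theorem total_sum {ι : Type*} (s : Finset ι) (f : ι → P.X d →ₗ[Enveloping k A] Enveloping k A) :
    D.total (∑ j ∈ s, f j) = ∑ j ∈ s, D.total (f j) := by
  unfold total
  rw [Finset.sum_comm]
  refine Finset.sum_congr rfl fun i _ => ?_
  rw [LinearMap.sum_apply, map_sum, Finset.sum_smul]

theorem total_rmul (f : P.X d →ₗ[Enveloping k A] Enveloping k A) (t : Enveloping k A) :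
    D.total (P.rmul f t) = swap t • D.total f := by
  unfold total
  rw [Finset.smul_sum]
  refine Finset.sum_congr rfl fun i _ => ?_
  rw [ProjRes.rmul_apply, swap_mul, mul_smul]

theorem extend_eq_of_total_eq {f g : P.X d →ₗ[Enveloping k A] Enveloping k A}
    (hf : f ∘ₗ P.d d = 0) (hg : g ∘ₗ P.d d = 0) (h : D.total f = D.total g) :
    (F.indRes P).outerCls (F.extend P f) (extend_comp_d hf) =
      (F.indRes P).outerCls (F.extend P g) (extend_comp_d hg) := by
  rw [ProjRes.outerCls_eq_iff, ← extend_sub]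
  apply extend_isOuterCoboundary
  rw [← D.sum_eq_zero_iff (f - g) (by
    rw [LinearMap.sub_comp, hf, hg]
    exact sub_self (0 : P.X (d + 1) →ₗ[Enveloping k A] Enveloping k A))]
  change D.total (f - g) = 0
  rw [total_sub, h, sub_self]

/-- The element of `Y` given by a cocycle on the induced resolution. -/
noncomputable def ev (f : (F.indRes P).X d →ₗ[Enveloping k C] Enveloping k C) : F.Y :=
  ∑ i, swap (f (F.indι P d (D.p i))) • F.monoRes 1 (D.u i)

theorem ev_add (f g : (F.indRes P).X d →ₗ[Enveloping k C] Enveloping k C) :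
    D.ev (f + g) = D.ev f + D.ev g := by
  unfold ev
  rw [← Finset.sum_add_distrib]
  refine Finset.sum_congr rfl fun i _ => ?_
  rw [LinearMap.add_apply, map_add, add_smul]

theorem ev_rmul (f : (F.indRes P).X d →ₗ[Enveloping k C] Enveloping k C) (t : Enveloping k C) :
    D.ev ((F.indRes P).rmul f t) = swap t • D.ev f := by
  unfold ev
  rw [Finset.smul_sum]
  refine Finset.sum_congr rfl fun i _ => ?_
  rw [ProjRes.rmul_apply, swap_mul, mul_smul]

theorem ev_extend (f : P.X d →ₗ[Enveloping k A] Enveloping k A) :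
    D.ev (F.extend P f) = F.monoRes 1 (D.total f) := by
  unfold ev total
  rw [map_sum]
  refine Finset.sum_congr rfl fun i _ => ?_
  rw [extend_indι, ← env_swap, map_smulₛₗ]

/-- This says that the sum of the `u_i ⊗ p_i` in `U ⊗_{A^e} P_d` is a cycle. Expanding `∂ p_i` in a
dual basis `(q_j, ξ_j)` of the next term, the coefficient of `q_j` is the element of `U` given by
the coboundary of `ξ_j`, and this is zero. -/
theorem sum_balanced {n : ℕ} (D : Duality F P (n + 1)) [Module.Finite (Enveloping k A) (P.X n)]
    {Q : Type*} [AddCommGroup Q] (b : F.res →+ P.X n →+ Q)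
    (hb : ∀ (s : Enveloping k A) u q, b (swap s • u) q = b u (s • q)) :
    ∑ i, b (D.u i) (P.d n (D.p i)) = 0 := by
  have := P.projective n
  obtain ⟨r, q, ξ, hξ⟩ := ProjRes.exists_dual_basis (Enveloping k A) (P.X n)
  have h1 : ∀ i, b (D.u i) (P.d n (D.p i)) =
      ∑ j, b (swap ((ξ j ∘ₗ P.d n) (D.p i)) • D.u i) (q j) := fun i => by
    conv_lhs => rw [hξ (P.d n (D.p i)), map_sum]
    exact Finset.sum_congr rfl fun j _ => (hb _ _ _).symm
  rw [Finset.sum_congr rfl fun i _ => h1 i, Finset.sum_comm]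
  refine Finset.sum_eq_zero fun j _ => ?_
  have h2 : ∑ i, swap ((ξ j ∘ₗ P.d n) (D.p i)) • D.u i = 0 :=
    (D.sum_eq_zero_iff (ξ j ∘ₗ P.d n) (LinearMap.ext fun x => by
      rw [LinearMap.comp_apply, LinearMap.comp_apply, P.d_d, map_zero]
      rfl)).2 ⟨ξ j, rfl⟩
  have h3 := congrArg (fun v => b v (q j)) h2
  simp only [map_sum, map_zero] at h3
  rw [AddMonoidHom.finsetSum_apply] at h3
  exact h3

/-- In positive degree, evaluating a coboundary of `g` on the fundamental cycle means evaluating `g`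
on its boundary, which vanishes by `sum_balanced`. -/
theorem ev_eq_zero [∀ n, Module.Finite (Enveloping k A) (P.X n)]
    {f : (F.indRes P).X d →ₗ[Enveloping k C] Enveloping k C}
    (hf : (F.indRes P).IsOuterCoboundary f) : D.ev f = 0 := by
  cases d with
  | zero =>
    obtain rfl : f = 0 := hf
    refine Finset.sum_eq_zero fun i _ => ?_
    rw [LinearMap.zero_apply, map_zero]
    exact zero_smul (Enveloping k C) (F.monoRes 1 (D.u i))
  | succ n =>
    obtain ⟨g, rfl⟩ := hf
    let g' : (F.indRes P).X n →ₗ[Enveloping k C] Enveloping k C := g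
    let b : F.res →+ P.X n →+ F.Y := AddMonoidHom.mk' (fun u => AddMonoidHom.mk'
      (fun q => swap (g' (F.indι P n q)) • F.monoRes 1 u)
      fun q q' => by rw [map_add, map_add, map_add, add_smul])
      fun u u' => AddMonoidHom.ext fun q => by
        change swap (g' (F.indι P n q)) • F.monoRes 1 (u + u') =
          swap (g' (F.indι P n q)) • F.monoRes 1 u + swap (g' (F.indι P n q)) • F.monoRes 1 u'
        rw [map_add, smul_add]
    refine Eq.trans ?_ (D.sum_balanced b fun s u q => ?_)
    · refine Finset.sum_congr rfl fun i _ => ?_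
      change swap (g' ((F.indRes P).d n (F.indι P (n + 1) (D.p i)))) • F.monoRes 1 (D.u i) =
        swap (g' (F.indι P n (P.d n (D.p i)))) • F.monoRes 1 (D.u i)
      rw [indRes_d]
    · change swap (g' (F.indι P n q)) • F.monoRes 1 (swap s • u) =
        swap (g' (F.indι P n (s • q))) • F.monoRes 1 u
      rw [map_smulₛₗ, map_smulₛₗ, map_smul, smul_eq_mul, swap_mul, env_swap, mul_smul]

variable [∀ n, Module.Finite (Enveloping k A) (P.X n)]

theorem ev_eq {f g : (F.indRes P).X d →ₗ[Enveloping k C] Enveloping k C}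
    (hf : f ∘ₗ (F.indRes P).d d = 0) (hg : g ∘ₗ (F.indRes P).d d = 0)
    (h : (F.indRes P).outerCls f hf = (F.indRes P).outerCls g hg) : D.ev f = D.ev g := by
  rw [ProjRes.outerCls_eq_iff] at h
  have h1 := D.ev_add (f - g) g
  rw [D.ev_eq_zero h, zero_add] at h1
  rw [← h1]
  exact congrArg D.ev (LinearMap.ext fun x => (sub_add_cancel (f x) (g x)).symm)

variable (F d) in
/-- The module `Ext^d(Y, C ⊗ C)`. -/
abbrev ExtY : Type u :=
  CategoryTheory.Abelian.Ext.{u} (ModuleCat.of (Enveloping k C) F.Y) (outerModule k C) d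

/-- The element of `Y` given by a class. -/
noncomputable def evExt (e : ExtY F d) : F.Y :=
  D.ev (ProjRes.outerCls_surjective (P := F.indRes P) e).choose

theorem evExt_outerCls {f : (F.indRes P).X d →ₗ[Enveloping k C] Enveloping k C}
    (hf : f ∘ₗ (F.indRes P).d d = 0) : D.evExt ((F.indRes P).outerCls f hf) = D.ev f :=
  D.ev_eq _ hf (ProjRes.outerCls_surjective (P := F.indRes P)
    ((F.indRes P).outerCls f hf)).choose_spec.choose_spec

/-- The map from classes to `Y`. -/
noncomputable def evLinear : ExtY F d →ₗ[Enveloping k C] F.Y where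
  toFun := D.evExt
  map_add' e e' := by
    obtain ⟨f, hf, rfl⟩ := ProjRes.outerCls_surjective (P := F.indRes P) e
    obtain ⟨f', hf', rfl⟩ := ProjRes.outerCls_surjective (P := F.indRes P) e'
    rw [ProjRes.outerCls_add, evExt_outerCls, evExt_outerCls, evExt_outerCls, ev_add]
  map_smul' t e := by
    obtain ⟨f, hf, rfl⟩ := ProjRes.outerCls_surjective (P := F.indRes P) e
    rw [ProjRes.smul_outerCls, evExt_outerCls, evExt_outerCls, ev_rmul, swap_swap]
    rfl

theorem evLinear_outerCls {f : (F.indRes P).X d →ₗ[Enveloping k C] Enveloping k C}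
    (hf : f ∘ₗ (F.indRes P).d d = 0) : D.evLinear ((F.indRes P).outerCls f hf) = D.ev f :=
  D.evExt_outerCls hf

end Duality

end Frame

/-! ### The identification of `Ext^d(Y, C ⊗ C)` with `Y`. -/

namespace Frame.Duality

open Enveloping

variable {k A C : Type u} [CommRing k] [Ring A] [Algebra k A] [Ring C] [Algebra k C]
  {F : Frame k A C} {P : ProjRes (diagonalModule k A)} {d : ℕ} (D : Duality F P d)

variable (F) in
/-- The class on the induced resolution given by a cocycle. -/
noncomputable def extCls (f : P.X d →ₗ[Enveloping k A] Enveloping k A) (hf : f ∘ₗ P.d d = 0) :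
    ExtY F d := (F.indRes P).outerCls (F.extend P f) (extend_comp_d hf)

theorem smul_extCls {f : P.X d →ₗ[Enveloping k A] Enveloping k A} (hf : f ∘ₗ P.d d = 0)
    (t : Enveloping k A) : F.env t • extCls F f hf =
      extCls F (P.rmul f (swap t)) (ProjRes.rmul_comp_d hf _) := by
  refine (ProjRes.smul_outerCls _ _).trans (ProjRes.outerCls_congr ?_ _ _)
  rw [extend_rmul, env_swap]

theorem extCls_sum {ι : Type*} (s : Finset ι)
    {f : ι → P.X d →ₗ[Enveloping k A] Enveloping k A} (hf : ∀ i, f i ∘ₗ P.d d = 0) :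
    extCls F (∑ i ∈ s, f i) (ProjRes.sum_comp_d s hf) = ∑ i ∈ s, extCls F (f i) (hf i) := by
  refine Eq.trans (ProjRes.outerCls_congr (extend_sum s f) _ ?_) (ProjRes.outerCls_sum s _)
  exact ProjRes.sum_comp_d s fun i => extend_comp_d (hf i)

/-- A cocycle whose class is a given element of degree one. -/
noncomputable def lift {c : C} (hc : F.IsHom 1 c) : P.X d →ₗ[Enveloping k A] Enveloping k A :=
  (D.exists_sum_eq c hc).choose

theorem lift_comp_d {c : C} (hc : F.IsHom 1 c) : D.lift hc ∘ₗ P.d d = 0 :=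
  (D.exists_sum_eq c hc).choose_spec.1

theorem total_lift {c : C} (hc : F.IsHom 1 c) : D.total (D.lift hc) = F.toRes c :=
  (D.exists_sum_eq c hc).choose_spec.2

/-- The class that corresponds to the generator of `Y`. -/
noncomputable def gen : ExtY F d :=
  ∑ j, (F.lo 1 j ⊗ₜ[k] 1 : Enveloping k C) •
    extCls F (D.lift (isHom_hi 1 j)) (D.lift_comp_d (isHom_hi 1 j))

/-- For `c` of degree one, the `c y_j` lie in `A`, so `c` times the generator is the class whose
total is `∑ c y_j x_j = c`. This property characterises the generator. -/
theorem smul_gen {f : P.X d →ₗ[Enveloping k A] Enveloping k A} (hf : f ∘ₗ P.d d = 0) {c : C}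
    (hc : D.total f = F.toRes c) : (c ⊗ₜ[k] 1 : Enveloping k C) • D.gen = extCls F f hf := by
  have hc1 : F.IsHom 1 c := by
    have h := D.isHom_total f
    rwa [hc, LinearEquiv.symm_apply_apply] at h
  have h0 : ∀ j, ∃ a, F.incl a = c * F.lo 1 j := fun j =>
    F.exists_incl _ ((hc1.mul (isHom_lo 1 j)).cast (by lia))
  choose a ha using h0
  unfold gen
  rw [Finset.smul_sum]
  have h1 : ∀ j, (c ⊗ₜ[k] 1 : Enveloping k C) • (F.lo 1 j ⊗ₜ[k] 1 : Enveloping k C) •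
      extCls F (D.lift (isHom_hi 1 j)) (D.lift_comp_d (isHom_hi 1 j)) =
      extCls F (P.rmul (D.lift (isHom_hi 1 j)) (swap (a j ⊗ₜ[k] 1)))
        (ProjRes.rmul_comp_d (D.lift_comp_d (isHom_hi 1 j)) _) := fun j => by
    rw [← smul_extCls, ← mul_smul, Algebra.TensorProduct.tmul_mul_tmul, one_mul, env_tmul, ha,
      unop_one, map_one, op_one]
  rw [Finset.sum_congr rfl fun j _ => h1 j, ← extCls_sum]
  refine D.extend_eq_of_total_eq (ProjRes.sum_comp_d _ fun j =>
    ProjRes.rmul_comp_d (D.lift_comp_d (isHom_hi 1 j)) _) hf ?_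
  rw [total_sum, hc]
  have h2 : ∀ j, D.total (P.rmul (D.lift (isHom_hi 1 j)) (swap (a j ⊗ₜ[k] 1))) =
      F.toRes (c * (F.lo 1 j * F.hi 1 j)) := fun j => by
    rw [total_rmul, swap_swap, total_lift, ← mul_assoc, ← ha, ← smul_toRes, Bimodule.smul_eq_env]
  rw [Finset.sum_congr rfl fun j _ => h2 j, ← map_sum, ← Finset.mul_sum, sum_lo_hi, mul_one]

/-- Since `1` lies in `C₋₁ C₁`, an element is recovered from its left multiples by elements of
degree one. -/
theorem eq_of_smul_eq {H : Type*} [AddCommGroup H] [Module (Enveloping k C) H] {x y : H}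
    (h : ∀ c, F.IsHom 1 c → (c ⊗ₜ[k] 1 : Enveloping k C) • x = (c ⊗ₜ[k] 1 : Enveloping k C) • y) :
    x = y := by
  have h1 : ∀ z : H, z = ∑ j, (F.lo 1 j ⊗ₜ[k] 1 : Enveloping k C) •
      (F.hi 1 j ⊗ₜ[k] 1 : Enveloping k C) • z := fun z => by
    simp only [← mul_smul, Algebra.TensorProduct.tmul_mul_tmul, one_mul]
    rw [← Finset.sum_smul, ← TensorProduct.sum_tmul, sum_lo_hi]
    exact (one_smul (Enveloping k C) z).symm
  rw [h1 x, h1 y]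
  exact Finset.sum_congr rfl fun j _ => by rw [h _ (isHom_hi 1 j)]

/-- After left multiplication by `c` of degree one, both sides are the class with total `c a`. -/
theorem isCentral_gen : IsCentral k F D.gen := by
  intro a
  refine eq_of_smul_eq (F := F) fun c hc => ?_
  have hca : F.IsHom 1 (c * F.incl a) := (hc.mul (isHom_incl a)).cast (add_zero 1)
  have h1 : D.total (P.rmul (D.lift hc) (swap (1 ⊗ₜ[k] op a))) = F.toRes (c * F.incl a) := by
    rw [total_rmul, swap_swap, total_lift, ← op_smul_toRes, Bimodule.op_smul_eq_env]
  have h2 := D.smul_gen (ProjRes.rmul_comp_d (D.lift_comp_d hc) _) h1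
  have h3 : (c ⊗ₜ[k] 1 : Enveloping k C) • (F.incl a ⊗ₜ[k] 1 : Enveloping k C) • D.gen =
      ((c * F.incl a) ⊗ₜ[k] 1 : Enveloping k C) • D.gen := by
    rw [← mul_smul, Algebra.TensorProduct.tmul_mul_tmul, one_mul]
  have h4 : (c ⊗ₜ[k] 1 : Enveloping k C) • (1 ⊗ₜ[k] op (F.incl a) : Enveloping k C) • D.gen =
      F.env (1 ⊗ₜ[k] op a) • (c ⊗ₜ[k] 1 : Enveloping k C) • D.gen := by
    rw [env_tmul, map_one, unop_op, ← mul_smul, ← mul_smul, Algebra.TensorProduct.tmul_mul_tmul,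
      Algebra.TensorProduct.tmul_mul_tmul, one_mul, one_mul, mul_one, mul_one]
  rw [h3, h2, h4, D.smul_gen (D.lift_comp_d hc) (D.total_lift hc), smul_extCls]

/-- The map from `Y` to classes. -/
noncomputable def toExt : F.Y →ₗ[Enveloping k C] ExtY F d := desc D.gen D.isCentral_gen

theorem toExt_one : D.toExt (F.mono 0 1) = D.gen := desc_one _ _

theorem toExt_mono {f : P.X d →ₗ[Enveloping k A] Enveloping k A} (hf : f ∘ₗ P.d d = 0) {c : C}
    (hc : D.total f = F.toRes c) : D.toExt (F.mono 0 c) = extCls F f hf := by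
  rw [← D.smul_gen hf hc, ← toExt_one, ← map_smul, ← Bimodule.smul_eq_env, smul_mono, mul_one]

theorem expand_indι {f : (F.indRes P).X d →ₗ[Enveloping k C] Enveloping k C}
    (hf : f ∘ₗ (F.indRes P).d d = 0) (x : P.X d) :
    f (F.indι P d x) = ∑ i, F.env (D.φ i x) * f (F.indι P d (D.p i)) := by
  -- The expansion in the dual basis holds for arbitrary coefficients, in particular for `C^e`
  -- restricted to `A^e`.
  let _ : Module (Enveloping k A) (Enveloping k C) := Module.compHom _ F.env
  let g : P.X d →ₗ[Enveloping k A] Enveloping k C :=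
    { toFun := fun x => f (F.indι P d x)
      map_add' := fun x y => by rw [map_add, map_add]
      map_smul' := fun s x => by
        rw [map_smulₛₗ, map_smul]
        rfl }
  refine D.expand g (LinearMap.ext fun x => ?_) x
  change f (F.indι P d (P.d d x)) = 0
  rw [← indRes_d]
  exact LinearMap.congr_fun hf _

/-- The expansion writes any cocycle as a sum of right multiples of the extended `φ_i`. So their
classes generate, and they lie in the image. -/
theorem toExt_surjective : Function.Surjective D.toExt := by
  intro e
  obtain ⟨f, hf, rfl⟩ := ProjRes.outerCls_surjective (P := F.indRes P) e
  refine ⟨∑ i, swap (f (F.indι P d (D.p i))) •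
    F.mono 0 (F.toRes.symm (D.total (D.φ i))), ?_⟩
  rw [map_sum]
  have h1 : ∀ i, D.toExt (swap (f (F.indι P d (D.p i))) •
      F.mono 0 (F.toRes.symm (D.total (D.φ i)))) =
      (F.indRes P).outerCls ((F.indRes P).rmul (F.extend P (D.φ i)) (f (F.indι P d (D.p i))))
        (ProjRes.rmul_comp_d (extend_comp_d (D.cocycle i)) _) := fun i => by
    rw [map_smul, D.toExt_mono (D.cocycle i) (F.toRes.apply_symm_apply _).symm]
    refine (ProjRes.smul_outerCls _ _).trans (ProjRes.outerCls_congr ?_ _ _)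
    rw [swap_swap]
  rw [Finset.sum_congr rfl fun i _ => h1 i, ← ProjRes.outerCls_sum]
  refine ProjRes.outerCls_congr (indRes_hom_ext fun x => ?_) _ _
  rw [D.expand_indι hf, LinearMap.sum_apply]
  exact Finset.sum_congr rfl fun i _ => by rw [ProjRes.rmul_apply, extend_indι]

variable [∀ n, Module.Finite (Enveloping k A) (P.X n)]

theorem evLinear_gen : D.evLinear D.gen = F.mono 1 1 := by
  unfold gen
  rw [map_sum]
  have h1 : ∀ j, D.evLinear ((F.lo 1 j ⊗ₜ[k] 1 : Enveloping k C) •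
      extCls F (D.lift (isHom_hi 1 j)) (D.lift_comp_d (isHom_hi 1 j))) =
      F.mono 1 (F.lo 1 j * F.hi 1 j) := fun j => by
    rw [map_smul]
    unfold extCls
    rw [evLinear_outerCls, ev_extend, total_lift, monoRes_toRes, ← Bimodule.smul_eq_env, smul_mono]
  rw [Finset.sum_congr rfl fun j _ => h1 j, ← mono_sum, sum_lo_hi]

theorem evLinear_toExt (y : F.Y) : D.evLinear (D.toExt y) = F.shift 1 y := by
  have h : D.evLinear ∘ₗ D.toExt = F.shift 1 := y_hom_ext (by
    rw [LinearMap.comp_apply, toExt_one, evLinear_gen, shift_mono, zero_add])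
  exact LinearMap.congr_fun h y

/-- `evLinear ∘ toExt` is the automorphism `T` and `toExt` is surjective, which forces both maps to
be bijective. -/
theorem evLinear_injective : Function.Injective D.evLinear := by
  intro e e' h
  obtain ⟨y, rfl⟩ := D.toExt_surjective e
  obtain ⟨y', rfl⟩ := D.toExt_surjective e'
  rw [evLinear_toExt, evLinear_toExt] at h
  have h' := congrArg (F.shift (-1)) h
  rw [shift_shift, shift_shift, add_neg_cancel, shift_zero, shift_zero] at h'
  rw [h']

theorem toExt_injective : Function.Injective D.toExt := by
  intro y y' h
  have h' := congrArg (fun e => F.shift (-1) (D.evLinear e)) h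
  simp only [evLinear_toExt] at h'
  rw [shift_shift, shift_shift, add_neg_cancel, shift_zero, shift_zero] at h'
  exact h'

end Frame.Duality

/-! ### The action of `T` on `Ext^d(Y, C ⊗ C)`. -/

section

namespace Bimodule

variable {k R : Type u} [CommRing k] [Ring R] [Algebra k R] {M N : Bimodule k R}

instance projective_unit : Module.Projective Rᵐᵒᵖ (unit k R) :=
  .of_equiv' (M := Rᵐᵒᵖ)
    { toFun := fun a => (a.unop : R)
      invFun := fun a => op (toAlg a)
      map_add' := fun _ _ => rfl
      map_smul' := fun _ _ => rfl
      left_inv := fun _ => rfl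
      right_inv := fun _ => rfl }

theorem env_smul_comm (s : Enveloping k R) (c : k) (m : M) : s • c • m = c • s • m := by
  induction s using Enveloping.induction with
  | tmul a b => rw [env_smul, env_smul, smul_comm b c, smul_comm a c]
  | add s t hs ht => rw [add_smul, add_smul, hs, ht, smul_add]

/-- The map induced on the bar complex, as a map of bimodules. -/
noncomputable def barMapEnv (f : M →ₗ[Enveloping k R] N) (n : ℕ) :
    bar M n →ₗ[Enveloping k R] bar N n :=
  envLinear (barMap f n).toAddMonoidHom
    (fun a t => (barMap_smul f n a t).trans (smul_eq_env _ _ _))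
    (fun c t => (barMap_op_smul f n c t).trans (op_smul_eq_env _ _ _))

/-- The map induced on bar resolutions. -/
noncomputable def barLiftRes [Module.Projective Rᵐᵒᵖ M] [Module.Projective Rᵐᵒᵖ N]
    [Module.Projective k R] (f : M →ₗ[Enveloping k R] N) :
    ProjRes.Lift (barRes M) (barRes N) f where
  f n := barMapEnv f (n + 1)
  comm n x := barD_barMap f (n + 1) x
  comm_aug x := barD_barMap f 0 x

end Bimodule

namespace Frame

open Bimodule Enveloping

variable {k A C : Type u} [CommRing k] [Ring A] [Algebra k A] [Ring C] [Algebra k C]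
  {F : Frame k A C}

variable (F) in
/-- The map from the bar complex of `A` to that of `Y` as a semilinear map. -/
noncomputable def barInclEnv (n : ℕ) : bar (unit k A) n →ₛₗ[F.env] bar F.Y n where
  toFun := F.barIncl n
  map_add' := map_add (F.barIncl n)
  map_smul' s b := by
    induction s using Enveloping.induction with
    | tmul x y =>
      rw [env_smul, env_tmul, env_smul, barIncl_smul]
      exact congrArg (F.incl x • ·) (barIncl_op_smul n y.unop b)
    | add s t hs ht => rw [add_smul, map_add, map_add F.env, add_smul, hs, ht]

/-- A functional with values in `C ⊗ C`, composed with the flip `C ⊗ C → Y`. -/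
noncomputable def traceMap {n : ℕ} (φ : bar F.Y n →ₗ[Enveloping k C] Enveloping k C) :
    bar F.Y n →ₗ[k] F.Y where
  toFun b := swap (φ b) • F.mono 0 1
  map_add' b b' := by rw [map_add, map_add, add_smul]
  map_smul' c b := by
    rw [RingHom.id_apply, ← algebraMap_smul_eq, smul_eq_env, map_smul, smul_eq_mul, swap_mul,
      swap_tmul, mul_smul, unop_one, ← op_smul_eq_env]
    have h : op (algebraMap k C c) • F.mono 0 1 = c • F.mono 0 1 :=
      algebraMap_smul Cᵐᵒᵖ c (F.mono 0 1)
    rw [h, env_smul_comm]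

variable {n : ℕ} (φ : bar F.Y n →ₗ[Enveloping k C] Enveloping k C)

theorem traceMap_smul (c : C) (b : bar F.Y n) :
    traceMap φ (c • b) = swap (φ b) • op c • F.mono 0 1 := by
  change swap (φ (c • b)) • F.mono 0 1 = _
  rw [smul_eq_env, map_smul, smul_eq_mul, swap_mul, swap_tmul, mul_smul, unop_one, ← op_smul_eq_env]

theorem traceMap_op_smul (c : C) (b : bar F.Y n) :
    traceMap φ (op c • b) = swap (φ b) • c • F.mono 0 1 := by
  change swap (φ (op c • b)) • F.mono 0 1 = _
  rw [op_smul_eq_env, map_smul, smul_eq_mul, swap_mul, swap_tmul, mul_smul, op_one, unop_op,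
    ← smul_eq_env]

/-- `T⁰` commutes with `A`, but not with all of `C`: for `c` of degree `m`, `T⁰ c = c Tᵐ`. Hence the
trace property over `A` only. -/
theorem traceMap_incl (a : A) (b : bar F.Y n) :
    traceMap φ (F.incl a • b) = traceMap φ (op (F.incl a) • b) := by
  rw [traceMap_smul, traceMap_op_smul, op_smul_mono (isHom_incl a), smul_mono, mul_one, one_mul,
    add_zero]

variable {P : ProjRes (diagonalModule k A)}

theorem indRes_aug (x : P.X 0) :
    (F.indRes P).aug (F.indι P 0 x) = F.mono 0 (F.incl (undiag k A (P.aug x))) :=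
  (congrArg F.indEquiv (Ind.map_ι P.aug x)).trans (indEquiv_ι (undiag k A (P.aug x)))

variable [Module.Projective k A]

variable (k A) in
/-- The bar resolution of `A`. -/
noncomputable def barResUnit : ProjRes (diagonalModule k A) := barRes (unit k A)

variable (F) in
/-- The bar resolution of `Y`. -/
noncomputable def barResY : ProjRes (ModuleCat.of (Enveloping k C) F.Y) :=
  have := F.projective_base
  barRes F.Y

/-- An element of the bar resolution of `A`, seen in the bar complex. -/
def ofBarRes {n : ℕ} (x : (barResUnit k A).X n) : bar (unit k A) (n + 1) := x

variable (F) in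
/-- An element of the bar complex of `Y`, seen in the bar resolution. -/
def toBarRes {n : ℕ} (b : bar F.Y (n + 1)) : F.barResY.X n := b

theorem barResY_d (n : ℕ) (b : bar F.Y (n + 2)) :
    F.barResY.d n (F.toBarRes b) = F.toBarRes (barD _ (n + 1) b) := rfl

theorem ofBarRes_d (n : ℕ) (x : (barResUnit k A).X (n + 1)) :
    ofBarRes ((barResUnit k A).d n x) = barD _ (n + 1) (ofBarRes x) := rfl

variable (F) in
/-- The components of the comparison with the bar resolution. -/
noncomputable def compareAux (γ : ProjRes.Lift P (barResUnit k A) LinearMap.id) (n : ℕ) :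
    (F.indRes P).X n →ₗ[Enveloping k C] F.barResY.X n :=
  F.indLift (H := bar F.Y (n + 1)) ((F.barInclEnv (n + 1)).comp (γ.f n))

theorem compareAux_indι (γ : ProjRes.Lift P (barResUnit k A) LinearMap.id) (n : ℕ) (x : P.X n) :
    F.compareAux γ n (F.indι P n x) = F.toBarRes (F.barIncl (n + 1) (ofBarRes (γ.f n x))) :=
  indLift_indι (H := bar F.Y (n + 1)) _ x

theorem aug_toBarRes (γ : ProjRes.Lift P (barResUnit k A) LinearMap.id) (x : P.X 0) :
    F.barResY.aug (F.toBarRes (F.barIncl 1 (ofBarRes (γ.f 0 x)))) =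
      F.mono 0 (F.incl (undiag k A (P.aug x))) :=
  (barD_barIncl 0 (ofBarRes (γ.f 0 x))).trans (congrArg (F.barIncl 0) (γ.comm_aug x))

variable (F) in
/-- The comparison with the bar resolution of `Y` given by one with the bar resolution of `A`. -/
noncomputable def compare (γ : ProjRes.Lift P (barResUnit k A) LinearMap.id) :
    ProjRes.Lift (F.indRes P) F.barResY LinearMap.id where
  f := F.compareAux γ
  comm n x := by
    have h : F.barResY.d n ∘ₗ F.compareAux γ (n + 1) = F.compareAux γ n ∘ₗ (F.indRes P).d n :=
      indRes_hom_ext fun x => by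
        rw [LinearMap.comp_apply, LinearMap.comp_apply, indRes_d, compareAux_indι, compareAux_indι,
          barResY_d, barD_barIncl, ← ofBarRes_d, γ.comm]
    exact LinearMap.congr_fun h x
  comm_aug x := by
    have h : F.barResY.aug ∘ₗ F.compareAux γ 0 = (F.indRes P).aug :=
      indRes_hom_ext fun x => by
        rw [LinearMap.comp_apply, compareAux_indι, indRes_aug]
        exact aug_toBarRes γ x
    exact LinearMap.congr_fun h x

variable (F) in
/-- The shift on the bar resolution of `Y`. -/
noncomputable def shiftLift : ProjRes.Lift F.barResY F.barResY (F.shift 1) :=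
  have := F.projective_base
  barLiftRes (F.shift 1)

theorem shiftLift_f (n : ℕ) (b : bar F.Y (n + 1)) :
    F.shiftLift.f n (F.toBarRes b) = F.toBarRes (barMap (F.shift 1) (n + 1) b) := rfl

namespace Duality

open CategoryTheory (Abelian.Ext)

variable {d : ℕ} (D : Duality F P d) [∀ n, Module.Finite (Enveloping k A) (P.X n)]

/-- Let `z_i` be the images of the `p_i` in the bar resolution. The left side evaluates the trace on
the `u_i T z_i`, the right side on the `z_i u_i`. By `exists_slide` the difference is the sum of the
`β(u_i, ∂ z_i)`, which is the value of a balanced map on the boundary of the fundamental cycle. -/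
theorem ev_shift (γ : ProjRes.Lift P (barResUnit k A) LinearMap.id)
    (f : F.barResY.X d →ₗ[Enveloping k C] Enveloping k C) (hf : f ∘ₗ F.barResY.d d = 0) :
    D.ev (f ∘ₗ F.shiftLift.f d ∘ₗ F.compareAux γ d) =
      F.shift (-1) (D.ev (f ∘ₗ F.compareAux γ d)) := by
  let φ : bar F.Y (d + 1) →ₗ[Enveloping k C] Enveloping k C := f
  have hφ : ∀ b, f (F.toBarRes b) = φ b := fun _ => rfl
  have hd : ∀ b, traceMap φ (barD _ (d + 1) b) = 0 := fun b => by
    have h : φ (barD _ (d + 1) b) = 0 := LinearMap.congr_fun hf b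
    change swap (φ (barD _ (d + 1) b)) • F.mono 0 1 = 0
    rw [h, map_zero]
    exact zero_smul (Enveloping k C) (F.mono 0 1)
  obtain ⟨β, hadd, hl, hr, h0, hβ⟩ := exists_slide d (traceMap φ) (traceMap_incl φ) hd
  let z : Fin D.r → bar (unit k A) (d + 1) := fun i => ofBarRes (γ.f d (D.p i))
  have h1 : D.ev (f ∘ₗ F.shiftLift.f d ∘ₗ F.compareAux γ d) =
      ∑ i, traceMap φ (F.twist (F.toRes.symm (D.u i)) (d + 1) (z i)) := by
    refine Finset.sum_congr rfl fun i _ => ?_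
    rw [LinearMap.comp_apply, LinearMap.comp_apply, compareAux_indι, shiftLift_f, hφ, twist_apply,
      traceMap_smul, op_smul_mono (D.isHom i), one_mul, zero_add]
    rfl
  have h2 : F.shift (-1) (D.ev (f ∘ₗ F.compareAux γ d)) =
      ∑ i, traceMap φ (op (F.toRes.symm (D.u i)) • F.barIncl (d + 1) (z i)) := by
    refine (map_sum (F.shift (-1)) _ _).trans (Finset.sum_congr rfl fun i _ => ?_)
    rw [LinearMap.comp_apply, compareAux_indι, hφ, traceMap_op_smul, map_smul, smul_mono, mul_one]
    refine congrArg (swap (φ (F.barIncl (d + 1) (z i))) • ·) ?_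
    exact shift_mono (-1) 1 _
  rw [h1, h2, Finset.sum_congr rfl fun i _ => hβ _ (D.isHom i) (z i), Finset.sum_add_distrib]
  -- Only the error term remains. In degree zero it vanishes because `β = 0`, in positive degree by
  -- `sum_balanced`.
  refine add_eq_left.2 ?_
  cases d with
  | zero =>
    rw [h0 rfl]
    exact Finset.sum_eq_zero fun _ _ => rfl
  | succ n =>
    let b : F.res →+ P.X n →+ F.Y := AddMonoidHom.mk' (fun u => AddMonoidHom.mk'
      (fun q => β (F.toRes.symm u) (ofBarRes (γ.f n q)))
      fun q q' => by
        rw [map_add]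
        exact map_add (β (F.toRes.symm u)) _ _)
      fun u u' => AddMonoidHom.ext fun q => by
        change β (F.toRes.symm (u + u')) _ = β (F.toRes.symm u) _ + β (F.toRes.symm u') _
        rw [map_add, hadd]
    refine Eq.trans ?_ (D.sum_balanced b fun s u q => ?_)
    · refine Finset.sum_congr rfl fun i _ => ?_
      change β _ (barD _ (n + 1) (ofBarRes (γ.f (n + 1) (D.p i)))) =
        β _ (ofBarRes (γ.f n (P.d n (D.p i))))
      rw [← ofBarRes_d, γ.comm]
    · induction s using Enveloping.induction with
      | tmul x y =>
        change β (F.incl y.unop * (F.toRes.symm u * F.incl x)) (ofBarRes (γ.f n q)) =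
          β (F.toRes.symm u) (ofBarRes (γ.f n ((x ⊗ₜ[k] y : Enveloping k A) • q)))
        rw [hr, hl, map_smul (γ.f n)]
        rfl
      | add s t hs ht =>
        rw [map_add, add_smul, map_add, AddMonoidHom.add_apply, hs, ht, add_smul, map_add]

/-- Classes may be represented on the bar resolution of `Y`, where `T` has an explicit lift;
`compare` covers the identity and transports the result to the induced resolution. -/
theorem evLinear_shift (e : ExtY F d) :
    D.evLinear ((Abelian.Ext.mk₀ (ModuleCat.ofHom (F.shift 1))).comp e (zero_add d)) =
      F.shift (-1) (D.evLinear e) := by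
  obtain ⟨γ⟩ := ProjRes.exists_lift P (barResUnit k A) LinearMap.id
  have key : ∀ (f : F.barResY.X d →ₗ[Enveloping k C] Enveloping k C)
      (hf : f ∘ₗ F.barResY.d d = 0), D.evLinear (F.barResY.outerCls f hf) =
        D.ev (f ∘ₗ F.compareAux γ d) := fun f hf => by
    have h := (F.compare γ).cls_comp (N := outerModule k C) f hf
    have h' : (Abelian.Ext.mk₀ (ModuleCat.ofHom (LinearMap.id :
        ModuleCat.of (Enveloping k C) F.Y →ₗ[Enveloping k C] _))).comp
        (F.barResY.outerCls f hf) (zero_add d) = F.barResY.outerCls f hf :=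
      Abelian.Ext.mk₀_id_comp _
    exact (congrArg D.evLinear (h'.symm.trans h)).trans (D.evLinear_outerCls _)
  obtain ⟨f, hf, rfl⟩ := ProjRes.outerCls_surjective (P := F.barResY) e
  have h1 := F.shiftLift.cls_comp (N := outerModule k C) f hf
  refine (congrArg D.evLinear h1).trans ?_
  refine (key (f ∘ₗ F.shiftLift.f d) _).trans ?_
  rw [key f hf, ← D.ev_shift γ f hf]
  rfl

end Duality

end Frame

end

/-! ### The long exact sequence of `0 → Y → Y → C → 0`. -/

section

namespace Frame

open CategoryTheory (ShortComplex)
open CategoryTheory.Abelian (Ext)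

variable {k A C : Type u} [CommRing k] [Ring A] [Algebra k A] [Ring C] [Algebra k C]
  (F : Frame k A C)

/-- The bimodule `Y` as a module over the enveloping algebra. -/
noncomputable abbrev yModule : ModuleCat.{u} (Enveloping k C) := ModuleCat.of (Enveloping k C) F.Y

/-- Multiplication by `T` on `Y`. -/
noncomputable def shiftHom : F.yModule ⟶ F.yModule := ModuleCat.ofHom (F.shift 1)

/-- The multiplication `Y → C`. -/
noncomputable def multHom : F.yModule ⟶ diagonalModule k C :=
  (ModuleCat.ofHom F.mult : F.yModule ⟶ ModuleCat.of (Enveloping k C) (Bimodule.unit k C))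

theorem sub_shiftHom_comp_multHom :
    CategoryTheory.CategoryStruct.comp (CategoryTheory.CategoryStruct.id F.yModule - F.shiftHom)
      F.multHom = 0 := by
  apply ModuleCat.hom_ext
  refine LinearMap.ext fun y => ?_
  exact (mult_exact (F := F)).apply_apply_eq_zero y

/-- The sequence `0 → Y → Y → C → 0` whose first map is `1 - T`. -/
noncomputable def sequence : ShortComplex (ModuleCat.{u} (Enveloping k C)) :=
  ShortComplex.mk (CategoryTheory.CategoryStruct.id F.yModule - F.shiftHom) F.multHom
    F.sub_shiftHom_comp_multHom

theorem sequence_shortExact : F.sequence.ShortExact where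
  exact := (ShortComplex.ShortExact.moduleCat_exact_iff_function_exact _).2
    (fun y => mult_exact (F := F) y)
  mono_f := by
    refine (ModuleCat.mono_iff_injective _).2 ((injective_iff_map_eq_zero _).2
      fun (y : F.Y) hy => ?_)
    have h : y - F.shift 1 y = 0 := hy
    exact eq_zero_of_shift_eq (sub_eq_zero.1 h).symm
  epi_g := (ModuleCat.epi_iff_surjective _).2 (mult_surjective (F := F))

variable {F}

theorem sequence_f_comp {i : ℕ} {N : ModuleCat.{u} (Enveloping k C)} (e : Ext.{u} F.yModule N i) :
    (Ext.mk₀ F.sequence.f).comp e (zero_add i) =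
      e - (Ext.mk₀ F.shiftHom).comp e (zero_add i) := by
  change (Ext.mk₀ (CategoryTheory.CategoryStruct.id F.yModule - F.shiftHom)).comp e (zero_add i) = _
  rw [eq_sub_iff_add_eq, ← Ext.add_comp, ← Ext.mk₀_add, sub_add_cancel, Ext.mk₀_id_comp]

theorem shift_neg_one_sub (y : F.Y) :
    F.mult (y - F.shift (-1) y) = 0 := by
  rw [map_sub, mult_shift, sub_self]

theorem exists_sub_shift_neg_one {y : F.Y} (hy : F.mult y = 0) : ∃ z, z - F.shift (-1) z = y := by
  obtain ⟨z, rfl⟩ := (mult_exact y).1 hy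
  refine ⟨-F.shift 1 z, ?_⟩
  rw [map_neg, shift_shift, add_neg_cancel, shift_zero]
  exact (neg_sub_neg _ _)

variable {P : ProjRes (diagonalModule k A)} {d : ℕ}

namespace Duality

theorem subsingleton_extY {i : ℕ} [Module.Finite (Enveloping k A) (P.X i)]
    (hvan : ∀ f : P.X i →ₗ[Enveloping k A] Enveloping k A, f ∘ₗ P.d i = 0 → P.IsOuterCoboundary f) :
    Subsingleton (ExtY F i) :=
  (F.indRes P).subsingleton_iff.2 fun f hf => isOuterCoboundary_indRes hvan f hf

variable (D : Duality F P d)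

/-- The connecting homomorphism on `Y`. -/
noncomputable def connect :
    F.Y →ₗ[Enveloping k C] Ext.{u} (diagonalModule k C) (outerModule k C) (d + 1) where
  toFun y := F.sequence_shortExact.extClass.comp (D.toExt y) (add_comm 1 d)
  map_add' y y' := by
    rw [map_add]
    exact Ext.comp_add _ _ _ _
  map_smul' t y := by
    rw [map_smul, RingHom.id_apply, ext_smul_def]
    exact (Ext.comp_assoc_of_third_deg_zero _ _ _ _).symm

theorem connect_apply (y : F.Y) :
    D.connect y = F.sequence_shortExact.extClass.comp (D.toExt y) (add_comm 1 d) := rfl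

/-- The next term of the long exact sequence, `Ext^{d+1}(Y, C ⊗ C)`, is zero, and `toExt` is
surjective. -/
theorem connect_surjective [∀ n, Module.Finite (Enveloping k A) (P.X n)]
    (hvan : ∀ i, i ≠ d → ∀ f : P.X i →ₗ[Enveloping k A] Enveloping k A, f ∘ₗ P.d i = 0 →
      P.IsOuterCoboundary f) : Function.Surjective D.connect := by
  intro x
  have := subsingleton_extY (F := F) (hvan (d + 1) (by lia))
  obtain ⟨x₁, hx₁⟩ := Ext.contravariant_sequence_exact₃ F.sequence_shortExact _ x
    (Subsingleton.elim (α := ExtY F (d + 1)) _ _) (add_comm 1 d)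
  obtain ⟨y, rfl⟩ := D.toExt_surjective x₁
  exact ⟨y, hx₁⟩

variable [Module.Projective k A] [∀ n, Module.Finite (Enveloping k A) (P.X n)]

/-- `evLinear_shift` transported to the other identification of `Ext^d(Y, C ⊗ C)` with `Y`; nothing
changes because powers of `T` commute. -/
theorem shift_toExt (y : F.Y) : (Ext.mk₀ F.shiftHom).comp (D.toExt y) (zero_add d) =
    D.toExt (F.shift (-1) y) := by
  apply D.evLinear_injective
  refine (D.evLinear_shift (D.toExt y)).trans ?_
  rw [evLinear_toExt, evLinear_toExt, shift_shift, shift_shift, add_comm]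

/-- By exactness the kernel is the image of `1 - T⁻¹` on `Y`. As `1 - T⁻¹` is `1 - T` up to a unit,
this is the kernel of the multiplication. -/
theorem connect_eq_zero_iff (y : F.Y) : D.connect y = 0 ↔ F.mult y = 0 := by
  rw [connect_apply]
  constructor
  · intro h
    obtain ⟨x, hx⟩ := Ext.contravariant_sequence_exact₁ F.sequence_shortExact _ _ _ h
    obtain ⟨z, rfl⟩ := D.toExt_surjective x
    have h1 := (sequence_f_comp (F := F) (D.toExt z)).symm.trans hx
    rw [shift_toExt, ← map_sub] at h1
    rw [← D.toExt_injective h1, shift_neg_one_sub]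
  · intro h
    obtain ⟨z, rfl⟩ := exists_sub_shift_neg_one h
    rw [map_sub, ← shift_toExt, ← sequence_f_comp]
    exact F.sequence_shortExact.extClass_comp_assoc _

/-- `Ext^i(C, C ⊗ C)` sits between `Ext^{i-1}(Y, C ⊗ C)` and `Ext^i(Y, C ⊗ C)`, which both vanish
unless `i` is `d` or `d + 1`. For `i = d` injectivity of `1 - T⁻¹` is needed. -/
theorem subsingleton_ext (D : Duality F P d)
    (hvan : ∀ i, i ≠ d → ∀ f : P.X i →ₗ[Enveloping k A] Enveloping k A, f ∘ₗ P.d i = 0 →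
      P.IsOuterCoboundary f) {i : ℕ} (hi : i ≠ d + 1) : Subsingleton (ExtGroup k C i) := by
  refine subsingleton_of_forall_eq 0 fun x => ?_
  have hx : (Ext.mk₀ F.sequence.g).comp x (zero_add i) = 0 := by
    by_cases h : i = d
    · subst h
      let e : ExtY F i := (Ext.mk₀ F.sequence.g).comp x (zero_add i)
      -- The class `e` is killed by `1 - T`. For `e = toExt y` this says `T⁻¹ y = y`, and a
      -- shift-invariant `y` is zero.
      have h1 : (Ext.mk₀ F.sequence.f).comp e (zero_add i) = 0 := by
        refine (Ext.mk₀_comp_mk₀_assoc F.sequence.f F.sequence.g _).trans ?_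
        have h0 : Ext.mk₀.{u}
            (CategoryTheory.CategoryStruct.comp F.sequence.f F.sequence.g) = 0 := by
          rw [F.sequence.zero, Ext.mk₀_zero]
        refine (congrArg (fun w : Ext.{u} F.sequence.X₁ F.sequence.X₃ 0 =>
          w.comp (show Ext.{u} F.sequence.X₃ (outerModule k C) i from x) (zero_add i)) h0).trans ?_
        exact Ext.zero_comp F.sequence.X₁ 0
          (show Ext.{u} F.sequence.X₃ (outerModule k C) i from x) _ _
      obtain ⟨y, hy⟩ := D.toExt_surjective e
      rw [← hy] at h1
      have h2 := (sequence_f_comp (F := F) (D.toExt y)).symm.trans h1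
      rw [shift_toExt, ← map_sub] at h2
      have h3 := sub_eq_zero.1 (D.toExt_injective (h2.trans (map_zero D.toExt).symm))
      have h4 : y = 0 := eq_zero_of_shift_eq (by
        conv_lhs => rw [h3, shift_shift, neg_add_cancel, shift_zero])
      change e = 0
      rw [← hy, h4, map_zero]
    · have := subsingleton_extY (F := F) (hvan i h)
      exact Subsingleton.elim (α := ExtY F i) _ _
  -- In degree zero, precomposition with an epimorphism is injective. Otherwise `x` comes from the
  -- previous `Ext` of `Y`, which is zero because `i ≠ d + 1`.
  cases i with
  | zero =>
    have := F.sequence_shortExact.epi_g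
    exact Ext.precomp_mk₀_injective_of_epi _ F.sequence.g
      (hx.trans (Ext.comp_zero _ _ _ _ (zero_add 0)).symm)
  | succ n =>
    have := subsingleton_extY (F := F) (hvan n (by lia))
    obtain ⟨x₁, rfl⟩ := Ext.contravariant_sequence_exact₃ F.sequence_shortExact _ x hx
      (add_comm 1 n)
    have h1 : x₁ = 0 := Subsingleton.elim (α := ExtY F n) _ _
    rw [h1]
    exact Ext.comp_zero _ _ _ _ _

end Duality

end Frame

end

/-- A linear isomorphism over the enveloping algebra from `Ext` to `A` is one of bimodules. -/
noncomputable def Bimodule.isoOfExtEquiv {k C : Type u} [CommRing k] [Ring C] [Algebra k C] {i : ℕ}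
    (e : CategoryTheory.Abelian.Ext.{u} (diagonalModule k C) (outerModule k C) i
      ≃ₗ[Enveloping k C] Bimodule.unit k C) :
    Bimodule.Iso (extBimodule k C i) (Bimodule.unit k C) where
  toFun := e
  invFun := e.symm
  left_inv := e.left_inv
  right_inv := e.right_inv
  map_add' := e.map_add
  map_smul' c m := by
    refine (e.map_smul (algebraMap k (Enveloping k C) c) m).trans ?_
    exact (Bimodule.smul_eq_env _ (algebraMap k C c) (e m)).symm.trans (algebraMap_smul C c (e m))
  map_left a m := (e.map_smul (a ⊗ₜ[k] (1 : Cᵐᵒᵖ)) m).trans (Bimodule.smul_eq_env _ _ _).symm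
  map_right a m := (e.map_smul ((1 : C) ⊗ₜ[k] op a) m).trans (Bimodule.op_smul_eq_env _ _ _).symm

namespace Frame.Duality

variable {k A C : Type u} [CommRing k] [Ring A] [Algebra k A] [Module.Projective k A] [Ring C]
  [Algebra k C] {F : Frame k A C} {P : ProjRes (diagonalModule k A)} {d : ℕ}
  [∀ n, Module.Finite (Enveloping k A) (P.X n)]

/-- The connecting map and the multiplication are surjections from `Y` with the same kernel. -/
theorem nonempty_iso (D : Duality F P d)
    (hvan : ∀ i, i ≠ d → ∀ f : P.X i →ₗ[Enveloping k A] Enveloping k A, f ∘ₗ P.d i = 0 →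
      P.IsOuterCoboundary f) :
    Nonempty (Bimodule.Iso (extBimodule k C (d + 1)) (Bimodule.unit k C)) := by
  have hker : LinearMap.ker D.connect = LinearMap.ker F.mult :=
    Submodule.ext fun y => D.connect_eq_zero_iff y
  exact ⟨Bimodule.isoOfExtEquiv
    ((D.connect.quotKerEquivOfSurjective (D.connect_surjective hvan)).symm ≪≫ₗ
      Submodule.quotEquivOfEq _ _ hker ≪≫ₗ F.mult.quotKerEquivOfSurjective mult_surjective)⟩

end Frame.Duality

/-! ### Duality data from a finite resolution of `A`, and the conclusion. -/

namespace Bimodule.Inverse.Laurent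

open Enveloping

variable {k A : Type u} [CommRing k] [Ring A] [Algebra k A]

section

variable {d : ℕ} (D : Inverse (extBimodule k A d))

/-- The element of degree one of the Laurent algebra given by a class in `Ext`. -/
noncomputable def ofExt : ExtGroup k A d →+ (frame D).res where
  toFun e := (frame D).toRes (inU D (show extBimodule k A d from e))
  map_zero' := by
    have h := inU_add (D := D) 0 0
    rw [add_zero] at h
    exact left_eq_add.1 h
  map_add' e e' := inU_add (D := D) e e'

theorem ofExt_injective : Function.Injective (ofExt D) :=
  fun _ _ h => inU_injective ((frame D).toRes.injective h)

theorem isHom_ofExt (e : ExtGroup k A d) : (frame D).IsHom 1 ((frame D).toRes.symm (ofExt D e)) :=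
  frame_isHom_inU (D := D) e

theorem exists_ofExt_eq {c : D.Laurent} (hc : (frame D).IsHom 1 c) :
    ∃ e, ofExt D e = (frame D).toRes c := by
  obtain ⟨u, rfl⟩ := exists_inU c hc
  exact ⟨u, rfl⟩

theorem ofExt_smul (s : Enveloping k A)
    (e : CategoryTheory.Abelian.Ext.{u} (diagonalModule k A) (outerModule k A) d) :
    ofExt D (s • e) = s • ofExt D e := by
  induction s using Enveloping.induction with
  | tmul a b =>
    obtain ⟨b, rfl⟩ := op_surjective b
    have h : ((a ⊗ₜ[k] op b : Enveloping k A)) • e =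
        (a ⊗ₜ[k] (1 : Aᵐᵒᵖ) : Enveloping k A) • (((1 : A) ⊗ₜ[k] op b : Enveloping k A) • e) := by
      rw [← mul_smul, Algebra.TensorProduct.tmul_mul_tmul, one_mul, mul_one]
    rw [h]
    refine (congrArg (frame D).toRes (inU_smul (D := D) a _)).trans ?_
    refine (congrArg (fun x => (frame D).toRes (inclHom D a * x))
      (inU_op_smul (D := D) b _)).trans ?_
    rfl
  | add s t hs ht => rw [add_smul, map_add, hs, ht, add_smul]

/-- The duality data given by a finite resolution of `A`. -/
theorem nonempty_duality (P : ProjRes (diagonalModule k A))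
    [∀ n, Module.Finite (Enveloping k A) (P.X n)] {m : ℕ} (hm : ∀ n, m < n → Subsingleton (P.X n))
    (hvan : ∀ i, i ≠ d → ∀ f : P.X i →ₗ[Enveloping k A] Enveloping k A, f ∘ₗ P.d i = 0 →
      P.IsOuterCoboundary f) : Nonempty (Frame.Duality (frame D) P d) := by
  obtain ⟨r, p, φ, hφ, hexp⟩ := P.exists_dual_cocycles hm
    (fun n hn f hf => hvan n hn.ne' f hf)
  -- By the dual basis, `f` is the sum of the `φ_i` multiplied on the right by `f (p_i)`. On classes
  -- this is the inner action of `swap (f (p_i))`, so the total of `f` is the class of `f` itself,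
  -- seen in degree one.
  have key : ∀ (f : P.X d →ₗ[Enveloping k A] Enveloping k A) (hf : f ∘ₗ P.d d = 0),
      ∑ i, swap (f (p i)) • ofExt D (P.outerCls (φ i) (hφ i)) = ofExt D (P.outerCls f hf) := by
    intro f hf
    have h : f = ∑ i, P.rmul (φ i) (f (p i)) := by
      refine LinearMap.ext fun x => ?_
      rw [LinearMap.sum_apply]
      exact hexp f hf x
    have h1 : P.outerCls f hf = ∑ i, swap (f (p i)) • P.outerCls (φ i) (hφ i) := by
      refine (ProjRes.outerCls_congr h hf
        (ProjRes.sum_comp_d _ fun i => ProjRes.rmul_comp_d (hφ i) _)).trans ?_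
      rw [ProjRes.outerCls_sum _ fun i => ProjRes.rmul_comp_d (hφ i) _]
      refine Finset.sum_congr rfl fun i _ => ?_
      rw [ProjRes.smul_outerCls]
      exact ProjRes.outerCls_congr (by rw [swap_swap]) _ _
    rw [h1, map_sum]
    exact Finset.sum_congr rfl fun i _ => (ofExt_smul D _ _).symm
  exact ⟨{
    r := r
    p := p
    φ := φ
    u := fun i => ofExt D (P.outerCls (φ i) (hφ i))
    cocycle := hφ
    isHom := fun i => isHom_ofExt D _
    expand := hexp
    sum_eq_zero_iff := fun f hf => by
      rw [key f hf, map_eq_zero_iff _ (ofExt_injective D)]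
      exact ProjRes.outerCls_eq_zero_iff hf
    exists_sum_eq := fun c hc => by
      obtain ⟨e, he⟩ := exists_ofExt_eq D hc
      obtain ⟨f, hf, rfl⟩ := ProjRes.outerCls_surjective (P := P) e
      exact ⟨f, hf, (key f hf).trans he⟩ }⟩

end

theorem isCalabiYau [Module.Projective k A] {d : ℕ} (hA : HasVanDenBerghDuality k A d)
    (D : Inverse (extBimodule k A d)) : IsCalabiYau k D.Laurent (d + 1) := by
  obtain ⟨Q, hfin, m, hm⟩ := hA.good
  let P := ProjRes.ofResolution Q
  have : ∀ n, Module.Finite (Enveloping k A) (P.X n) := hfin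
  have hvan : ∀ i, i ≠ d → ∀ f : P.X i →ₗ[Enveloping k A] Enveloping k A, f ∘ₗ P.d i = 0 →
      P.IsOuterCoboundary f := fun i hi => P.subsingleton_iff.1 (hA.vanishing i hi)
  obtain ⟨E⟩ := nonempty_duality D P (fun n hn => ModuleCat.subsingleton_of_isZero (hm n hn)) hvan
  exact ⟨(frame D).hasGoodResolution hA.good, fun i hi => E.subsingleton_ext hvan hi,
    E.nonempty_iso hvan⟩

end Bimodule.Inverse.Laurent

theorem mainTheorem2 {k A : Type u} [CommRing k] [Ring A] [Algebra k A] [Module.Projective k A]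
    (d : ℕ) (hA : HasVanDenBerghDuality k A d) :
    Nonempty (Bimodule.Inverse (extBimodule k A d)) ∧
      ∀ D : Bimodule.Inverse (extBimodule k A d), IsCalabiYau k D.Laurent (d + 1) :=
  ⟨hA.invertible.nonempty_inverse, fun D => Bimodule.Inverse.Laurent.isCalabiYau hA D⟩
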